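/- For a rooted tree, let its degree be the maximum number of children of a vertex and its height the maximum number of edges on a path from the root to a vertex. Subtree Isomorphism on two rooted, unordered trees $H, G$ asks whether there is an injective map from the vertices of $H$ to the vertices of $G$ that maps edges to edges and the root of $H$ to the root of $G$. The Strong Exponential Time Hypothesis (SETH) says that for every $\varepsilon > 0$ there is a $k$ such that no algorithm solves $k$-SAT on $n$ variables in time $O(2^{(1-\varepsilon) n}\,\mathrm{poly}(n))$. Algorithms are deterministic random access machines with logarithmic cost. Theorem. Assume SETH. Then for every integer $d \ge 2$ there is a constant $C > 0$ such that for every $\varepsilon > 0$ no algorithm solves, in time $O(n^{2-\varepsilon})$, Subtree Isomorphism on all pairs of rooted, unordered trees $H, G$ that have $n$ vertices in total, degree at most $d$, and height at most $2\log_d n + C \log\log n$. In particular, under SETH, Subtree Isomorphism on two rooted, unordered trees with altogether $n$ vertices has no $O(n^{2-\varepsilon})$ algorithm for any $\varepsilon > 0$. -/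

import Mathlib

namespace SubtreeLB

/-! ## Random access machines with logarithmic cost

A machine has registers `R 0, R 1, …`, which a program addresses directly (so that each program
uses finitely many of them), and a memory `M 0, M 1, …`, which it addresses through registers.
All of them hold natural numbers.  An instruction costs `1` plus the total bit length of the
numbers and addresses that it handles, which is the usual logarithmic cost measure: it agrees,
up to polylogarithmic factors, with unit cost on a machine with words of logarithmic length. -/

/-- The contents of registers and memory. -/
structure State where
  reg : ℕ → ℕ
  mem : ℕ → ℕ

/-- Assignment to a register. -/
def State.setReg (s : State) (i x : ℕ) : State := { s with reg := Function.update s.reg i x }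

/-- Assignment to a memory cell. -/
def State.setMem (s : State) (a x : ℕ) : State := { s with mem := Function.update s.mem a x }

/-- Instructions. Subtraction is truncated at `0`, division rounds down, and `x / 0 = 0`. -/
inductive Instr
  /-- `R i := c` -/
  | const (i c : ℕ)
  /-- `R i := R j + R k` -/
  | add (i j k : ℕ)
  /-- `R i := R j - R k` -/
  | sub (i j k : ℕ)
  /-- `R i := R j * R k` -/
  | mul (i j k : ℕ)
  /-- `R i := R j / R k` -/
  | div (i j k : ℕ)
  /-- `R i := M (R j)` -/
  | load (i j : ℕ)
  /-- `M (R i) := R j` -/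
  | store (i j : ℕ)

/-- The effect of an instruction. -/
def Instr.apply : Instr → State → State
  | .const i c, s => s.setReg i c
  | .add i j k, s => s.setReg i (s.reg j + s.reg k)
  | .sub i j k, s => s.setReg i (s.reg j - s.reg k)
  | .mul i j k, s => s.setReg i (s.reg j * s.reg k)
  | .div i j k, s => s.setReg i (s.reg j / s.reg k)
  | .load i j, s => s.setReg i (s.mem (s.reg j))
  | .store i j, s => s.setMem (s.reg i) (s.reg j)

/-- The logarithmic cost of an instruction (`Nat.size` is the length in binary). -/
def Instr.cost : Instr → State → ℕ
  | .const _ c, _ => 1 + c.size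
  | .add _ j k, s => 1 + (s.reg j).size + (s.reg k).size
  | .sub _ j k, s => 1 + (s.reg j).size + (s.reg k).size
  | .mul _ j k, s => 1 + (s.reg j).size + (s.reg k).size
  | .div _ j k, s => 1 + (s.reg j).size + (s.reg k).size
  | .load _ j, s => 1 + (s.reg j).size + (s.mem (s.reg j)).size
  | .store i j, s => 1 + (s.reg i).size + (s.reg j).size

/-- Programs, with structured control flow (jumps between finitely many labels are simulated
with a constant factor overhead, by a label register and one loop). -/
inductive Prog
  | skip
  | instr (a : Instr)
  | seq (p q : Prog)
  /-- if `R i ≠ 0` then `p` else `q` -/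
  | ite (i : ℕ) (p q : Prog)
  /-- while `R i ≠ 0` do `p` -/
  | loop (i : ℕ) (p : Prog)

/-- `Exec p s s' t`: started in state `s`, the program `p` halts in state `s'` after time `t`. -/
inductive Exec : Prog → State → State → ℕ → Prop
  | skip (s : State) : Exec .skip s s 0
  | instr (a : Instr) (s : State) : Exec (.instr a) s (a.apply s) (a.cost s)
  | seq {p q : Prog} {s₁ s₂ s₃ : State} {t u : ℕ} :
      Exec p s₁ s₂ t → Exec q s₂ s₃ u → Exec (.seq p q) s₁ s₃ (t + u)
  | ite_true {i : ℕ} {p q : Prog} {s₁ s₂ : State} {t : ℕ} : s₁.reg i ≠ 0 →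
      Exec p s₁ s₂ t → Exec (.ite i p q) s₁ s₂ (1 + (s₁.reg i).size + t)
  | ite_false {i : ℕ} {p q : Prog} {s₁ s₂ : State} {t : ℕ} : s₁.reg i = 0 →
      Exec q s₁ s₂ t → Exec (.ite i p q) s₁ s₂ (1 + t)
  | loop_done {i : ℕ} {p : Prog} {s : State} : s.reg i = 0 → Exec (.loop i p) s s 1
  | loop_step {i : ℕ} {p : Prog} {s₁ s₂ s₃ : State} {t u : ℕ} : s₁.reg i ≠ 0 →
      Exec p s₁ s₂ t → Exec (.loop i p) s₂ s₃ u →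
      Exec (.loop i p) s₁ s₃ (1 + (s₁.reg i).size + t + u)

/-- The machine is deterministic. -/
theorem Exec.deterministic {p : Prog} {s s₁ s₂ : State} {t₁ t₂ : ℕ}
    (h₁ : Exec p s s₁ t₁) (h₂ : Exec p s s₂ t₂) : s₁ = s₂ ∧ t₁ = t₂ := by
  induction h₁ generalizing s₂ t₂ with
  | skip | instr => cases h₂; exact ⟨rfl, rfl⟩
  | seq _ _ ih ih' =>
    cases h₂ with
    | seq a b => obtain ⟨rfl, rfl⟩ := ih a; obtain ⟨rfl, rfl⟩ := ih' b; exact ⟨rfl, rfl⟩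
  | ite_true h _ ih =>
    cases h₂ with
    | ite_true _ a => obtain ⟨rfl, rfl⟩ := ih a; exact ⟨rfl, rfl⟩
    | ite_false k _ => exact absurd k h
  | ite_false h _ ih =>
    cases h₂ with
    | ite_true k _ => exact absurd h k
    | ite_false _ a => obtain ⟨rfl, rfl⟩ := ih a; exact ⟨rfl, rfl⟩
  | loop_done h =>
    cases h₂ with
    | loop_done _ => exact ⟨rfl, rfl⟩
    | loop_step k _ _ => exact absurd h k
  | loop_step h _ _ ih ih' =>
    cases h₂ with
    | loop_done k => exact absurd k h
    | loop_step _ a b => obtain ⟨rfl, rfl⟩ := ih a; obtain ⟨rfl, rfl⟩ := ih' b; exact ⟨rfl, rfl⟩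

/-- The state in which a computation on the input `w` starts: the input is in the first memory
cells, its length is in register `0`, and everything else is `0`. -/
def startState (w : List ℕ) : State where
  reg i := if i = 0 then w.length else 0
  mem a := w.getD a 0

/-- The program `p` decides, for every instance `x : ι`, given as the input `enc x`, whether
`Yes x` holds, and it does so within time `T x`. The answer is whether register `0` is nonzero. -/
def SolvesInTime {ι : Type} (p : Prog) (enc : ι → List ℕ) (Yes : ι → Prop) (T : ι → ℝ) : Prop :=
  ∀ x : ι, ∃ (s : State) (t : ℕ),
    Exec p (startState (enc x)) s t ∧ (t : ℝ) ≤ T x ∧ (s.reg 0 ≠ 0 ↔ Yes x)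

/-! ## The Strong Exponential Time Hypothesis -/

/-- A literal over the variables `Fin n`: the variable and the value that makes it true. -/
abbrev Literal (n : ℕ) : Type := Fin n × Bool

/-- An instance of `k`-SAT on `n` variables: a set (listed without repetition) of clauses with at
most `k` literals each. -/
structure KCNF (k n : ℕ) where
  clauses : List (List (Literal n))
  width_le : ∀ c ∈ clauses, c.length ≤ k
  nodup : clauses.Nodup

/-- Satisfiability. -/
def KCNF.Satisfiable {k n : ℕ} (φ : KCNF k n) : Prop :=
  ∃ a : Fin n → Bool, ∀ c ∈ φ.clauses, ∃ l ∈ c, a l.1 = l.2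

/-- A literal as a number: `2 * x + 1` for the variable `x` and `2 * x` for its negation. -/
def Literal.code {n : ℕ} (l : Literal n) : ℕ := 2 * (l.1 : ℕ) + l.2.toNat

/-- The input for a formula: the number of variables, the number of clauses, and for each clause
its length and its literals. -/
def KCNF.encode {k n : ℕ} (φ : KCNF k n) : List ℕ :=
  n :: φ.clauses.length :: φ.clauses.flatMap fun c => c.length :: c.map Literal.code

/-- SETH: for every `ε > 0` there is a `k` such that `k`-SAT on `n` variables cannot be solved in
time `2 ^ ((1 - ε) * n) * poly n`. -/
def SETH : Prop :=
  ∀ ε : ℝ, 0 < ε → ∃ k : ℕ, ¬ ∃ (p : Prog) (q : Polynomial ℕ),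
    SolvesInTime (ι := Σ n : ℕ, KCNF k n) p (fun x => x.2.encode) (fun x => x.2.Satisfiable)
      (fun x => (2 : ℝ) ^ ((1 - ε) * (x.1 : ℝ)) * ((q.eval x.1 : ℕ) : ℝ))

/-! ## Rooted unordered trees -/

/-- A finite rooted unordered tree with the vertices numbered `0, …, size - 1` (as they are when it
is given to a machine), described by its parent function
(by convention, the parent of the root is the root). -/
structure NumberedTree where
  size : ℕ
  root : Fin size
  parent : Fin size → Fin size
  parent_root : parent root = root
  reaches_root : ∀ v, ∃ k : ℕ, parent^[k] v = root

namespace NumberedTree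

/-- The underlying undirected graph: the edges join the vertices to their parents. -/
def graph (T : NumberedTree) : SimpleGraph (Fin T.size) :=
  SimpleGraph.fromRel fun u v => T.parent u = v

/-- The children of a vertex. -/
def children (T : NumberedTree) (v : Fin T.size) : Finset (Fin T.size) :=
  Finset.univ.filter fun u => u ≠ T.root ∧ T.parent u = v

/-- A tree of degree `d`: each vertex has at most `d` children (`d = 2` means binary). -/
def DegreeLE (T : NumberedTree) (d : ℕ) : Prop := ∀ v, (T.children v).card ≤ d

/-- The number of edges between a vertex and the root. -/
def depth (T : NumberedTree) (v : Fin T.size) : ℕ := Nat.find (T.reaches_root v)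

/-- The height: the largest depth of a vertex. -/
def height (T : NumberedTree) : ℕ := Finset.univ.sup T.depth

/-- `H` is isomorphic to a subtree of `G`, where the root of `H` goes to the root of `G`: there is
an injective map of the vertices that maps edges to edges and the root to the root. -/
def IsoToSubtree (H G : NumberedTree) : Prop :=
  ∃ f : SimpleGraph.Copy H.graph G.graph, f H.root = G.root

/-- A tree as an input: the number of vertices, followed by the array of parents. -/
def encode (T : NumberedTree) : List ℕ := T.size :: List.ofFn fun v => (T.parent v : ℕ)

end NumberedTree

/-- The instances of Subtree Isomorphism, i.e. pairs `(H, G)` of rooted trees, with altogether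
`n` vertices, of degree at most `d` and height at most `2 * log_d n + C * log (log n)`. -/
structure BoundedInstance (d : ℕ) (C : ℝ) where
  H : NumberedTree
  G : NumberedTree
  degree_H : H.DegreeLE d
  degree_G : G.DegreeLE d
  height_H : (H.height : ℝ) ≤ 2 * Real.logb d ((H.size + G.size : ℕ) : ℝ)
    + C * Real.log (Real.log ((H.size + G.size : ℕ) : ℝ))
  height_G : (G.height : ℝ) ≤ 2 * Real.logb d ((H.size + G.size : ℕ) : ℝ)
    + C * Real.log (Real.log ((H.size + G.size : ℕ) : ℝ))

/-- The total number of vertices. -/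
def BoundedInstance.numVerts {d : ℕ} {C : ℝ} (x : BoundedInstance d C) : ℕ := x.H.size + x.G.size

end SubtreeLB

open SubtreeLB

/-!
A satisfiability algorithm is obtained by splitting the variables into two halves, the variables of
even and of odd number. For a formula with `n` variables and `m` clauses, two trees are written
down, each with about `2 ^ (n / 2)` columns, one for each assignment to its half of the variables,
and with slots in each column for all clauses. The trees (`Shape`) are such that an embedding of the
first one into the second one consists of the choice of one column `i` of the first tree and one
column `i'` of the second tree, where each clause that is false under the partial assignment `i` has
to be true under `i'` (`Shape.isoToSubtree_iff`). Hence the first tree embeds if and only if the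
formula is satisfiable (`KCNF.satisfiable_iff`). As the trees have `2 ^ (n / 2)` vertices up to a
polynomial factor, an algorithm for Subtree Isomorphism in time `O(N ^ (2 - ε))` would decide
satisfiability in time `2 ^ ((1 - ε / 2) * n)`, up to a polynomial factor, for all `k`
(`solvesInTime_satProg`).

The choice of the columns works as follows. Both trees start with a complete `d`-ary tree with `N`
leaves. In the second tree, `N - 1` of these lead to one column each, which accepts every column of
the first tree, and the last one branches out to `N` columns, one for each partial assignment. As
the `N` leaves of the first tree have to be matched to the `N` leaves of the second tree, exactly
one column of the first tree is matched to a column that stands for an assignment. Below a column, a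
slot consists of a path with some leaves attached to it. The positions of the leaves encode the
label of the slot in binary, so that only slots with the same label match, and one more leaf encodes
the truth value of the clause. That leaf can be accommodated at the end of the longer path of the
second tree if the clause is true under the assignment of the first column; otherwise it needs a
leaf in the same position, which exists if the clause is true under the assignment of the second
column (`Shape.isoToSubtree_of_columns`, `Shape.columns_of_isoToSubtree`).

There are enough slots in each column for the height of the trees to be at most twice the logarithm
of their size (`reductionInstance`).

The rest of the argument is about machines. `Steps` measures time in units that cover a block of
instructions, `steps_tree` shows that a program writes the encoding of a tree, and `steps_reduction`
that the reduction ends in the state in which the machine would start on the two trees. The number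
of clauses is polynomial because they have bounded width and are not repeated
(`KCNF.length_clauses_le`).
-/

namespace SubtreeLB

/-! ### Trees given by a decreasing parent function -/

/-- The tree on `0, …, S - 1` with root `0` in which the parent `F v` of `v ≠ 0` has a smaller
number. -/
def NumberedTree.ofParent (S : ℕ) (F : ℕ → ℕ) (hS : 0 < S) (h0 : F 0 = 0)
    (hF : ∀ v < S, 0 < v → F v < v) : NumberedTree where
  size := S
  root := ⟨0, hS⟩
  parent v := ⟨F v, by
    rcases Nat.eq_zero_or_pos v.1 with h | h
    · rw [h, h0]; exact hS
    · exact (hF v v.2 h).trans v.2⟩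
  parent_root := by ext; exact h0
  reaches_root := by
    rintro ⟨v, hv⟩
    induction v using Nat.strong_induction_on with
    | _ v ih =>
      rcases Nat.eq_zero_or_pos v with rfl | h
      · exact ⟨0, rfl⟩
      · obtain ⟨k, hk⟩ := ih (F v) (hF v hv h) ((hF v hv h).trans hv)
        exact ⟨k + 1, hk⟩

theorem NumberedTree.graph_adj (T : NumberedTree) {u v : Fin T.size} :
    T.graph.Adj u v ↔ u ≠ v ∧ (T.parent u = v ∨ T.parent v = u) :=
  SimpleGraph.fromRel_adj _ u v

/-- A copy of a rooted tree that fixes the root commutes with the parent functions: going down from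
the root, an edge cannot be mapped upwards because the map is injective. -/
theorem NumberedTree.isoToSubtree_iff {T T' : NumberedTree}
    (hT : ∀ v, v ≠ T.root → T.parent v < v) :
    T.IsoToSubtree T' ↔ ∃ f : Fin T.size → Fin T'.size, Function.Injective f ∧
      f T.root = T'.root ∧ ∀ v, f (T.parent v) = T'.parent (f v) := by
  constructor
  · rintro ⟨g, hg⟩
    refine ⟨g, g.injective, hg, fun v => ?_⟩
    induction v using WellFoundedLT.induction with
    | _ v ih =>
      by_cases hv : v = T.root
      · rw [hv, T.parent_root, hg, T'.parent_root]
      · have hlt := hT v hv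
        have hadj : T.graph.Adj v (T.parent v) := T.graph_adj.2 ⟨hlt.ne', Or.inl rfl⟩
        rcases (T'.graph_adj.1 (g.toHom.map_adj hadj)).2 with h | h
        · exact h.symm
        · exfalso
          have h4 : T.parent (T.parent v) = v := g.injective ((ih _ hlt).trans h)
          by_cases h5 : T.parent v = T.root
          · rw [h5, T.parent_root] at h4
            exact hv h4.symm
          · have := hT _ h5
            rw [h4] at this
            exact lt_asymm this hlt
  · rintro ⟨f, hinj, hf0, hf⟩
    refine ⟨⟨⟨f, fun {u v} huv => ?_⟩, hinj⟩, hf0⟩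
    rw [NumberedTree.graph_adj] at huv ⊢
    exact ⟨hinj.ne huv.1, huv.2.imp (fun h => by rw [← hf, h]) (fun h => by rw [← hf, h])⟩

section ofParent
variable {S S' : ℕ} {F F' : ℕ → ℕ} {hS : 0 < S} {h0 : F 0 = 0} {hF : ∀ v < S, 0 < v → F v < v}
  {hS' : 0 < S'} {h0' : F' 0 = 0} {hF' : ∀ v < S', 0 < v → F' v < v}

theorem NumberedTree.encode_ofParent :
    (NumberedTree.ofParent S F hS h0 hF).encode = S :: (List.range S).map F := by
  simp only [NumberedTree.encode, NumberedTree.ofParent]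
  congr 1
  apply List.ext_getElem <;> simp

/-- Embeddings in terms of maps of numbers. -/
theorem NumberedTree.ofParent_isoToSubtree_iff :
    (NumberedTree.ofParent S F hS h0 hF).IsoToSubtree (NumberedTree.ofParent S' F' hS' h0' hF') ↔
      ∃ f : ℕ → ℕ, (∀ v < S, f v < S') ∧ Set.InjOn f (Set.Iio S) ∧ f 0 = 0 ∧
        ∀ v < S, f (F v) = F' (f v) := by
  rw [NumberedTree.isoToSubtree_iff]
  · constructor
    · rintro ⟨g, hinj, hg0, hg⟩
      have hext : ∀ v : Fin S, (if hv : (v : ℕ) < S then (g ⟨v, hv⟩ : ℕ) else 0) = g v :=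
        fun v => dif_pos v.2
      refine ⟨fun v => if hv : v < S then (g ⟨v, hv⟩ : ℕ) else 0, ?_, ?_, ?_, ?_⟩
      · intro v hv
        exact (hext ⟨v, hv⟩).trans_lt (g ⟨v, hv⟩).2
      · intro u hu v hv huv
        exact congrArg Fin.val (hinj (Fin.ext
          (((hext ⟨u, hu⟩).symm.trans huv).trans (hext ⟨v, hv⟩))))
      · exact (hext ⟨0, hS⟩).trans (congrArg Fin.val hg0)
      · intro v hv
        have h2 := congrArg Fin.val (hg ⟨v, hv⟩)
        exact (hext _).trans (h2.trans (congrArg F' (hext ⟨v, hv⟩).symm))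
    · rintro ⟨f, hfS, hinj, hf0, hf⟩
      exact ⟨fun v => ⟨f v, hfS v v.2⟩, fun u v huv =>
        Fin.ext (hinj u.2 v.2 (congrArg Fin.val huv)), Fin.ext hf0, fun v => Fin.ext (hf v v.2)⟩
  · intro v hv
    exact hF v v.2 (Nat.pos_of_ne_zero fun h => hv (Fin.ext h))

theorem NumberedTree.ofParent_degreeLE {d : ℕ}
    (h : ∀ v < S, ∃ s : Finset ℕ, s.card ≤ d ∧ ∀ u < S, 0 < u → F u = v → u ∈ s) :
    (NumberedTree.ofParent S F hS h0 hF).DegreeLE d := by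
  rintro ⟨v, hv⟩
  obtain ⟨s, hs, hs'⟩ := h v hv
  refine le_trans ?_ hs
  refine Finset.card_le_card_of_injOn (fun u : Fin S => (u : ℕ)) ?_ (Fin.val_injective.injOn)
  rintro ⟨u, hu⟩ hmem
  obtain ⟨hne, hp⟩ := (Finset.mem_filter.1 hmem).2
  refine hs' u hu (Nat.pos_of_ne_zero fun h => hne (Fin.ext h)) (congrArg Fin.val hp)

/-- A function `rk` that increases from parents to children bounds the height. -/
theorem NumberedTree.ofParent_height_le {b : ℕ} (rk : ℕ → ℕ)
    (hrk : ∀ v < S, 0 < v → rk (F v) + 1 ≤ rk v) (hb : ∀ v < S, rk v ≤ b) :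
    (NumberedTree.ofParent S F hS h0 hF).height ≤ b := by
  refine Finset.sup_le ?_
  rintro ⟨v, hv⟩ -
  refine le_trans ?_ (hb v hv)
  have key : ∀ v (hv : v < S), ∃ k ≤ rk v,
      (NumberedTree.ofParent S F hS h0 hF).parent^[k] (⟨v, hv⟩ : Fin S) =
        (NumberedTree.ofParent S F hS h0 hF).root := by
    intro v
    induction v using Nat.strong_induction_on with
    | _ v ih =>
      intro hv
      rcases Nat.eq_zero_or_pos v with rfl | h
      · exact ⟨0, Nat.zero_le _, rfl⟩
      · obtain ⟨k, hk, hk'⟩ := ih (F v) (hF v hv h) ((hF v hv h).trans hv)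
        exact ⟨k + 1, by have := hrk v hv h; omega, hk'⟩
  obtain ⟨k, hk, hk'⟩ := key v hv
  exact (Nat.find_min' _ hk').trans hk

end ofParent

/-! ### Vertices numbered block by block -/

/-- The first number of block `t`, when numbers are dealt out to blocks of sizes `w 0, w 1, …`. -/
def offset (w : ℕ → ℕ) (t : ℕ) : ℕ := ∑ s ∈ Finset.range t, w s

/-- The block that contains the number `v`, provided that no block is empty. -/
def blockOf (w : ℕ → ℕ) (v : ℕ) : ℕ := Nat.findGreatest (fun t => offset w t ≤ v) v

section offset
variable {w : ℕ → ℕ}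

theorem offset_zero : offset w 0 = 0 := rfl

theorem offset_succ (t : ℕ) : offset w (t + 1) = offset w t + w t := Finset.sum_range_succ ..

theorem offset_mono : Monotone (offset w) :=
  monotone_nat_of_le_succ fun t => by rw [offset_succ]; omega

theorem le_offset (hw : ∀ t, 0 < w t) (t : ℕ) : t ≤ offset w t := by
  induction t with
  | zero => simp
  | succ t ih => rw [offset_succ]; have := hw t; omega

theorem blockOf_offset_add (hw : ∀ t, 0 < w t) {t y : ℕ} (hy : y < w t) :
    blockOf w (offset w t + y) = t := by
  rw [blockOf, Nat.findGreatest_eq_iff]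
  refine ⟨(le_offset hw t).trans (Nat.le_add_right _ _), fun _ => Nat.le_add_right _ _, ?_⟩
  intro n hn _ h
  have := offset_mono (w := w) (Nat.succ_le_of_lt hn)
  rw [Nat.succ_eq_add_one, offset_succ] at this
  omega

theorem offset_add_inj (hw : ∀ t, 0 < w t) {t t' y y' : ℕ} (hy : y < w t) (hy' : y' < w t')
    (h : offset w t + y = offset w t' + y') : t = t' ∧ y = y' := by
  have ht : t = t' := by
    rw [← blockOf_offset_add hw hy, h, blockOf_offset_add hw hy']
  subst ht
  exact ⟨rfl, by omega⟩

theorem exists_eq_offset_add {T v : ℕ} (h : v < offset w T) :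
    ∃ t y, t < T ∧ y < w t ∧ v = offset w t + y := by
  induction T with
  | zero => simp [offset_zero] at h
  | succ T ih =>
    rw [offset_succ] at h
    by_cases h' : v < offset w T
    · obtain ⟨t, y, ht, hy, rfl⟩ := ih h'
      exact ⟨t, y, by omega, hy, rfl⟩
    · exact ⟨T, v - offset w T, by omega, by omega, by omega⟩

theorem offset_add_lt {T t y : ℕ} (ht : t < T) (hy : y < w t) : offset w t + y < offset w T := by
  have := offset_mono (w := w) (Nat.succ_le_of_lt ht)
  rw [Nat.succ_eq_add_one, offset_succ] at this
  omega

end offset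

/-! ### The trees of the reduction -/

/-- The data of a tree of the reduction. Put `N = d ^ L`. From the root, the tree consists of

* a complete `d`-ary tree of height `L`, with `N` leaves;
* below each of the first `N - h` of these a path of length `L`, and, if `h = 1`, below the last one
  a complete `d`-ary tree of height `L`; this makes `N` *columns* if `h = 0` and `2 * N - 1` columns
  if `h = 1`, the last `N` of which are below the last leaf;
* below each column a complete `d`-ary tree of height `2 * (κ + 1)`, whose leaves are the *slots* of
  the column; they are numbered across all columns, so that slot `x` is number
  `x % d ^ (2 * (κ + 1))` in its column;
* below each slot a path, its *arm*, of length `2 * κ + 1 + h`;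
* for each `b ≤ κ` one leaf on each arm, attached to vertex `2 * b` or `2 * b + 1` of the arm,
  according to a bit. For `b < κ` it is bit `b` of the number of the slot in its column, so that
  these leaves label the slot; for `b = κ` it is `β x`. -/
structure Shape where
  d : ℕ
  L : ℕ
  κ : ℕ
  h : ℕ
  β : ℕ → ℕ

namespace Shape
variable (D : Shape)

/-- The number of slots of a column. -/
def slots : ℕ := D.d ^ (2 * (D.κ + 1))

/-- The level on which the arms start. -/
def arm : ℕ := 2 * D.L + 2 * (D.κ + 1)

/-- The level on which the arms end. -/
def top : ℕ := D.arm + (2 * D.κ + 1 + D.h)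

/-- The number of vertices of level `t`, out of `w`, that have exactly one child on level `t + 1`.
These are the first ones of the level, and the others have `d` children. -/
def fixed (t w : ℕ) : ℕ :=
  if t < D.L then 0 else if t < 2 * D.L then D.d ^ D.L - D.h else if t < D.arm then 0 else w

/-- The number of vertices of level `t`. Beyond level `top`, the value (which is then the number of
all slots) is the number of leaves with the same `b` on the arms. -/
def width : ℕ → ℕ
  | 0 => 1
  | t + 1 => D.fixed t (width t) + (width t - D.fixed t (width t)) * D.d

/-- The number of the first vertex of level `t`. The vertices of the levels up to `top` are numbered
level by level; they are followed, for `b = 0, …, κ`, by the leaves number `b` on all arms. -/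
abbrev off (t : ℕ) : ℕ := offset D.width t

/-- The number of vertices of level `t` that have exactly one child on level `t + 1`, if
`t < top`. -/
def stem (t : ℕ) : ℕ := D.fixed t (D.width t)

/-- The position in level `t` of the parent of the vertex in position `y` of level `t + 1`; the
first summand is `min y (stem t)`. -/
def proj (t y : ℕ) : ℕ := (y - (y - D.stem t)) + (y - D.stem t) / D.d

/-- The bit recorded by leaf `b` on the arm of slot `x`. -/
def bit (b x : ℕ) : ℕ := if b < D.κ then x % D.slots / 2 ^ b % 2 else D.β x

/-- The parent of the vertex in position `y` of block `t`. -/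
def parentAt : ℕ → ℕ → ℕ
  | 0, _ => 0
  | t + 1, y =>
    if t < D.top then D.off t + D.proj t y
    else D.off (D.arm + 2 * (t - D.top) + D.bit (t - D.top) y) + y

/-- The parent of the vertex `v`. -/
def parentNumber (v : ℕ) : ℕ :=
  D.parentAt (blockOf D.width v) (v - D.off (blockOf D.width v))

/-- The number of vertices. -/
def numVertices : ℕ := D.off (D.top + 1 + (D.κ + 1))

/-- The conditions under which the data make sense. -/
structure Valid : Prop where
  two_le_d : 2 ≤ D.d
  h_le : D.h ≤ 1
  β_le : ∀ x, D.β x ≤ 1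

variable {D}

theorem width_succ (t : ℕ) :
    D.width (t + 1) = D.stem t + (D.width t - D.stem t) * D.d := rfl

theorem width_of_le {t : ℕ} (ht : t ≤ D.L) : D.width t = D.d ^ t := by
  induction t with
  | zero => rfl
  | succ t ih =>
    rw [width_succ, ih (by omega), stem, fixed, if_pos (by omega), pow_succ]
    simp

theorem stem_of_lt {t : ℕ} (ht : t < D.L) : D.stem t = 0 := by
  rw [stem, fixed, if_pos ht]

theorem stem_mid {t : ℕ} (h1 : D.L ≤ t) (h2 : t < 2 * D.L) : D.stem t = D.d ^ D.L - D.h := by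
  rw [stem, fixed, if_neg (by omega), if_pos h2]

theorem stem_slots {t : ℕ} (h1 : 2 * D.L ≤ t) (h2 : t < D.arm) : D.stem t = 0 := by
  rw [stem, fixed, if_neg (by omega), if_neg (by omega), if_pos h2]

theorem stem_arm {t : ℕ} (h1 : D.arm ≤ t) : D.stem t = D.width t := by
  have : 2 * D.L ≤ D.arm := by unfold arm; omega
  rw [stem, fixed, if_neg (by omega), if_neg (by omega), if_neg (by omega)]

theorem Valid.pow_pos (hD : D.Valid) (t : ℕ) : 0 < D.d ^ t :=
  Nat.pow_pos (by have := hD.two_le_d; omega)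

theorem width_mid (hD : D.Valid) {s : ℕ} (hs : s ≤ D.L) :
    D.width (D.L + s) = (D.d ^ D.L - D.h) + D.h * D.d ^ s := by
  induction s with
  | zero =>
    have h1 := hD.pow_pos D.L
    have h2 := hD.h_le
    rw [Nat.add_zero, width_of_le le_rfl, pow_zero]; omega
  | succ s ih =>
    rw [← Nat.add_assoc, width_succ, ih (by omega), stem_mid (by omega) (by omega), pow_succ]
    simp only [Nat.add_sub_cancel_left]
    ring

theorem width_slots {s : ℕ} (hs : s ≤ 2 * (D.κ + 1)) :
    D.width (2 * D.L + s) = D.width (2 * D.L) * D.d ^ s := by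
  induction s with
  | zero => simp
  | succ s ih =>
    rw [← Nat.add_assoc, width_succ, ih (by omega),
      stem_slots (by omega) (by unfold arm; omega), pow_succ]
    simp [Nat.mul_assoc]

theorem width_two_mul (hD : D.Valid) :
    D.width (2 * D.L) = (D.d ^ D.L - D.h) + D.h * D.d ^ D.L := by
  rw [Nat.two_mul, width_mid hD le_rfl]

theorem width_arm_eq : D.width D.arm = D.width (2 * D.L) * D.slots := width_slots le_rfl

theorem width_of_arm_le {t : ℕ} (ht : D.arm ≤ t) : D.width t = D.width D.arm := by
  induction t, ht using Nat.le_induction with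
  | base => rfl
  | succ t ht ih => rw [width_succ, stem_arm ht, ih]; simp

theorem stem_le_width (hD : D.Valid) (t : ℕ) : D.stem t ≤ D.width t := by
  by_cases h1 : t < D.L
  · rw [stem_of_lt h1]; exact Nat.zero_le _
  by_cases h2 : t < 2 * D.L
  · rw [stem_mid (by omega) h2, show t = D.L + (t - D.L) by omega, width_mid hD (by omega)]
    exact Nat.le_add_right _ _
  by_cases h3 : t < D.arm
  · rw [stem_slots (by omega) h3]; exact Nat.zero_le _
  · exact (stem_arm (by omega)).le

theorem width_pos (hD : D.Valid) (t : ℕ) : 0 < D.width t := by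
  induction t with
  | zero => exact Nat.one_pos
  | succ t ih =>
    rw [width_succ]
    have h1 := stem_le_width hD t
    have := hD.two_le_d
    rcases Nat.eq_zero_or_pos (D.stem t) with h | h
    · rw [h]
      have : 0 < (D.width t - 0) * D.d := Nat.mul_pos (by omega) (by omega)
      omega
    · omega

theorem proj_of_lt {t y : ℕ} (h : y < D.stem t) : D.proj t y = y := by
  rw [proj, Nat.sub_eq_zero_of_le h.le]; simp

theorem proj_of_le {t y : ℕ} (h : D.stem t ≤ y) :
    D.proj t y = D.stem t + (y - D.stem t) / D.d := by
  rw [proj]; omega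

theorem proj_lt (hD : D.Valid) {t y : ℕ} (hy : y < D.width (t + 1)) : D.proj t y < D.width t := by
  have h1 := stem_le_width hD t
  have h3 := hD.two_le_d
  by_cases h : y < D.stem t
  · rw [proj_of_lt h]; omega
  · rw [proj_of_le (by omega)]
    rw [width_succ] at hy
    have : (y - D.stem t) / D.d < D.width t - D.stem t := by
      rw [Nat.div_lt_iff_lt_mul (by omega)]; omega
    omega

/-- Every vertex of a level has a child on the next level. -/
theorem exists_proj_eq (hD : D.Valid) {t y : ℕ} (hy : y < D.width t) :
    ∃ y' < D.width (t + 1), D.proj t y' = y := by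
  have h3 := hD.two_le_d
  by_cases h : y < D.stem t
  · exact ⟨y, by rw [width_succ]; omega, proj_of_lt h⟩
  · refine ⟨D.stem t + (y - D.stem t) * D.d, ?_, ?_⟩
    · rw [width_succ]
      have : (y - D.stem t) * D.d < (D.width t - D.stem t) * D.d :=
        Nat.mul_lt_mul_of_pos_right (by omega) (by omega)
      omega
    · rw [proj_of_le (by omega), Nat.add_sub_cancel_left, Nat.mul_div_cancel _ (by omega)]
      omega

theorem bit_le (hD : D.Valid) (b x : ℕ) : D.bit b x ≤ 1 := by
  rw [bit]; split_ifs
  · omega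
  · exact hD.β_le x

theorem parentNumber_off_add (hD : D.Valid) {t y : ℕ} (hy : y < D.width t) :
    D.parentNumber (D.off t + y) = D.parentAt t y := by
  rw [parentNumber, blockOf_offset_add (width_pos hD) hy, Nat.add_sub_cancel_left]

theorem parentNumber_zero (hD : D.Valid) : D.parentNumber 0 = 0 :=
  parentNumber_off_add hD (t := 0) (y := 0) (width_pos hD 0)

theorem parentNumber_level (hD : D.Valid) {t y : ℕ} (ht : t < D.top) (hy : y < D.width (t + 1)) :
    D.parentNumber (D.off (t + 1) + y) = D.off t + D.proj t y := by
  rw [parentNumber_off_add hD hy, parentAt, if_pos ht]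

theorem arm_le_top : D.arm ≤ D.top := Nat.le_add_right _ _

theorem parentNumber_leaf (hD : D.Valid) {b x : ℕ} (hx : x < D.width D.arm) :
    D.parentNumber (D.off (D.top + 1 + b) + x) = D.off (D.arm + 2 * b + D.bit b x) + x := by
  have h1 := arm_le_top (D := D)
  rw [parentNumber_off_add hD (by rwa [width_of_arm_le (by omega)]),
    show D.top + 1 + b = (D.top + b) + 1 by omega, parentAt, if_neg (by omega),
    Nat.add_sub_cancel_left]

/-- A vertex is the root, or a vertex of a later level, or one of the leaves on the arms. -/
theorem vertex_cases {v : ℕ} (hv : v < D.numVertices) :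
    v = 0 ∨ (∃ t y, t < D.top ∧ y < D.width (t + 1) ∧ v = D.off (t + 1) + y) ∨
      ∃ b x, b ≤ D.κ ∧ x < D.width D.arm ∧ v = D.off (D.top + 1 + b) + x := by
  obtain ⟨t, y, ht, hy, rfl⟩ := exists_eq_offset_add hv
  have h1 := arm_le_top (D := D)
  rcases t with _ | t
  · left
    have : D.width 0 = 1 := rfl
    rw [offset_zero]; omega
  right
  by_cases h : t < D.top
  · exact Or.inl ⟨t, y, h, hy, rfl⟩
  · refine Or.inr ⟨t - D.top, y, by omega, ?_, ?_⟩
    · rwa [width_of_arm_le (by omega)] at hy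
    · congr 2; omega

theorem arm_add_le (hD : D.Valid) {b x : ℕ} (hb : b ≤ D.κ) :
    D.arm + 2 * b + D.bit b x ≤ D.top := by
  have := bit_le hD b x
  unfold top; omega

theorem parentNumber_lt (hD : D.Valid) {v : ℕ} (hv : v < D.numVertices) (h0 : 0 < v) :
    D.parentNumber v < v := by
  rcases vertex_cases hv with rfl | ⟨t, y, ht, hy, rfl⟩ | ⟨b, x, hb, hx, rfl⟩
  · omega
  · rw [parentNumber_level hD ht hy]
    have := offset_add_lt (w := D.width) (Nat.lt_succ_self t) (proj_lt hD hy)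
    exact this.trans_le (Nat.le_add_right _ _)
  · rw [parentNumber_leaf hD hx]
    have h2 := arm_add_le hD (x := x) hb
    have := offset_add_lt (w := D.width) (t := D.arm + 2 * b + D.bit b x)
      (T := D.top + 1 + b) (y := x) (by omega) (by rwa [width_of_arm_le (by omega)])
    exact this.trans_le (Nat.le_add_right _ _)

theorem numVertices_pos (hD : D.Valid) : 0 < D.numVertices :=
  (by omega : 0 < D.top + 1 + (D.κ + 1)).trans_le (le_offset (width_pos hD) _)

variable (D) in
/-- The tree of shape `D`. -/
def tree (hD : D.Valid) : NumberedTree :=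
  NumberedTree.ofParent D.numVertices D.parentNumber (numVertices_pos hD) (parentNumber_zero hD)
    fun _ hv h0 => parentNumber_lt hD hv h0

theorem encode_tree (hD : D.Valid) :
    (D.tree hD).encode = D.numVertices :: (List.range D.numVertices).map D.parentNumber :=
  NumberedTree.encode_ofParent

/-- The last leaves on the arms of the first tree may be one level deeper than the arms. -/
theorem tree_height_le (hD : D.Valid) : (D.tree hD).height ≤ 2 * D.L + 4 * (D.κ + 1) := by
  have hw := width_pos hD
  have h1 := arm_le_top (D := D)
  let rk : ℕ → ℕ := fun v =>
    if blockOf D.width v ≤ D.top then blockOf D.width v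
    else blockOf D.width (D.parentNumber v) + 1
  have hrk1 : ∀ t y, t ≤ D.top → y < D.width t → rk (D.off t + y) = t := by
    intro t y ht hy
    simp only [rk, blockOf_offset_add hw hy, if_pos ht]
  have hrk2 : ∀ b x, x < D.width D.arm → b ≤ D.κ →
      rk (D.off (D.top + 1 + b) + x) = D.arm + 2 * b + D.bit b x + 1 := by
    intro b x hx hb
    simp only [rk]
    rw [blockOf_offset_add hw (by rwa [width_of_arm_le (by omega)]), if_neg (by omega),
      parentNumber_leaf hD hx, blockOf_offset_add hw (by rwa [width_of_arm_le (by omega)])]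
  refine NumberedTree.ofParent_height_le rk ?_ ?_
  · intro v hv h0
    rcases vertex_cases hv with rfl | ⟨t, y, ht, hy, rfl⟩ | ⟨b, x, hb, hx, rfl⟩
    · omega
    · rw [parentNumber_level hD ht hy, hrk1 t _ ht.le (proj_lt hD hy), hrk1 _ _ (by omega) hy]
    · rw [parentNumber_leaf hD hx, hrk2 b x hx hb, hrk1 _ _ (arm_add_le hD hb)
        (by rwa [width_of_arm_le (by omega)])]
  · intro v hv
    have hh := hD.h_le
    have htop : D.top ≤ 2 * D.L + 4 * (D.κ + 1) := by unfold top arm; omega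
    rcases vertex_cases hv with rfl | ⟨t, y, ht, hy, rfl⟩ | ⟨b, x, hb, hx, rfl⟩
    · have : rk 0 = 0 := hrk1 0 0 (Nat.zero_le _) (hw 0)
      omega
    · rw [hrk1 _ _ (by omega) hy]; omega
    · rw [hrk2 b x hx hb]
      have := bit_le hD b x
      unfold arm; omega

/-- A vertex of an arm has a child on the arm and at most one leaf. -/
theorem child_cases (hD : D.Valid) {t y u : ℕ} (ht : D.arm ≤ t) (hy : y < D.width t)
    (hu : u < D.numVertices) (h0 : 0 < u) (huv : D.parentNumber u = D.off t + y) :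
    u = D.off (t + 1) + y ∨
      ∃ b ≤ D.κ, u = D.off (D.top + 1 + b) + y ∧ D.arm + 2 * b + D.bit b y = t := by
  have hw := width_pos hD
  rcases vertex_cases hu with rfl | ⟨t', y', ht', hy', rfl⟩ | ⟨b, x, hb, hx, rfl⟩
  · omega
  · left
    rw [parentNumber_level hD ht' hy'] at huv
    obtain ⟨rfl, rfl⟩ := offset_add_inj hw (proj_lt hD hy') hy huv
    rw [width_succ, stem_arm (by omega)] at hy'
    rw [proj_of_lt]
    rw [stem_arm (by omega)]; simpa using hy'
  · right
    rw [parentNumber_leaf hD hx] at huv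
    obtain ⟨rfl, rfl⟩ := offset_add_inj hw (by rwa [width_of_arm_le (by omega)]) hy huv
    exact ⟨b, hb, rfl, rfl⟩

theorem tree_degreeLE (hD : D.Valid) : (D.tree hD).DegreeLE D.d := by
  have hw := width_pos hD
  have hd := hD.two_le_d
  have h1 := arm_le_top (D := D)
  refine NumberedTree.ofParent_degreeLE fun v hv => ?_
  obtain ⟨t, y, ht, hy, rfl⟩ := exists_eq_offset_add hv
  by_cases hta : t < D.arm
  · refine ⟨(Finset.range D.d).image fun r =>
      D.off (t + 1) + if y < D.stem t then y else D.stem t + ((y - D.stem t) * D.d + r),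
      Finset.card_image_le.trans (by simp), ?_⟩
    intro u hu h0 huv
    rw [Finset.mem_image]
    rcases vertex_cases hu with rfl | ⟨t', y', ht', hy', rfl⟩ | ⟨b, x, hb, hx, rfl⟩
    · omega
    · rw [parentNumber_level hD ht' hy'] at huv
      obtain ⟨rfl, rfl⟩ := offset_add_inj hw (proj_lt hD hy') hy huv
      by_cases h : y' < D.stem t'
      · exact ⟨0, by simp; omega, by rw [proj_of_lt h, if_pos h]⟩
      · refine ⟨(y' - D.stem t') % D.d, Finset.mem_range.2 (Nat.mod_lt _ (by omega)), ?_⟩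
        rw [proj_of_le (by omega), if_neg (not_lt.2 (Nat.le_add_right _ _)),
          Nat.add_sub_cancel_left, Nat.div_add_mod']
        omega
    · rw [parentNumber_leaf hD hx] at huv
      have := offset_add_inj hw (by rwa [width_of_arm_le (by omega)]) hy huv
      omega
  · refine ⟨{D.off (t + 1) + y, D.off (D.top + 1 + (t - D.arm) / 2) + y},
      Finset.card_le_two.trans hd, ?_⟩
    intro u hu h0 huv
    rw [Finset.mem_insert, Finset.mem_singleton]
    rcases child_cases hD (by omega) hy hu h0 huv with h | ⟨b, _, h, hb⟩
    · exact Or.inl h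
    · right
      have := bit_le hD b y
      rw [h]; congr 3; omega

theorem pow_le_numVertices (hD : D.Valid) :
    D.d ^ (D.L + 2 * (D.κ + 1)) ≤ D.numVertices := by
  have h1 := arm_le_top (D := D)
  have h2 : D.width D.arm ≤ D.numVertices := by
    have := offset_mono (w := D.width) (show D.arm + 1 ≤ D.top + 1 + (D.κ + 1) by omega)
    rw [offset_succ] at this
    exact (Nat.le_add_left _ _).trans this
  refine le_trans ?_ h2
  rw [width_arm_eq, width_two_mul hD, pow_add]
  refine Nat.mul_le_mul_right _ ?_
  have h3 := hD.h_le
  have h4 := hD.pow_pos D.L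
  have : D.h ≤ D.h * D.d ^ D.L := Nat.le_mul_of_pos_right _ h4
  omega

end Shape

namespace Shape

/-! ### Embeddings of the trees -/

/-- On level `t` of a complete `d`-ary tree of height `L`, this is an automorphism of the tree that
takes the leaf `i` to the last leaf. -/
def shuffle (d L i : ℕ) : ℕ → ℕ → ℕ
  | 0, _ => 0
  | t + 1, y => d * shuffle d L i t (y / d) + Equiv.swap (i / d ^ (L - (t + 1)) % d) (d - 1) (y % d)

section shuffle
variable {d L i : ℕ}

theorem shuffle_digit_lt (hd : 0 < d) (a y : ℕ) : Equiv.swap (a % d) (d - 1) (y % d) < d := by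
  have h1 := Nat.mod_lt a hd
  have h2 := Nat.mod_lt y hd
  rw [Equiv.swap_apply_def]
  split_ifs <;> omega

theorem shuffle_succ_div (hd : 0 < d) (t y : ℕ) :
    shuffle d L i (t + 1) y / d = shuffle d L i t (y / d) := by
  rw [shuffle, Nat.mul_add_div hd, Nat.div_eq_of_lt (shuffle_digit_lt hd _ _), Nat.add_zero]

theorem shuffle_lt (hd : 0 < d) {t y : ℕ} (hy : y < d ^ t) : shuffle d L i t y < d ^ t := by
  induction t generalizing y with
  | zero => simp [shuffle]
  | succ t ih =>
    rw [pow_succ] at hy ⊢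
    rw [← Nat.div_lt_iff_lt_mul hd, shuffle_succ_div hd]
    exact ih ((Nat.div_lt_iff_lt_mul hd).2 hy)

theorem shuffle_inj (hd : 0 < d) {t y y' : ℕ} (hy : y < d ^ t) (hy' : y' < d ^ t)
    (h : shuffle d L i t y = shuffle d L i t y') : y = y' := by
  induction t generalizing y y' with
  | zero => simp at hy hy'; omega
  | succ t ih =>
    rw [pow_succ] at hy hy'
    have h1 := congrArg (· / d) h
    simp only [shuffle_succ_div hd] at h1
    have h2 := ih ((Nat.div_lt_iff_lt_mul hd).2 hy) ((Nat.div_lt_iff_lt_mul hd).2 hy') h1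
    rw [shuffle, shuffle, h1] at h
    have h3 := (Equiv.swap _ _).injective (Nat.add_left_cancel h)
    rw [← Nat.div_add_mod y d, ← Nat.div_add_mod y' d, h2, h3]

theorem shuffle_self (hd : 0 < d) {t : ℕ} (ht : t ≤ L) :
    shuffle d L i t (i / d ^ (L - t)) = d ^ t - 1 := by
  induction t with
  | zero => rfl
  | succ t ih =>
    rw [shuffle, Equiv.swap_apply_left, Nat.div_div_eq_div_mul, ← pow_succ,
      show L - (t + 1) + 1 = L - t by omega, ih (by omega), Nat.mul_sub, pow_succ, Nat.mul_comm]
    have : d ≤ d ^ t * d := Nat.le_mul_of_pos_left _ (Nat.pow_pos hd)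
    omega

theorem shuffle_self' (hd : 0 < d) : shuffle d L i L i = d ^ L - 1 := by
  simpa using shuffle_self hd le_rfl

theorem shuffle_lt_of_ne (hd : 0 < d) (hi : i < d ^ L) {y : ℕ} (hy : y < d ^ L) (hyi : y ≠ i) :
    shuffle d L i L y < d ^ L - 1 := by
  have h1 := shuffle_lt (L := L) (i := i) hd hy
  have h2 : shuffle d L i L y ≠ d ^ L - 1 := fun h =>
    hyi (shuffle_inj hd hy hi (h.trans (shuffle_self' hd).symm))
  omega

end shuffle

/-- Where column `y` of the first tree goes: column `i` goes to the column of the partial assignment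
`i'`, and the others go to the columns that accept everything. -/
def columnMap (d L i i' y : ℕ) : ℕ :=
  if y = i then d ^ L - 1 + i' else shuffle d L i L y

/-- The embedding on level `t`. Up to level `L` it is the automorphism that takes `i` to the last
leaf; then the path below `i` goes down to column `i'` of the complete tree below the last leaf, and
from level `2 * L` on the slots keep their numbers in the columns. -/
def levelMap (d L κ i i' t y : ℕ) : ℕ :=
  if t ≤ L then shuffle d L i t y
  else if t ≤ 2 * L then if y = i then d ^ L - 1 + i' / d ^ (2 * L - t) else shuffle d L i L y
  else columnMap d L i i' (y / d ^ (min (t - 2 * L) (2 * (κ + 1)))) *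
    d ^ (min (t - 2 * L) (2 * (κ + 1))) + y % d ^ (min (t - 2 * L) (2 * (κ + 1)))

section levelMap
variable {d L κ i i' : ℕ}

theorem columnMap_inj (hd : 0 < d) (hi : i < d ^ L) {y y' : ℕ} (hy : y < d ^ L)
    (hy' : y' < d ^ L) (h : columnMap d L i i' y = columnMap d L i i' y') : y = y' := by
  unfold columnMap at h
  split_ifs at h with h1 h2 h2
  · omega
  · have := shuffle_lt_of_ne hd hi hy' h2; omega
  · have := shuffle_lt_of_ne hd hi hy h1; omega
  · exact shuffle_inj hd hy hy' h

theorem columnMap_lt (hd : 0 < d) (hi : i < d ^ L) (hi' : i' < d ^ L) {y : ℕ} (hy : y < d ^ L) :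
    columnMap d L i i' y < d ^ L - 1 + d ^ L := by
  unfold columnMap
  split_ifs with h
  · omega
  · have := shuffle_lt_of_ne hd hi hy h; omega

theorem levelMap_slots (hi : i < d ^ L) (hi' : i' < d ^ L) {s : ℕ}
    (hs : s ≤ 2 * (κ + 1)) (y : ℕ) :
    levelMap d L κ i i' (2 * L + s) y =
      columnMap d L i i' (y / d ^ s) * d ^ s + y % d ^ s := by
  rcases Nat.eq_zero_or_pos s with rfl | hpos
  · unfold levelMap columnMap
    rcases Nat.eq_zero_or_pos L with rfl | hL
    · simp [shuffle] at hi hi' ⊢; subst hi; subst hi'; simp [Nat.mod_one]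
    · rw [if_neg (by omega), if_pos (by omega)]
      simp [Nat.mod_one]
  · rw [levelMap, if_neg (by omega), if_neg (by omega), Nat.add_sub_cancel_left,
      Nat.min_eq_left hs]

theorem levelMap_arm {t : ℕ}
    (ht : 2 * L + 2 * (κ + 1) ≤ t) (y : ℕ) :
    levelMap d L κ i i' t y =
      columnMap d L i i' (y / d ^ (2 * (κ + 1))) * d ^ (2 * (κ + 1)) + y % d ^ (2 * (κ + 1)) := by
  rw [levelMap, if_neg (by omega), if_neg (by omega), Nat.min_eq_right (by omega)]

theorem levelMap_mid (hd : 0 < d) (hi' : i' < d ^ L) {t : ℕ}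
    (ht : L ≤ t) (ht' : t ≤ 2 * L) (y : ℕ) :
    levelMap d L κ i i' t y =
      if y = i then d ^ L - 1 + i' / d ^ (2 * L - t) else shuffle d L i L y := by
  rcases ht.eq_or_lt with rfl | h
  · rw [levelMap, if_pos le_rfl]
    split_ifs with h
    · rw [h, shuffle_self' hd, Nat.div_eq_of_lt]; · rfl
      rwa [Nat.two_mul, Nat.add_sub_cancel]
    · rfl
  · rw [levelMap, if_neg (by omega), if_pos ht']

end levelMap

section embedding
variable {d L κ : ℕ} {α β : ℕ → ℕ}

local notation "SA" => Shape.mk d L κ 0 α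
local notation "SB" => Shape.mk d L κ 1 β

theorem levelMap_lt (hA : Valid SA) (hB : Valid SB) {i i' t y : ℕ} (hi : i < d ^ L)
    (hi' : i' < d ^ L) (hy : y < width SA t) : levelMap d L κ i i' t y < width SB t := by
  have hd : 0 < d := by have := hA.two_le_d; simp only at this; omega
  by_cases h1 : t ≤ L
  · rw [width_of_le h1] at hy ⊢
    rw [levelMap, if_pos h1]
    exact shuffle_lt hd hy
  have hslots : ∀ s ≤ 2 * (κ + 1), ∀ y < width SA (2 * L + s),
      levelMap d L κ i i' (2 * L + s) y < width SB (2 * L + s) := by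
    intro s hs y hy
    rw [width_slots (D := SA) hs, width_two_mul hA] at hy
    rw [width_slots (D := SB) hs, width_two_mul hB, levelMap_slots hi hi' hs]
    simp only [Nat.sub_zero, Nat.zero_mul, Nat.add_zero, Nat.one_mul] at hy ⊢
    have hpos : 0 < d ^ s := Nat.pow_pos hd
    have h2 := columnMap_lt hd hi hi' ((Nat.div_lt_iff_lt_mul hpos).2 hy)
    rw [← Nat.div_lt_iff_lt_mul hpos, Nat.mul_comm _ (d ^ s), Nat.mul_add_div hpos,
      Nat.div_eq_of_lt (Nat.mod_lt _ hpos)]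
    simpa using h2
  by_cases h2 : t ≤ 2 * L
  · obtain ⟨s, rfl⟩ := Nat.exists_eq_add_of_le (show L ≤ t by omega)
    rw [levelMap_mid hd hi' (by omega) h2]
    have e1 := width_mid hA (s := s) (by simp only; omega)
    have e2 := width_mid hB (s := s) (by simp only; omega)
    simp only at e1 e2
    rw [e1] at hy; rw [e2]
    simp only [Nat.sub_zero, Nat.zero_mul, Nat.add_zero, Nat.one_mul] at hy ⊢
    split_ifs with h
    · have : i' / d ^ (2 * L - (L + s)) < d ^ s := by
        rw [Nat.div_lt_iff_lt_mul (Nat.pow_pos hd), ← pow_add]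
        rwa [show s + (2 * L - (L + s)) = L by omega]
      omega
    · exact (shuffle_lt_of_ne hd hi hy h).trans_le (Nat.le_add_right _ _)
  by_cases h3 : t ≤ 2 * L + 2 * (κ + 1)
  · obtain ⟨s, rfl⟩ := Nat.exists_eq_add_of_le (show 2 * L ≤ t by omega)
    exact hslots s (by omega) y hy
  · rw [levelMap_arm (by omega)]
    rw [width_of_arm_le (D := SA) (by unfold arm; simp only; omega)] at hy
    rw [width_of_arm_le (D := SB) (by unfold arm; simp only; omega)]
    have := hslots (2 * (κ + 1)) le_rfl y hy
    rwa [levelMap_slots hi hi' le_rfl] at this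

theorem levelMap_inj (hA : Valid SA) {i i' t y y' : ℕ} (hi : i < d ^ L)
    (hi' : i' < d ^ L) (hy : y < width SA t) (hy' : y' < width SA t)
    (h : levelMap d L κ i i' t y = levelMap d L κ i i' t y') : y = y' := by
  have hd : 0 < d := by have := hA.two_le_d; simp only at this; omega
  by_cases h1 : t ≤ L
  · rw [width_of_le h1] at hy hy'
    rw [levelMap, levelMap, if_pos h1, if_pos h1] at h
    exact shuffle_inj hd hy hy' h
  have hslots : ∀ s ≤ 2 * (κ + 1), ∀ y < width SA (2 * L + s), ∀ y' < width SA (2 * L + s),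
      levelMap d L κ i i' (2 * L + s) y = levelMap d L κ i i' (2 * L + s) y' → y = y' := by
    intro s hs y hy y' hy' h
    rw [width_slots (D := SA) hs, width_two_mul hA] at hy hy'
    rw [levelMap_slots hi hi' hs, levelMap_slots hi hi' hs] at h
    simp only [Nat.sub_zero, Nat.zero_mul, Nat.add_zero] at hy hy'
    have hpos : 0 < d ^ s := Nat.pow_pos hd
    have e1 := congrArg (· / d ^ s) h
    have e2 := congrArg (· % d ^ s) h
    simp only [Nat.mul_comm _ (d ^ s), Nat.mul_add_div hpos, Nat.mul_add_mod,
      Nat.div_eq_of_lt (Nat.mod_lt _ hpos), Nat.add_zero, Nat.mod_mod] at e1 e2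
    have e3 := columnMap_inj hd hi ((Nat.div_lt_iff_lt_mul hpos).2 hy)
      ((Nat.div_lt_iff_lt_mul hpos).2 hy') e1
    rw [← Nat.div_add_mod y (d ^ s), ← Nat.div_add_mod y' (d ^ s), e3, e2]
  by_cases h2 : t ≤ 2 * L
  · obtain ⟨s, rfl⟩ := Nat.exists_eq_add_of_le (show L ≤ t by omega)
    rw [levelMap_mid hd hi' (by omega) h2, levelMap_mid hd hi' (by omega) h2] at h
    have e1 := width_mid hA (s := s) (by simp only; omega)
    simp only [Nat.sub_zero, Nat.zero_mul, Nat.add_zero] at e1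
    rw [e1] at hy hy'
    split_ifs at h with h3 h4 h4
    · omega
    · exact absurd (h ▸ shuffle_lt_of_ne hd hi hy' h4) (not_lt.2 (Nat.le_add_right _ _))
    · exact absurd (h ▸ shuffle_lt_of_ne hd hi hy h3) (not_lt.2 (Nat.le_add_right _ _))
    · exact shuffle_inj hd hy hy' h
  by_cases h3 : t ≤ 2 * L + 2 * (κ + 1)
  · obtain ⟨s, rfl⟩ := Nat.exists_eq_add_of_le (show 2 * L ≤ t by omega)
    exact hslots s (by omega) y hy y' hy' h
  · rw [levelMap_arm (by omega), levelMap_arm (by omega)] at h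
    rw [width_of_arm_le (D := SA) (by unfold arm; simp only; omega)] at hy hy'
    refine hslots (2 * (κ + 1)) le_rfl y hy y' hy' ?_
    rwa [levelMap_slots hi hi' le_rfl, levelMap_slots hi hi' le_rfl]

/-- The embedding commutes with the parent functions. -/
theorem proj_levelMap (hA : Valid SA) (hB : Valid SB) {i i' t y : ℕ} (hi : i < d ^ L)
    (hi' : i' < d ^ L) (hy : y < width SA (t + 1)) :
    proj SB t (levelMap d L κ i i' (t + 1) y) = levelMap d L κ i i' t (proj SA t y) := by
  have hd : 0 < d := by have := hA.two_le_d; simp only at this; omega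
  have hdN : 0 < d ^ L := Nat.pow_pos hd
  by_cases h1 : t < L
  · rw [proj_of_le (by rw [stem_of_lt h1]; omega), proj_of_le (by rw [stem_of_lt h1]; omega),
      stem_of_lt h1, stem_of_lt h1, levelMap, levelMap, if_pos (by omega), if_pos (by omega)]
    simpa using shuffle_succ_div hd t y
  by_cases h2 : t < 2 * L
  · obtain ⟨s, rfl⟩ := Nat.exists_eq_add_of_le (show L ≤ t by omega)
    have e1 := width_mid hA (s := s + 1) (by simp only; omega)
    simp only [Nat.sub_zero, Nat.zero_mul, Nat.add_zero, ← Nat.add_assoc] at e1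
    rw [e1] at hy
    have e2 : stem SA (L + s) = d ^ L := stem_mid (D := SA) (by simp only; omega) h2
    have e3 : stem SB (L + s) = d ^ L - 1 := stem_mid (D := SB) (by simp only; omega) h2
    rw [proj_of_lt (D := SA) (by omega), levelMap_mid hd hi' (by omega) (by omega),
      levelMap_mid hd hi' (by omega) (by omega)]
    split_ifs with h
    · rw [proj_of_le (e3.le.trans (Nat.le_add_right _ _)), e3, Nat.add_sub_cancel_left]
      simp only
      rw [Nat.div_div_eq_div_mul, ← pow_succ]
      congr 3; omega
    · rw [proj_of_lt]; rw [e3]; exact shuffle_lt_of_ne hd hi hy h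
  by_cases h3 : t < 2 * L + 2 * (κ + 1)
  · obtain ⟨s, rfl⟩ := Nat.exists_eq_add_of_le (show 2 * L ≤ t by omega)
    have e2 : stem SA (2 * L + s) = 0 := stem_slots (D := SA) (by simp only; omega) h3
    have e3 : stem SB (2 * L + s) = 0 := stem_slots (D := SB) (by simp only; omega) h3
    rw [proj_of_le (by omega), proj_of_le (by omega), e2, e3, Nat.add_assoc,
      levelMap_slots hi hi' (by omega), levelMap_slots hi hi' (by omega)]
    simp only [Nat.zero_add, Nat.sub_zero]
    rw [pow_succ, ← Nat.mul_assoc, Nat.mul_comm _ d, Nat.mul_add_div hd, Nat.mul_comm (d ^ s) d,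
      Nat.mod_mul_right_div_self, Nat.div_div_eq_div_mul]
  · have e4 : arm SA ≤ t := by unfold arm; simp only; omega
    have e5 : arm SB ≤ t := by unfold arm; simp only; omega
    have e6 := levelMap_lt hA hB hi hi' hy
    rw [width_of_arm_le (by omega), ← width_of_arm_le e4] at hy
    rw [width_of_arm_le (by omega), ← width_of_arm_le e5] at e6
    rw [proj_of_lt (D := SA) (by rwa [stem_arm e4]), proj_of_lt (D := SB) (by rwa [stem_arm e5]),
      levelMap_arm (by omega), levelMap_arm (by omega)]

/-- The embedding that takes column `i` to column `d ^ L - 1 + i'`. A leaf that records a `1` at the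
end of an arm fits in any case, because the arms of the second tree are longer by one: it goes to
the end of the longer arm. A leaf that records a `0` needs a leaf in the same place. -/
theorem isoToSubtree_of_columns (hA : Valid SA) (hB : Valid SB) {i i' : ℕ} (hi : i < d ^ L)
    (hi' : i' < d ^ L)
    (hαβ : ∀ x < width SA (arm SA), α x = 0 → β (levelMap d L κ i i' (arm SA) x) = 0) :
    (tree SA hA).IsoToSubtree (tree SB hB) := by
  have hwA := width_pos hA
  have hwB := width_pos hB
  have hd : 0 < d := by have := hA.two_le_d; simp only at this; omega
  have htop : top SB = top SA + 1 := by unfold top arm; simp only; omega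
  have harm : arm SB = arm SA := rfl
  have hle := arm_le_top (D := SA)
  have htopA : top SA = arm SA + 2 * κ + 1 := rfl
  rw [tree, tree, NumberedTree.ofParent_isoToSubtree_iff]
  -- the block of the image: a leaf that records a true literal goes to the end of the longer arm
  let T : ℕ → ℕ → ℕ := fun t y =>
    if t ≤ top SA then t else if t = top SA + 1 + κ ∧ α y = 1 then top SB else t + 1
  let f : ℕ → ℕ := fun v =>
    off SB (T (blockOf (width SA) v) (v - off SA (blockOf (width SA) v))) +
      levelMap d L κ i i' (blockOf (width SA) v) (v - off SA (blockOf (width SA) v))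
  have hf : ∀ t y, y < width SA t →
      f (off SA t + y) = off SB (T t y) + levelMap d L κ i i' t y := by
    intro t y hy
    simp only [f, blockOf_offset_add hwA hy, Nat.add_sub_cancel_left]
  have hT : ∀ t y, t < top SA + 1 + (κ + 1) → T t y < top SB + 1 + (κ + 1) := by
    intro t y ht
    simp only [T]; split_ifs <;> omega
  have hTw : ∀ t y, width SB (T t y) = width SB t := by
    intro t y
    simp only [T]
    split_ifs
    · rfl
    · rw [width_of_arm_le (by omega), width_of_arm_le (t := t) (by omega)]
    · rw [width_of_arm_le (by omega), width_of_arm_le (t := t) (by omega)]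
  have hlt : ∀ t y, y < width SA t → levelMap d L κ i i' t y < width SB (T t y) := by
    intro t y hy
    rw [hTw]
    exact levelMap_lt hA hB hi hi' hy
  have hlm : ∀ t y, arm SA ≤ t →
      levelMap d L κ i i' t y = levelMap d L κ i i' (arm SA) y := by
    intro t y ht
    rw [levelMap_arm ht, levelMap_arm (t := arm SA) le_rfl]
  refine ⟨f, ?_, ?_, ?_, ?_⟩
  · intro v hv
    obtain ⟨t, y, ht, hy, rfl⟩ := exists_eq_offset_add hv
    rw [hf t y hy]
    exact offset_add_lt (hT t y ht) (hlt t y hy)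
  · intro v hv v' hv' h
    obtain ⟨t, y, ht, hy, rfl⟩ := exists_eq_offset_add hv
    obtain ⟨t', y', ht', hy', rfl⟩ := exists_eq_offset_add hv'
    rw [hf t y hy, hf t' y' hy'] at h
    obtain ⟨h1, h2⟩ := offset_add_inj hwB (hlt t y hy) (hlt t' y' hy') h
    have h3 : t = t' := by
      simp only [T] at h1
      split_ifs at h1 <;> omega
    subst h3
    rw [levelMap_inj hA hi hi' hy hy' h2]
  · have := hf 0 0 (hwA 0)
    have h2 : f 0 = off SB (T 0 0) + levelMap d L κ i i' 0 0 := this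
    rw [h2, levelMap, if_pos (Nat.zero_le _)]
    simp [T, shuffle, offset_zero]
  · intro v hv
    rcases vertex_cases hv with rfl | ⟨t, y, ht, hy, rfl⟩ | ⟨b, x, hb, hx, rfl⟩
    · have h2 : f 0 = 0 := by
        have := hf 0 0 (hwA 0)
        have h2 : f 0 = off SB (T 0 0) + levelMap d L κ i i' 0 0 := this
        rw [h2, levelMap, if_pos (Nat.zero_le _)]
        simp [T, shuffle, offset_zero]
      rw [parentNumber_zero hA, h2, parentNumber_zero hB]
    · rw [parentNumber_level hA ht hy, hf _ _ (proj_lt hA hy), hf _ _ hy]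
      have e1 : T t (proj SA t y) = t := if_pos (by omega)
      have e2 : T (t + 1) y = t + 1 := if_pos (by omega)
      rw [e1, e2, parentNumber_level hB (by omega) (levelMap_lt hA hB hi hi' hy),
        proj_levelMap hA hB hi hi' hy]
    · have hb1 := arm_add_le hA (x := x) hb
      have hxt : ∀ t, arm SA ≤ t → x < width SA t := fun t ht => by rwa [width_of_arm_le ht]
      rw [parentNumber_leaf hA hx, hf _ _ (hxt _ (by omega)), hf _ _ (hxt _ (by omega)),
        hlm _ _ (by omega), hlm (top SA + 1 + b) _ (by omega)]
      have e1 : T (arm SA + 2 * b + bit SA b x) x = arm SA + 2 * b + bit SA b x :=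
        if_pos (by omega)
      have hz := levelMap_lt hA hB hi hi' hx
      rw [e1]
      by_cases hcase : top SA + 1 + b = top SA + 1 + κ ∧ α x = 1
      · have e2 : T (top SA + 1 + b) x = top SB := by
          simp only [T]; rw [if_neg (by omega), if_pos hcase]
        obtain rfl : κ = b := by omega
        have e3 : bit SA κ x = 1 := by rw [bit, if_neg (lt_irrefl _)]; exact hcase.2
        have hz' : levelMap d L κ i i' (arm SA) x < width SB (top SA) := by
          rwa [width_of_arm_le (by omega)]
        have e4 : proj SB (top SA) (levelMap d L κ i i' (arm SA) x) =
            levelMap d L κ i i' (arm SA) x :=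
          proj_of_lt (by rwa [stem_arm (by omega)])
        rw [e2, e3, htop, parentNumber_level hB (by omega)
          (by rwa [width_of_arm_le (by omega)]), e4, htopA]
      · have e2 : T (top SA + 1 + b) x = top SB + 1 + b := by
          simp only [T]; rw [if_neg (by omega), if_neg hcase]; omega
        rw [e2, parentNumber_leaf hB hz, harm]
        have e3 : bit SA b x = bit SB b (levelMap d L κ i i' (arm SA) x) := by
          unfold bit
          simp only
          split_ifs with hbκ
          · rw [levelMap_arm (t := arm SA) le_rfl]
            unfold slots
            simp only
            rw [Nat.mul_add_mod', Nat.mod_mod]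
          · have h1 := hA.β_le x
            simp only at h1
            have h2 : α x = 0 := by omega
            rw [h2, hαβ x hx h2]
        rw [e3]

/-- In an embedding, some column of the first tree is matched to a column below the last leaf of the
upper part of the second tree, and there every slot is matched to a slot with the same label. -/
theorem columns_of_isoToSubtree (hA : Valid SA) (hB : Valid SB)
    (h : (tree SA hA).IsoToSubtree (tree SB hB)) :
    ∃ i < d ^ L, ∃ i' < d ^ L, ∀ j < slots SA, ∃ j' < slots SA,
      (∀ b < κ, j' / 2 ^ b % 2 = j / 2 ^ b % 2) ∧
      (α (i * slots SA + j) = 0 → β ((d ^ L - 1 + i') * slots SA + j') = 0) := by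
  have hwA := width_pos hA
  have hwB := width_pos hB
  have hd : 0 < d := by have := hA.two_le_d; simp only at this; omega
  have hdN : 0 < d ^ L := Nat.pow_pos hd
  have htop : top SB = top SA + 1 := by unfold top arm; simp only; omega
  have harm : arm SB = arm SA := rfl
  have hslots : slots SB = slots SA := rfl
  have hle := arm_le_top (D := SA)
  have htopA : top SA = arm SA + 2 * κ + 1 := rfl
  have harmA : arm SA = 2 * L + 2 * (κ + 1) := rfl
  rw [tree, tree, NumberedTree.ofParent_isoToSubtree_iff] at h
  obtain ⟨f, hfS, hinj, hf0, hf⟩ := h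
  have hmem : ∀ t y, t ≤ top SA → y < width SA t → off SA t + y < numVertices SA :=
    fun t y ht hy => offset_add_lt (by omega) hy
  have hfpos : ∀ v < numVertices SA, 0 < v → 0 < f v := by
    intro v hv h0
    refine Nat.pos_of_ne_zero fun h => h0.ne' (hinj hv (numVertices_pos hA) (h.trans hf0.symm))
  have hoffpos : ∀ t, 0 < t → 0 < off SA t := fun t ht => ht.trans_le (le_offset hwA t)
  -- a vertex with a child goes to the same level, because the leaves on the arms have no child
  have hlev : ∀ t < top SA, ∀ y < width SA t, ∃ z < width SB t,
      f (off SA t + y) = off SB t + z := by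
    intro t
    induction t with
    | zero =>
      intro _ y hy
      have : width SA 0 = 1 := rfl
      obtain rfl : y = 0 := by omega
      exact ⟨0, hwB 0, hf0⟩
    | succ t ih =>
      intro ht y hy
      obtain ⟨z, hz, hfz⟩ := ih (by omega) _ (proj_lt hA hy)
      have h1 := hf _ (hmem _ _ ht.le hy)
      rw [parentNumber_level hA (by omega) hy, hfz] at h1
      have hpos := hoffpos (t + 1) (by omega)
      rcases vertex_cases (hfS _ (hmem _ _ ht.le hy)) with h2 | ⟨t', y', ht', hy', h2⟩ |
        ⟨b, x, hb, hx, h2⟩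
      · have := hfpos _ (hmem _ _ ht.le hy) (by omega)
        omega
      · rw [h2, parentNumber_level hB ht' hy'] at h1
        obtain ⟨rfl, -⟩ := offset_add_inj hwB hz (proj_lt hB hy') h1
        exact ⟨y', hy', h2⟩
      · exfalso
        obtain ⟨y'', hy'', hp⟩ := exists_proj_eq hA hy
        have hm := hmem (t + 1 + 1) y'' (by omega) hy''
        have h3 := hf _ hm
        rw [parentNumber_level hA (by omega) hy'', hp, h2] at h3
        have hx' : x < width SB (top SB + 1 + b) := by
          rwa [width_of_arm_le (by have := arm_le_top (D := SB); omega)]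
        have hpos' := hoffpos (t + 1 + 1) (by omega)
        rcases vertex_cases (hfS _ hm) with h4 | ⟨t', y', ht', hy', h4⟩ | ⟨b', x', hb', hx'', h4⟩
        · have := hfpos _ hm (by omega)
          omega
        · rw [h4, parentNumber_level hB ht' hy'] at h3
          have := (offset_add_inj hwB hx' (proj_lt hB hy') h3).1
          omega
        · rw [h4, parentNumber_leaf hB hx''] at h3
          have h5 := arm_add_le hB (x := x') hb'
          have := (offset_add_inj hwB hx' (by rwa [width_of_arm_le (by omega)]) h3).1
          omega
  choose! ψ hψ hfψ using hlev
  have hψinj : ∀ t < top SA, ∀ y < width SA t, ∀ y' < width SA t, ψ t y = ψ t y' → y = y' := by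
    intro t ht y hy y' hy' h
    have h1 := hfψ t ht y hy
    rw [h, ← hfψ t ht y' hy'] at h1
    have := hinj (hmem _ _ ht.le hy) (hmem _ _ ht.le hy') h1
    omega
  have hcomm : ∀ t, t + 1 < top SA → ∀ y < width SA (t + 1),
      proj SB t (ψ (t + 1) y) = ψ t (proj SA t y) := by
    intro t ht y hy
    have h1 := hf _ (hmem _ _ ht.le hy)
    rw [parentNumber_level hA (by omega) hy, hfψ t (by omega) _ (proj_lt hA hy),
      hfψ (t + 1) ht y hy, parentNumber_level hB (by omega) (hψ _ ht _ hy)] at h1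
    exact (offset_add_inj hwB (hψ t (by omega) _ (proj_lt hA hy))
      (proj_lt hB (hψ _ ht _ hy)) h1).2.symm
  -- counting, the map on level `L` is onto
  obtain ⟨i, hi, hiL⟩ : ∃ i < d ^ L, ψ L i = d ^ L - 1 := by
    have e1 : width SA L = d ^ L := width_of_le le_rfl
    have e2 : width SB L = d ^ L := width_of_le le_rfl
    have hLt : L < top SA := by omega
    have hmaps : Set.MapsTo (ψ L) (Finset.range (d ^ L) : Set ℕ) (Finset.range (d ^ L)) := by
      intro y hy
      simp only [Finset.coe_range, Set.mem_Iio] at hy ⊢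
      rw [← e2]; exact hψ L hLt y (by rwa [e1])
    have hinjOn : Set.InjOn (ψ L) (Finset.range (d ^ L)) := by
      intro y hy y' hy' h
      simp only [Finset.coe_range, Set.mem_Iio] at hy hy'
      exact hψinj L hLt y (by rwa [e1]) y' (by rwa [e1]) h
    have hsurj := Finset.surjOn_of_injOn_of_card_le (ψ L) hmaps hinjOn le_rfl
    obtain ⟨i, hi, h⟩ := hsurj (show d ^ L - 1 ∈ (Finset.range (d ^ L) : Set ℕ) by simp; omega)
    exact ⟨i, by simpa using hi, h⟩
  have hwmid : ∀ s ≤ L, width SA (L + s) = d ^ L := by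
    intro s hs
    have := width_mid hA (s := s) hs
    simpa using this
  have hmid : ∀ s ≤ L, d ^ L - 1 ≤ ψ (L + s) i := by
    intro s
    induction s with
    | zero => intro _; rw [Nat.add_zero, hiL]
    | succ s ih =>
      intro hs
      have h1 := hcomm (L + s) (by omega) i
        (by rw [show L + s + 1 = L + (s + 1) by omega, hwmid (s + 1) hs]; exact hi)
      have e3 : stem SB (L + s) = d ^ L - 1 :=
        stem_mid (D := SB) (by simp only; omega) (by simp only; omega)
      have e4 : stem SA (L + s) = d ^ L :=
        stem_mid (D := SA) (by simp only; omega) (by simp only; omega)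
      rw [proj_of_lt (D := SA) (by rw [e4]; exact hi)] at h1
      by_contra hcon
      rw [show L + (s + 1) = L + s + 1 by omega] at hcon
      rw [proj_of_lt (by omega)] at h1
      have := ih (by omega)
      omega
  have hw2A : width SA (2 * L) = d ^ L := by rw [Nat.two_mul]; exact hwmid L le_rfl
  have hw2B : width SB (2 * L) = d ^ L - 1 + d ^ L := by simpa using width_two_mul hB
  have hcol := hmid L le_rfl
  have hcol' := hψ (2 * L) (by omega) i (by rwa [hw2A])
  rw [← Nat.two_mul] at hcol
  rw [hw2B] at hcol'
  refine ⟨i, hi, ψ (2 * L) i - (d ^ L - 1), by omega, fun j hj => ?_⟩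
  rw [Nat.add_sub_cancel' hcol]
  have hEpos : 0 < slots SA := Nat.pow_pos hd
  have hx : ∀ s ≤ 2 * (κ + 1),
      (i * slots SA + j) / d ^ (2 * (κ + 1) - s) < width SA (2 * L + s) := by
    intro s hs
    rw [width_slots hs, hw2A, Nat.div_lt_iff_lt_mul (Nat.pow_pos hd), Nat.mul_assoc]
    simp only
    rw [← pow_add, show s + (2 * (κ + 1) - s) = 2 * (κ + 1) by omega]
    have : (i + 1) * slots SA ≤ d ^ L * slots SA := Nat.mul_le_mul_right _ hi
    rw [Nat.add_mul, Nat.one_mul] at this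
    exact (by omega : i * slots SA + j < i * slots SA + slots SA).trans_le this
  have hdesc : ∀ s ≤ 2 * (κ + 1),
      ψ (2 * L + s) ((i * slots SA + j) / d ^ (2 * (κ + 1) - s)) / d ^ s = ψ (2 * L) i := by
    intro s
    induction s with
    | zero =>
      intro _
      have : (i * slots SA + j) / d ^ (2 * (κ + 1) - 0) = i := by
        change (i * slots SA + j) / slots SA = i
        rw [Nat.mul_comm, Nat.mul_add_div hEpos, Nat.div_eq_of_lt hj, Nat.add_zero]
      rw [this]; simp
    | succ s ih =>
      intro hs
      rw [← ih (by omega)]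
      have e3 : stem SB (2 * L + s) = 0 :=
        stem_slots (D := SB) (by simp only; omega) (by unfold arm; simp only; omega)
      have e4 : stem SA (2 * L + s) = 0 :=
        stem_slots (D := SA) (by simp only; omega) (by unfold arm; simp only; omega)
      have h1 := hcomm (2 * L + s) (by omega) _ (hx (s + 1) hs)
      rw [proj_of_le (by rw [e3]; exact Nat.zero_le _),
        proj_of_le (by rw [e4]; exact Nat.zero_le _), e3, e4] at h1
      simp only [Nat.zero_add, Nat.sub_zero] at h1
      rw [Nat.div_div_eq_div_mul, ← pow_succ,
        show 2 * (κ + 1) - (s + 1) + 1 = 2 * (κ + 1) - s by omega] at h1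
      rw [← h1, pow_succ', ← Nat.div_div_eq_div_mul, Nat.add_assoc]
  set x := i * slots SA + j with hxdef
  have hxA : x < width SA (arm SA) := by
    have := hx (2 * (κ + 1)) le_rfl
    rwa [Nat.sub_self, pow_zero, Nat.div_one] at this
  set z := ψ (arm SA) x with hzdef
  have hzq : z / slots SA = ψ (2 * L) i := by
    have := hdesc (2 * (κ + 1)) le_rfl
    rwa [Nat.sub_self, pow_zero, Nat.div_one] at this
  have hzB : z < width SB (arm SB) := hψ (arm SA) (by omega) x hxA
  have hpath : ∀ u, arm SA + u < top SA → ψ (arm SA + u) x = z := by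
    intro u
    induction u with
    | zero => intro _; rfl
    | succ u ih =>
      intro hu
      have hxw : x < width SA (arm SA + u) := by rwa [width_of_arm_le (by omega)]
      have hxw' : x < width SA (arm SA + u + 1) := by rwa [width_of_arm_le (by omega)]
      have h1 := hcomm (arm SA + u) hu x hxw'
      rw [proj_of_lt (D := SA) (by rwa [stem_arm (by omega)]), ih (by omega)] at h1
      have h2 := hψ _ hu x hxw'
      rw [width_of_arm_le (by omega), ← width_of_arm_le (t := arm SA + u) (by omega)] at h2
      rw [proj_of_lt (D := SB) (by rwa [stem_arm (by omega)])] at h1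
      exact h1
  -- an arm vertex with a leaf has two children, and so has its image
  have hbit : ∀ b ≤ κ, arm SA + 2 * b + bit SA b x < top SA → bit SB b z = bit SA b x := by
    intro b hb hlt
    set u := 2 * b + bit SA b x with hu
    have hxw : ∀ t, arm SA ≤ t → x < width SA t := fun t ht => by rwa [width_of_arm_le ht]
    have hzw : ∀ t, arm SA ≤ t → z < width SB t := fun t ht => by
      rwa [width_of_arm_le (D := SB) ht]
    have hfu : f (off SA (arm SA + u) + x) = off SB (arm SA + u) + z := by
      rw [hfψ _ (by omega) x (hxw _ (by omega)), hpath u (by omega)]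
    have m1 : off SA (arm SA + u + 1) + x < numVertices SA :=
      hmem _ _ (by omega) (hxw _ (by omega))
    have m2 : off SA (top SA + 1 + b) + x < numVertices SA :=
      offset_add_lt (by simp only; omega) (hxw _ (by omega))
    have p1 : parentNumber SB (f (off SA (arm SA + u + 1) + x)) = off SB (arm SA + u) + z := by
      rw [← hf _ m1, parentNumber_level hA (by omega) (hxw _ (by omega)),
        proj_of_lt (by rw [stem_arm (by omega)]; exact hxw _ (by omega)), hfu]
    have p2 : parentNumber SB (f (off SA (top SA + 1 + b) + x)) = off SB (arm SA + u) + z := by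
      rw [← hf _ m2, parentNumber_leaf hA hxA, Nat.add_assoc (arm SA), ← hu, hfu]
    have pos1 := hfpos _ m1 (by have := hoffpos (arm SA + u + 1) (by omega); omega)
    have pos2 := hfpos _ m2 (by have := hoffpos (top SA + 1 + b) (by omega); omega)
    have hne : f (off SA (arm SA + u + 1) + x) ≠ f (off SA (top SA + 1 + b) + x) := by
      intro h
      have := (offset_add_inj hwA (hxw _ (by omega)) (hxw _ (by omega)) (hinj m1 m2 h)).1
      omega
    have fin : ∀ b' ≤ κ, arm SB + 2 * b' + bit SB b' z = arm SA + u → bit SB b z = bit SA b x := by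
      intro b' _ h'
      have q1 := bit_le hA b x
      have q2 := bit_le hB b' z
      obtain rfl : b' = b := by omega
      omega
    rcases child_cases hB (by omega) (hzw _ (by omega)) (hfS _ m1) pos1 p1 with
      c1 | ⟨b', hb', _, c1⟩
    · rcases child_cases hB (by omega) (hzw _ (by omega)) (hfS _ m2) pos2 p2 with
        c2 | ⟨b', hb', _, c2⟩
      · exact absurd (c1.trans c2.symm) hne
      · exact fin b' hb' c2
    · exact fin b' hb' c1
  have hxmod : x % slots SA = j := by
    rw [hxdef, Nat.mul_comm, Nat.mul_add_mod, Nat.mod_eq_of_lt hj]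
  refine ⟨z % slots SA, Nat.mod_lt _ hEpos, fun b hb => ?_, fun hα => ?_⟩
  · have := hbit b hb.le (by have := bit_le hA b x; omega)
    rw [bit, bit, if_pos hb, if_pos hb, hxmod] at this
    exact this
  · have e : bit SA κ x = 0 := by rw [bit, if_neg (lt_irrefl _)]; exact hα
    have := hbit κ le_rfl (by omega)
    rw [e, bit, if_neg (lt_irrefl _)] at this
    rw [← hzq, Nat.div_add_mod']
    exact this

/-- If the bit of a slot depends on the column and on the label `c < 2 ^ κ` of the slot only, then
an embedding amounts to the choice of a column `i` of the first tree and a column `i'` of the second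
tree (below the last leaf of its upper part) such that, for each label, the bit in column `i'` is
`0` if the bit in column `i` is `0`. -/
theorem isoToSubtree_iff (hA : Valid SA) (hB : Valid SB) {a b : ℕ → ℕ → ℕ}
    (hα : ∀ x, α x = a (x / slots SA) (x % slots SA % 2 ^ κ))
    (hβ : ∀ x, β x = if x / slots SB < d ^ L - 1 then 0
      else b (x / slots SB - (d ^ L - 1)) (x % slots SB % 2 ^ κ)) :
    (tree SA hA).IsoToSubtree (tree SB hB) ↔
      ∃ i < d ^ L, ∃ i' < d ^ L, ∀ c < 2 ^ κ, a i c = 0 → b i' c = 0 := by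
  have hd : 2 ≤ d := hA.two_le_d
  have hEpos : 0 < slots SA := Nat.pow_pos (show 0 < d by omega)
  have hslots : slots SB = slots SA := rfl
  rw [hslots] at hβ
  constructor
  · intro h
    obtain ⟨i, hi, i', hi', h⟩ := columns_of_isoToSubtree hA hB h
    refine ⟨i, hi, i', hi', fun c hc hac => ?_⟩
    have hcE : c < slots SA := by
      refine hc.trans_le ((Nat.pow_le_pow_left hd κ).trans ?_)
      exact Nat.pow_le_pow_right (show 0 < d by omega) (by simp only; omega)
    obtain ⟨j', hj', hbits, hj⟩ := h c hcE
    have hmod : j' % 2 ^ κ = c := by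
      apply Nat.eq_of_testBit_eq
      intro n
      rw [Nat.testBit_mod_two_pow]
      by_cases hn : n < κ
      · have := hbits n hn
        simp [hn, Nat.testBit_eq_decide_div_mod_eq, this]
      · have : c < 2 ^ n := hc.trans_le (Nat.pow_le_pow_right (by omega) (by omega))
        simp [hn, Nat.testBit_lt_two_pow this]
    have key : ∀ q r, r < slots SA → (q * slots SA + r) / slots SA = q ∧
        (q * slots SA + r) % slots SA = r := fun q r hr => by
      rw [Nat.mul_comm, Nat.mul_add_div hEpos, Nat.mul_add_mod, Nat.div_eq_of_lt hr,
        Nat.mod_eq_of_lt hr]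
      simp
    rw [hα, hβ, (key _ _ hcE).1, (key _ _ hcE).2, (key _ _ hj').1, (key _ _ hj').2,
      Nat.mod_eq_of_lt hc, hmod, if_neg (by omega), Nat.add_sub_cancel_left] at hj
    exact hj hac
  · rintro ⟨i, hi, i', hi', h⟩
    refine isoToSubtree_of_columns hA hB hi hi' fun x hx hx0 => ?_
    have hz : levelMap d L κ i i' (arm SA) x =
        columnMap d L i i' (x / slots SA) * slots SA + x % slots SA := levelMap_arm le_rfl x
    have hq : x / slots SA < d ^ L := by
      rw [width_arm_eq, width_two_mul hA] at hx
      simpa using (Nat.div_lt_iff_lt_mul hEpos).2 hx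
    rw [hβ, hz, Nat.mul_comm, Nat.mul_add_div hEpos, Nat.mul_add_mod,
      Nat.div_eq_of_lt (Nat.mod_lt _ hEpos), Nat.add_zero, Nat.mod_mod]
    split_ifs with hlt
    · rfl
    · rw [columnMap] at hlt ⊢
      split_ifs at hlt ⊢ with hqi
      · rw [Nat.add_sub_cancel_left]
        refine h _ (Nat.mod_lt _ (by positivity)) ?_
        rw [← hqi, ← hα]
        exact hx0
      · exact absurd (shuffle_lt_of_ne (by omega) hi hq hqi) hlt

end embedding
end Shape

/-! ### Running time of structured programs -/

/-- A straight-line program. -/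
def block (is : List Instr) : Prog := is.foldr (fun a p => .seq (.instr a) p) .skip

/-- The unit in which running times are counted: it covers every block of at most `60`
instructions that starts with numbers at most `M`. The factor is generous: each instruction at most
doubles the largest length of a number, so that `3 * 2 ^ 60` would do. -/
def unitCost (M : ℕ) : ℕ := 2 ^ 64 * M.size

/-- The program `p` takes the state `s` to the state `s'` in at most `k` units of time. -/
def Steps (M : ℕ) (p : Prog) (s s' : State) (k : ℕ) : Prop :=
  ∃ t ≤ k * unitCost M, Exec p s s' t

/-- All numbers in registers and memory are at most `X`. -/
def State.BoundedBy (s : State) (X : ℕ) : Prop := (∀ i, s.reg i ≤ X) ∧ ∀ a, s.mem a ≤ X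

/-- The constant that occurs in an instruction, if any. -/
def Instr.constant : Instr → ℕ
  | .const _ c => c
  | _ => 0

section
variable {M : ℕ} {p q : Prog} {s s' s'' : State} {k k' : ℕ}

theorem Steps.mono (h : Steps M p s s' k) (hk : k ≤ k') : Steps M p s s' k' := by
  obtain ⟨t, ht, he⟩ := h
  exact ⟨t, ht.trans (Nat.mul_le_mul_right _ hk), he⟩

theorem Steps.seq (h : Steps M p s s' k) (h' : Steps M q s' s'' k') :
    Steps M (.seq p q) s s'' (k + k') := by
  obtain ⟨t, ht, he⟩ := h
  obtain ⟨t', ht', he'⟩ := h'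
  exact ⟨t + t', by rw [Nat.add_mul]; omega, .seq he he'⟩

theorem size_pos_of_two_le (hM : 2 ≤ M) : 0 < M.size := Nat.size_pos.2 (by omega)

theorem size_le_unitCost (hM : 2 ≤ M) {x : ℕ} (hx : x ≤ M) : 1 + x.size ≤ unitCost M := by
  have h1 := size_pos_of_two_le hM
  have h2 := Nat.size_le_size hx
  unfold unitCost
  omega

/-- A loop that runs through the states `σ 0, …, σ n`. -/
theorem Steps.loop {i n : ℕ} (hM : 2 ≤ M) (σ : ℕ → State)
    (hσ : ∀ j < n, (σ j).reg i ≠ 0 ∧ (σ j).reg i ≤ M ∧ Steps M p (σ j) (σ (j + 1)) k)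
    (hn : (σ n).reg i = 0) : Steps M (.loop i p) (σ 0) (σ n) (n * (k + 1) + 1) := by
  induction n generalizing σ with
  | zero =>
    exact ⟨1, by have := size_le_unitCost hM (Nat.zero_le M); omega, .loop_done hn⟩
  | succ n ih =>
    obtain ⟨h0, hi, t, ht, he⟩ := hσ 0 (Nat.succ_pos n)
    obtain ⟨t', ht', he'⟩ := ih (fun j => σ (j + 1)) (fun j hj => hσ (j + 1) (by omega)) hn
    refine ⟨_, ?_, .loop_step h0 he he'⟩
    have h1 := size_le_unitCost hM hi
    have h2 : ((n + 1) * (k + 1) + 1) * unitCost M =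
      (n * (k + 1) + 1) * unitCost M + (k * unitCost M + unitCost M) := by ring
    omega

theorem Instr.boundedBy_apply {a : Instr} {X : ℕ} (hX : 2 ≤ X) (hs : s.BoundedBy X)
    (ha : a.constant ≤ X) : (a.apply s).BoundedBy (X * X) := by
  have hXX : X + X ≤ X * X := by nlinarith
  have key : ∀ i x, x ≤ X * X → (s.setReg i x).BoundedBy (X * X) := by
    intro i x hx
    refine ⟨fun j => ?_, fun a => (hs.2 a).trans (by omega)⟩
    simp only [State.setReg, Function.update_apply]
    split_ifs
    · exact hx
    · exact (hs.1 j).trans (by omega)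
  have hr := hs.1
  cases a with
  | const i c => exact key _ _ (le_trans ha (by omega))
  | add i j k => exact key _ _ (by have := hr j; have := hr k; omega)
  | sub i j k => exact key _ _ (by have := hr j; omega)
  | mul i j k => exact key _ _ (Nat.mul_le_mul (hr j) (hr k))
  | div i j k => exact key _ _ ((Nat.div_le_self _ _).trans (by have := hr j; omega))
  | load i j => exact key _ _ ((hs.2 _).trans (by omega))
  | store i j =>
    refine ⟨fun j => (hr j).trans (by omega), fun b => ?_⟩
    simp only [Instr.apply, State.setMem, Function.update_apply]
    split_ifs
    · exact (hr j).trans (by omega)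
    · exact (hs.2 b).trans (by omega)

theorem Instr.cost_le {a : Instr} {X : ℕ} (hX : 2 ≤ X) (hs : s.BoundedBy X)
    (ha : a.constant ≤ X) : a.cost s ≤ 3 * X.size := by
  have h1 := size_pos_of_two_le hX
  have h2 : ∀ j, (s.reg j).size ≤ X.size := fun j => Nat.size_le_size (hs.1 j)
  have h3 : ∀ j, (s.mem j).size ≤ X.size := fun j => Nat.size_le_size (hs.2 j)
  cases a with
  | const i c => have := Nat.size_le_size ha; simp only [Instr.constant] at this
                 simp only [Instr.cost]; omega
  | add i j k => have := h2 j; have := h2 k; simp only [Instr.cost]; omega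
  | sub i j k => have := h2 j; have := h2 k; simp only [Instr.cost]; omega
  | mul i j k => have := h2 j; have := h2 k; simp only [Instr.cost]; omega
  | div i j k => have := h2 j; have := h2 k; simp only [Instr.cost]; omega
  | load i j => have := h2 j; have := h3 (s.reg j); simp only [Instr.cost]; omega
  | store i j => have := h2 i; have := h2 j; simp only [Instr.cost]; omega

theorem size_mul_self_le (X : ℕ) : (X * X).size ≤ 2 * X.size := by
  rw [Nat.size_le, Nat.two_mul, pow_add]
  exact Nat.mul_lt_mul'' (Nat.lt_size_self X) (Nat.lt_size_self X)

/-- Each instruction at most squares the largest number, hence at most doubles the lengths. -/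
theorem exec_block (is : List Instr) {X : ℕ} (hX : 2 ≤ X) (hs : s.BoundedBy X)
    (hc : ∀ a ∈ is, a.constant ≤ X) :
    ∃ t, t + 3 * X.size ≤ 3 * 2 ^ is.length * X.size ∧
      Exec (block is) s (is.foldl (fun s a => a.apply s) s) t := by
  induction is generalizing s X with
  | nil => exact ⟨0, by simp, .skip s⟩
  | cons a is ih =>
    have hXX : X ≤ X * X := Nat.le_mul_self X
    have ha := hc a (by simp)
    obtain ⟨t, ht, he⟩ := ih (hX.trans hXX) (Instr.boundedBy_apply hX hs ha)
      (fun b hb => (hc b (by simp [hb])).trans hXX)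
    refine ⟨a.cost s + t, ?_, .seq (.instr a s) he⟩
    have h1 := Instr.cost_le hX hs ha
    have h2 := size_mul_self_le X
    have h3 : t + 3 * (X * X).size ≤ 3 * 2 ^ is.length * (X * X).size := ht
    have h4 : 1 ≤ 2 ^ is.length := Nat.one_le_two_pow
    have h5 : t ≤ 3 * (2 ^ is.length - 1) * (X * X).size := by
      rw [Nat.mul_sub, Nat.sub_mul]; omega
    have h6 : 3 * (2 ^ is.length - 1) * (X * X).size ≤ 3 * (2 ^ is.length - 1) * (2 * X.size) :=
      Nat.mul_le_mul_left _ h2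
    have h7 : 3 * (2 ^ is.length - 1) * (2 * X.size) + 6 * X.size =
        3 * 2 ^ (is.length + 1) * X.size := by
      obtain ⟨m, hm⟩ := Nat.exists_eq_add_of_le h4
      rw [pow_succ, hm, Nat.add_sub_cancel_left]; ring
    rw [List.length_cons, ← h7]
    omega

theorem steps_block (is : List Instr) (hlen : is.length ≤ 60) (hM : 2 ≤ M) (hs : s.BoundedBy M)
    (hc : ∀ a ∈ is, a.constant ≤ M) :
    Steps M (block is) s (is.foldl (fun s a => a.apply s) s) 1 := by
  obtain ⟨t, ht, he⟩ := exec_block is hM hs hc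
  refine ⟨t, ?_, he⟩
  have h1 : 3 * 2 ^ is.length ≤ 2 ^ 64 := by
    have := Nat.pow_le_pow_right (n := 2) (by norm_num) hlen
    omega
  have h2 := Nat.mul_le_mul_right M.size h1
  unfold unitCost
  omega

end

/-! ### The registers of the reduction -/

/-- The contents of the registers: `out` is the number of used memory cells, `len`, `tbl` and `bas`
are the places in memory where the powers of two, the table of clauses and the output start, and the
others hold the numbers of the same names in the construction of the trees or are auxiliary. -/
structure Vars where
  (out len tbl bas m Q E κ L N h off w U lc y rem op pb sz ptr cnt sat i t1 t2 t3 t4 t5 d : ℕ)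

namespace Vars

/-- The contents of registers `0, …, 29`. -/
def toList (v : Vars) : List ℕ :=
  [v.out, v.len, v.tbl, v.bas, v.m, v.Q, v.E, v.κ, v.L, v.N, v.h, v.off, v.w, v.U, v.lc, v.y,
    v.rem, v.op, v.pb, v.sz, v.ptr, v.cnt, v.sat, v.i, v.t1, v.t2, v.t3, v.t4, v.t5, v.d]

/-- The content of register `i`, which is `0` for `i ≥ 30`. -/
def get (v : Vars) (i : ℕ) : ℕ := v.toList.getD i 0

/-- Assignment to register `i`, for `i < 30`. -/
def set (v : Vars) (i x : ℕ) : Vars :=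
  match i with
  | 0 => {v with out := x}
  | 1 => {v with len := x}
  | 2 => {v with tbl := x}
  | 3 => {v with bas := x}
  | 4 => {v with m := x}
  | 5 => {v with Q := x}
  | 6 => {v with E := x}
  | 7 => {v with κ := x}
  | 8 => {v with L := x}
  | 9 => {v with N := x}
  | 10 => {v with h := x}
  | 11 => {v with off := x}
  | 12 => {v with w := x}
  | 13 => {v with U := x}
  | 14 => {v with lc := x}
  | 15 => {v with y := x}
  | 16 => {v with rem := x}
  | 17 => {v with op := x}
  | 18 => {v with pb := x}
  | 19 => {v with sz := x}
  | 20 => {v with ptr := x}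
  | 21 => {v with cnt := x}
  | 22 => {v with sat := x}
  | 23 => {v with i := x}
  | 24 => {v with t1 := x}
  | 25 => {v with t2 := x}
  | 26 => {v with t3 := x}
  | 27 => {v with t4 := x}
  | 28 => {v with t5 := x}
  | _ => {v with d := x}

theorem toList_set (v : Vars) {i : ℕ} (hi : i < 30) (x : ℕ) :
    (v.set i x).toList = v.toList.set i x := by
  interval_cases i <;> rfl

theorem get_set (v : Vars) {i : ℕ} (hi : i < 30) (x : ℕ) :
    (v.set i x).get = Function.update v.get i x := by
  funext j
  simp only [get, toList_set v hi, Function.update_apply, List.getD_eq_getElem?_getD,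
    List.getElem?_set]
  have : i < v.toList.length := hi
  split_ifs with h1 h2 h2 <;> first | rfl | omega

/-- The equations that read named registers, as one rewriting rule. -/
theorem get_eqs (v : Vars) :
    v.get 0 = v.out ∧ v.get 1 = v.len ∧ v.get 2 = v.tbl ∧ v.get 3 = v.bas ∧ v.get 4 = v.m ∧
    v.get 5 = v.Q ∧ v.get 6 = v.E ∧ v.get 7 = v.κ ∧ v.get 8 = v.L ∧ v.get 9 = v.N ∧
    v.get 10 = v.h ∧ v.get 11 = v.off ∧ v.get 12 = v.w ∧ v.get 13 = v.U ∧ v.get 14 = v.lc ∧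
    v.get 15 = v.y ∧ v.get 16 = v.rem ∧ v.get 17 = v.op ∧ v.get 18 = v.pb ∧ v.get 19 = v.sz ∧
    v.get 20 = v.ptr ∧ v.get 21 = v.cnt ∧ v.get 22 = v.sat ∧ v.get 23 = v.i ∧ v.get 24 = v.t1 ∧
    v.get 25 = v.t2 ∧ v.get 26 = v.t3 ∧ v.get 27 = v.t4 ∧ v.get 28 = v.t5 ∧ v.get 29 = v.d :=
  ⟨rfl, rfl, rfl, rfl, rfl, rfl, rfl, rfl, rfl, rfl, rfl, rfl, rfl, rfl, rfl, rfl, rfl, rfl,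
    rfl, rfl, rfl, rfl, rfl, rfl, rfl, rfl, rfl, rfl, rfl, rfl⟩

/-- The equations that write named registers, as one rewriting rule. -/
theorem set_eqs (v : Vars) (x : ℕ) :
    v.set 0 x = {v with out := x} ∧ v.set 1 x = {v with len := x} ∧ v.set 2 x = {v with tbl := x} ∧
    v.set 3 x = {v with bas := x} ∧ v.set 4 x = {v with m := x} ∧ v.set 5 x = {v with Q := x} ∧
    v.set 6 x = {v with E := x} ∧ v.set 7 x = {v with κ := x} ∧ v.set 8 x = {v with L := x} ∧
    v.set 9 x = {v with N := x} ∧ v.set 10 x = {v with h := x} ∧ v.set 11 x = {v with off := x} ∧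
    v.set 12 x = {v with w := x} ∧ v.set 13 x = {v with U := x} ∧ v.set 14 x = {v with lc := x} ∧
    v.set 15 x = {v with y := x} ∧ v.set 16 x = {v with rem := x} ∧ v.set 17 x = {v with op := x} ∧
    v.set 18 x = {v with pb := x} ∧ v.set 19 x = {v with sz := x} ∧
    v.set 20 x = {v with ptr := x} ∧ v.set 21 x = {v with cnt := x} ∧
    v.set 22 x = {v with sat := x} ∧ v.set 23 x = {v with i := x} ∧ v.set 24 x = {v with t1 := x} ∧
    v.set 25 x = {v with t2 := x} ∧ v.set 26 x = {v with t3 := x} ∧ v.set 27 x = {v with t4 := x} ∧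
    v.set 28 x = {v with t5 := x} ∧ v.set 29 x = {v with d := x} :=
  ⟨rfl, rfl, rfl, rfl, rfl, rfl, rfl, rfl, rfl, rfl, rfl, rfl, rfl, rfl, rfl, rfl, rfl, rfl,
    rfl, rfl, rfl, rfl, rfl, rfl, rfl, rfl, rfl, rfl, rfl, rfl⟩

/-- All registers are at most `M`. -/
structure BoundedBy (v : Vars) (M : ℕ) : Prop where
  out : v.out ≤ M
  len : v.len ≤ M
  tbl : v.tbl ≤ M
  bas : v.bas ≤ M
  m : v.m ≤ M
  Q : v.Q ≤ M
  E : v.E ≤ M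
  κ : v.κ ≤ M
  L : v.L ≤ M
  N : v.N ≤ M
  h : v.h ≤ M
  off : v.off ≤ M
  w : v.w ≤ M
  U : v.U ≤ M
  lc : v.lc ≤ M
  y : v.y ≤ M
  rem : v.rem ≤ M
  op : v.op ≤ M
  pb : v.pb ≤ M
  sz : v.sz ≤ M
  ptr : v.ptr ≤ M
  cnt : v.cnt ≤ M
  sat : v.sat ≤ M
  i : v.i ≤ M
  t1 : v.t1 ≤ M
  t2 : v.t2 ≤ M
  t3 : v.t3 ≤ M
  t4 : v.t4 ≤ M
  t5 : v.t5 ≤ M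
  d : v.d ≤ M

theorem BoundedBy.get {v : Vars} {M : ℕ} (h : v.BoundedBy M) (i : ℕ) : v.get i ≤ M := by
  rw [Vars.get, List.getD_eq_getElem?_getD]
  rcases hx : v.toList[i]? with _ | x
  · exact Nat.zero_le _
  · have := List.mem_of_getElem? hx
    obtain ⟨⟩ := h
    simp only [toList, List.mem_cons, List.not_mem_nil, or_false] at this
    simp only [Option.getD_some]
    rcases this with rfl | rfl | rfl | rfl | rfl | rfl | rfl | rfl | rfl | rfl | rfl | rfl | rfl |
      rfl | rfl | rfl | rfl | rfl | rfl | rfl | rfl | rfl | rfl | rfl | rfl | rfl | rfl | rfl |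
      rfl | rfl <;> assumption

end Vars

/-- A memory that holds the list `l`, followed by zeros. -/
def listMem (l : List ℕ) (a : ℕ) : ℕ := l.getD a 0

/-- The state given by named registers and a list. -/
def conf (v : Vars) (l : List ℕ) : State := ⟨v.get, listMem l⟩

theorem update_listMem_length (l : List ℕ) (x : ℕ) :
    Function.update (listMem l) l.length x = listMem (l ++ [x]) := by
  funext a
  simp only [listMem, Function.update_apply, List.getD_eq_getElem?_getD, List.getElem?_append]
  split_ifs with h1 h2 h2
  · omega
  · simp [h1]
  · rfl
  · rw [List.getElem?_eq_none (by omega), List.getElem?_eq_none (by simp; omega)]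

theorem update_listMem_of_lt {l : List ℕ} {a : ℕ} (ha : a < l.length) (x : ℕ) :
    Function.update (listMem l) a x = listMem (l.set a x) := by
  funext b
  simp only [listMem, Function.update_apply, List.getD_eq_getElem?_getD, List.getElem?_set]
  split_ifs with h1 h2 h2 <;> first | rfl | omega

theorem conf_boundedBy {v : Vars} {l : List ℕ} {M : ℕ} (hv : v.BoundedBy M)
    (hl : ∀ x ∈ l, x ≤ M) : (conf v l).BoundedBy M := by
  refine ⟨hv.get, fun a => ?_⟩
  simp only [conf, listMem, List.getD_eq_getElem?_getD]
  rcases hx : l[a]? with _ | x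
  · exact Nat.zero_le _
  · exact hl x (List.mem_of_getElem? hx)

/-- The effect of an instruction, in terms of named registers. -/
def Instr.applyVars : Instr → Vars × (ℕ → ℕ) → Vars × (ℕ → ℕ)
  | .const i c, s => (s.1.set i c, s.2)
  | .add i j k, s => (s.1.set i (s.1.get j + s.1.get k), s.2)
  | .sub i j k, s => (s.1.set i (s.1.get j - s.1.get k), s.2)
  | .mul i j k, s => (s.1.set i (s.1.get j * s.1.get k), s.2)
  | .div i j k, s => (s.1.set i (s.1.get j / s.1.get k), s.2)
  | .load i j, s => (s.1.set i (s.2 (s.1.get j)), s.2)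
  | .store i j, s => (s.1, Function.update s.2 (s.1.get i) (s.1.get j))

/-- The instruction writes to a named register, and its constant is at most `4`. -/
def Instr.fits : Instr → Bool
  | .const i c => i < 30 && c ≤ 4
  | .add i _ _ => i < 30
  | .sub i _ _ => i < 30
  | .mul i _ _ => i < 30
  | .div i _ _ => i < 30
  | .load i _ => i < 30
  | .store _ _ => true

theorem Instr.apply_eq_applyVars {a : Instr} (ha : a.fits) (s : Vars × (ℕ → ℕ)) :
    a.apply ⟨s.1.get, s.2⟩ = ⟨(a.applyVars s).1.get, (a.applyVars s).2⟩ := by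
  cases a <;> simp only [Instr.fits, Bool.and_eq_true, decide_eq_true_eq] at ha <;>
    simp [Instr.apply, Instr.applyVars, State.setReg, State.setMem, Vars.get_set, ha]

theorem foldl_apply_eq_foldl_applyVars {is : List Instr} (his : is.all Instr.fits)
    (s : Vars × (ℕ → ℕ)) :
    is.foldl (fun s a => a.apply s) ⟨s.1.get, s.2⟩ =
      ⟨(is.foldl (fun s a => a.applyVars s) s).1.get,
        (is.foldl (fun s a => a.applyVars s) s).2⟩ := by
  induction is generalizing s with
  | nil => rfl
  | cons a is ih =>
    rw [List.all_cons, Bool.and_eq_true] at his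
    rw [List.foldl_cons, List.foldl_cons, Instr.apply_eq_applyVars his.1, ih his.2]

theorem Instr.constant_le_of_fits {a : Instr} (ha : a.fits) : a.constant ≤ 4 := by
  cases a <;> simp_all [Instr.fits, Instr.constant]

/-- The effect of a straight-line program, in terms of named registers. -/
def runVars (is : List Instr) (s : Vars × (ℕ → ℕ)) : Vars × (ℕ → ℕ) :=
  is.foldl (fun s a => a.applyVars s) s

/-- The effect of a block can be computed symbolically. -/
theorem Steps.block {M : ℕ} {is : List Instr} {v v' : Vars} {l l' : List ℕ}
    (hM : 4 ≤ M) (hv : v.BoundedBy M) (hl : ∀ x ∈ l, x ≤ M)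
    (his : (is.all Instr.fits && is.length ≤ 60) = true)
    (hrun : (runVars is (v, listMem l)).1 = v')
    (hmem : (runVars is (v, listMem l)).2 = listMem l') :
    Steps M (block is) (conf v l) (conf v' l') 1 := by
  rw [Bool.and_eq_true, decide_eq_true_eq] at his
  have h1 := steps_block is his.2 (by omega) (conf_boundedBy hv hl)
    (fun a ha => (Instr.constant_le_of_fits (List.all_eq_true.1 his.1 a ha)).trans hM)
  have h2 := foldl_apply_eq_foldl_applyVars his.1 (v, listMem l)
  unfold runVars at hrun hmem
  rw [hrun, hmem] at h2
  unfold conf at h1 ⊢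
  rwa [h2] at h1

/-- The loop that writes the numbers `g 0, …, g (n - 1)`. -/
theorem Steps.writeLoop {M : ℕ} {p : Prog} {v : Vars} {l : List ℕ} {n k : ℕ} (g : ℕ → ℕ)
    (hM : 2 ≤ M) (hn : n ≤ M)
    (hp : ∀ j < n, Steps M p
      (conf {v with out := l.length + j, y := j, rem := n - j} (l ++ (List.range j).map g))
      (conf {v with out := l.length + j + 1, y := j + 1, rem := n - j - 1}
        (l ++ (List.range j).map g ++ [g j])) k) :
    Steps M (.loop 16 p) (conf {v with out := l.length, y := 0, rem := n} l)
      (conf {v with out := l.length + n, y := n, rem := 0} (l ++ (List.range n).map g))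
      (n * (k + 1) + 1) := by
  have h := Steps.loop (M := M) (p := p) (k := k) (i := 16) (n := n) hM
    (fun j => conf {v with out := l.length + j, y := j, rem := n - j} (l ++ (List.range j).map g))
    (fun j hj => ⟨show n - j ≠ 0 by omega, show n - j ≤ M by omega, ?_⟩) (show n - n = 0 by omega)
  · simpa using h
  · have := hp j hj
    rwa [List.append_assoc, ← List.map_singleton, ← List.map_append, ← List.range_succ,
      Nat.sub_sub] at this

/-! ### The program of the reduction -/

/-! The numbers of the registers, in the order of the fields of `Vars`. -/

namespace Reg
abbrev out : ℕ := 0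
abbrev len : ℕ := 1
abbrev tbl : ℕ := 2
abbrev bas : ℕ := 3
abbrev m : ℕ := 4
abbrev Q : ℕ := 5
abbrev E : ℕ := 6
abbrev κ : ℕ := 7
abbrev L : ℕ := 8
abbrev N : ℕ := 9
abbrev h : ℕ := 10
abbrev off : ℕ := 11
abbrev w : ℕ := 12
abbrev U : ℕ := 13
abbrev lc : ℕ := 14
abbrev y : ℕ := 15
abbrev rem : ℕ := 16
abbrev op : ℕ := 17
abbrev pb : ℕ := 18
abbrev sz : ℕ := 19
abbrev ptr : ℕ := 20
abbrev cnt : ℕ := 21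
abbrev sat : ℕ := 22
abbrev i : ℕ := 23
abbrev t1 : ℕ := 24
abbrev t2 : ℕ := 25
abbrev t3 : ℕ := 26
abbrev t4 : ℕ := 27
abbrev t5 : ℕ := 28
abbrev d : ℕ := 29
end Reg

section programs
open Reg Instr

/-! The auxiliary registers `t1, …, t5` are `0` before and after each block, so that `add r s t1`
copies a register, as does `add r s y` where `y` is `0`. -/

/-- Writes the parent of vertex `y` of the next level. -/
def levelVertexCode : List Instr :=
  [.sub t1 y U, .sub t2 y t1, .add t2 off t2, .div t1 t1 d, .add t2 t2 t1, .store out t2,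
    .const t1 1, .add out out t1, .add y y t1, .sub rem rem t1, .const t1 0, .const t2 0]

/-- Finds the number of vertices of the next level. -/
def levelStartCode : List Instr :=
  [.sub t1 w U, .mul t1 t1 d, .add rem U t1, .const y 0, .const t1 0, .const t2 0]

/-- Moves on to the next level. -/
def levelEndCode : List Instr :=
  [.add off off w, .const t1 0, .add w y t1, .const t1 1, .sub lc lc t1, .const t1 0, .const y 0]

/-- Writes the parents of the vertices of the next level. -/
def levelProg : Prog :=
  .seq (block levelStartCode) (.seq (.loop rem (block levelVertexCode)) (block levelEndCode))

/-- Writes the parent of leaf `y` in the current group of leaves that encode a bit of the label. -/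
def labelLeafCode : List Instr :=
  [.div t1 y E, .mul t1 t1 E, .sub t1 y t1, .div t1 t1 pb, .const t2 2, .div t3 t1 t2,
    .mul t3 t3 t2, .sub t1 t1 t3, .mul t1 t1 w, .add t1 op t1, .add t1 t1 y, .store out t1,
    .const t1 1, .add out out t1, .add y y t1, .sub rem rem t1, .const t1 0, .const t2 0,
    .const t3 0]

/-- Starts the group of leaves for the next bit of the label. -/
def labelStartCode : List Instr := [.const y 0, .add rem w y]

/-- Moves on to the next bit of the label. -/
def labelEndCode : List Instr :=
  [.add op op w, .add op op w, .add pb pb pb, .const t1 1, .sub lc lc t1, .const t1 0, .const y 0]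

/-- Writes the leaves that encode the next bit of the label. -/
def labelProg : Prog :=
  .seq (block labelStartCode) (.seq (.loop rem (block labelLeafCode)) (block labelEndCode))

/-- Reads the next literal of the current clause, and increases `sat` if the literal is true under
the partial assignment `i`. -/
def literalCode : List Instr :=
  [.const t1 1, .add ptr ptr t1, .sub cnt cnt t1, .load t2 ptr, .const t3 4, .div t4 t2 t3,
    .mul t3 t4 t3, .sub t2 t2 t3, .add t4 len t4, .load t4 t4, .div t4 i t4, .const t3 2,
    .div t5 t4 t3, .mul t5 t5 t3, .sub t4 t4 t5, .mul t3 t3 h, .add t4 t3 t4, .sub t3 t2 t4,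
    .sub t4 t4 t2, .add t3 t3 t4, .sub t3 t1 t3, .add sat sat t3, .const t1 0, .const t2 0,
    .const t3 0, .const t4 0, .const t5 0]

/-- Finds the clause and the partial assignment of column `y`. -/
def truthStartCode : List Instr :=
  [.div t1 y E, .mul t2 t1 E, .sub t2 y t2, .div t3 t2 Q, .mul t3 t3 Q, .sub t2 t2 t3,
    .div t3 t2 m, .mul t3 t3 m, .sub t2 t2 t3, .add t2 tbl t2, .load ptr t2, .load cnt ptr,
    .sub t3 N h, .mul t3 t3 h, .sub i t1 t3, .const sat 0, .const t1 0, .const t2 0, .const t3 0,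
    .const t4 0, .const t5 0]

/-- Writes the parent of the leaf of column `y` that tells whether the clause is true. -/
def truthEndCode : List Instr :=
  [.const t1 1, .sub t2 t1 sat, .sub t2 t1 t2, .sub t3 h t2, .sub t2 t2 h, .add t2 t2 t3,
    .sub t3 N h, .mul t3 t3 h, .div t4 y E, .sub t3 t3 t4, .sub t2 t2 t3, .mul t2 t2 w,
    .add t2 op t2, .add t2 t2 y, .store out t2, .add out out t1, .add y y t1, .sub rem rem t1,
    .const ptr 0, .const i 0, .const sat 0, .const t1 0, .const t2 0, .const t3 0, .const t4 0]

/-- Writes the leaf of column `y` that records the truth value of its clause. -/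
def truthProg : Prog :=
  .seq (block truthStartCode) (.seq (.loop cnt (block literalCode)) (block truthEndCode))

/-- Reserves a place for the number of vertices, and writes the root. -/
def treeStartCode : List Instr :=
  [.const y 0, .add sz out y, .const U 0, .const off 0, .const w 1, .store out y, .add out out w,
    .store out y, .add out out w, .add lc L y, .const t1 0, .const t2 0, .const rem 0]

/-- Prepares the levels `L, …, 2 * L`. -/
def treeMidCode : List Instr := [.sub U N h, .add lc L t1]

/-- Prepares the levels of the trees of slots. -/
def treeSlotsCode : List Instr := [.const U 0, .const t1 1, .add lc κ t1, .add lc lc lc,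
  .const t1 0]

/-- Prepares the arms, whose start is kept in `op`. -/
def treeArmCode : List Instr :=
  [.add U w t1, .add op off t1, .add lc κ κ, .const t1 1, .add lc lc t1, .add lc lc h,
    .const t1 0]

/-- Prepares the leaves that encode the labels. -/
def treeLabelCode : List Instr := [.const pb 1, .add lc κ t1, .const t3 0]

/-- Prepares the leaves that record the truth values. -/
def treeTruthCode : List Instr := [.const y 0, .add rem w y, .const ptr 0, .const i 0,
  .const sat 0, .const t4 0, .const cnt 0, .const t5 0]

/-- Writes the number of vertices in the place reserved for it. -/
def treeEndCode : List Instr :=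
  [.sub t1 out sz, .const t2 1, .sub t1 t1 t2, .store sz t1, .const t1 0, .const t2 0,
    .const U 0, .const off 0, .const w 0, .const op 0, .const pb 0, .const y 0, .const sz 0]

/-- Writes the encoding of the tree of the half `h` of the variables. -/
def treeProg : Prog :=
  .seq (block treeStartCode) <| .seq (.loop lc levelProg) <| .seq (block treeMidCode) <|
  .seq (.loop lc levelProg) <| .seq (block treeSlotsCode) <| .seq (.loop lc levelProg) <|
  .seq (block treeArmCode) <| .seq (.loop lc levelProg) <| .seq (block treeLabelCode) <|
  .seq (.loop lc labelProg) <| .seq (block treeTruthCode) <| .seq (.loop rem truthProg)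
    (block treeEndCode)

end programs

/-! ### The program writes the trees -/

/-- The registers while the tree of shape `D` is written, between two phases. -/
abbrev Vars.work (v : Vars) (D : Shape) (out off w U lc op pb sz : ℕ) : Vars :=
  {v with
    Q := 2 ^ D.κ, E := D.slots, κ := D.κ, L := D.L, N := D.d ^ D.L, h := D.h, d := D.d,
    out := out, off := off, w := w, U := U, lc := lc, op := op, pb := pb, sz := sz, y := 0,
    rem := 0, ptr := 0, cnt := 0, sat := 0, i := 0, t1 := 0, t2 := 0, t3 := 0, t4 := 0, t5 := 0}

section specs
variable {M : ℕ} {v : Vars} {l : List ℕ}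

theorem steps_levelVertex (hM : 4 ≤ M) (hv : v.BoundedBy M) (hl : ∀ x ∈ l, x ≤ M)
    (hout : v.out = l.length) :
    Steps M (block levelVertexCode) (conf v l)
      (conf {v with out := v.out + 1, y := v.y + 1, rem := v.rem - 1, t1 := 0, t2 := 0}
        (l ++ [v.off + (v.y - (v.y - v.U)) + (v.y - v.U) / v.d])) 1 := by
  refine Steps.block hM hv hl (by decide) ?_ ?_
  · simp only [runVars, levelVertexCode, Instr.applyVars, List.foldl_cons, List.foldl_nil,
      Vars.get_eqs, Vars.set_eqs]
  · simp only [runVars, levelVertexCode, Instr.applyVars, List.foldl_cons, List.foldl_nil,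
      Vars.get_eqs, Vars.set_eqs]
    rw [hout, update_listMem_length]

theorem forall_mem_append_map {g : ℕ → ℕ} {n : ℕ} (hl : ∀ x ∈ l, x ≤ M)
    (hg : ∀ j < n, g j ≤ M) : ∀ x ∈ l ++ (List.range n).map g, x ≤ M := by
  intro x hx
  rw [List.mem_append, List.mem_map] at hx
  rcases hx with hx | ⟨j, hj, rfl⟩
  · exact hl x hx
  · exact hg j (List.mem_range.1 hj)

theorem steps_level {D : Shape} (hD : D.Valid) {t lc op pb sz : ℕ} (hM : 4 ≤ M)
    (hl : ∀ x ∈ l, x ≤ M)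
    (hv : (v.work D l.length (D.off t) (D.width t) (D.stem t) lc op pb sz).BoundedBy M)
    (hcap : l.length + D.width (t + 1) ≤ M) (hoff : D.off (t + 1) ≤ M) :
    Steps M levelProg (conf (v.work D l.length (D.off t) (D.width t) (D.stem t) lc op pb sz) l)
      (conf (v.work D (l.length + D.width (t + 1)) (D.off (t + 1)) (D.width (t + 1)) (D.stem t)
        (lc - 1) op pb sz)
        (l ++ (List.range (D.width (t + 1))).map fun y => D.off t + D.proj t y))
      (2 * D.width (t + 1) + 3) := by
  have hg : ∀ j < D.width (t + 1), D.off t + D.proj t j ≤ M := by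
    intro j hj
    exact (offset_add_lt (Nat.lt_succ_self t) (Shape.proj_lt hD hj)).le.trans hoff
  have h1 : Steps M (block levelStartCode)
      (conf (v.work D l.length (D.off t) (D.width t) (D.stem t) lc op pb sz) l)
      (conf {v.work D l.length (D.off t) (D.width t) (D.stem t) lc op pb sz with
        rem := D.width (t + 1)} l) 1 := by
    refine Steps.block hM hv hl (by decide) ?_ ?_
    · simp only [runVars, levelStartCode, Instr.applyVars, List.foldl_cons, List.foldl_nil,
        Vars.get_eqs, Vars.set_eqs, Shape.width_succ]
    · simp only [runVars, levelStartCode, Instr.applyVars, List.foldl_cons, List.foldl_nil,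
        Vars.get_eqs, Vars.set_eqs]
  have h2 := Steps.writeLoop (M := M) (p := block levelVertexCode)
    (v := v.work D l.length (D.off t) (D.width t) (D.stem t) lc op pb sz) (l := l)
    (n := D.width (t + 1)) (k := 1) (fun y => D.off t + D.proj t y) (by omega) (by omega)
    (fun j hj => by
      have := steps_levelVertex
        (v := {v.work D l.length (D.off t) (D.width t) (D.stem t) lc op pb sz with
          out := l.length + j, y := j, rem := D.width (t + 1) - j})
        (l := l ++ (List.range j).map fun y => D.off t + D.proj t y) hM
        {hv with out := by simp only; omega, y := by simp only; omega, rem := by simp only; omega}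
        (forall_mem_append_map hl fun j' hj' => hg j' (by omega)) (by simp)
      simp only [Nat.add_assoc (D.off t)] at this
      exact this)
  have h3 : Steps M (block levelEndCode)
      (conf {v.work D l.length (D.off t) (D.width t) (D.stem t) lc op pb sz with
        out := l.length + D.width (t + 1), y := D.width (t + 1), rem := 0}
        (l ++ (List.range (D.width (t + 1))).map fun y => D.off t + D.proj t y))
      (conf (v.work D (l.length + D.width (t + 1)) (D.off (t + 1)) (D.width (t + 1)) (D.stem t)
        (lc - 1) op pb sz)
        (l ++ (List.range (D.width (t + 1))).map fun y => D.off t + D.proj t y)) 1 := by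
    refine Steps.block hM {hv with out := hcap, y := by simp only; omega}
      (forall_mem_append_map hl hg) (by decide) ?_ ?_
    · simp only [runVars, levelEndCode, Instr.applyVars, List.foldl_cons, List.foldl_nil,
        Vars.get_eqs, Vars.set_eqs, Nat.add_zero, Shape.off, offset_succ]
    · simp only [runVars, levelEndCode, Instr.applyVars, List.foldl_cons, List.foldl_nil,
        Vars.get_eqs, Vars.set_eqs]
  exact (h1.seq (h2.seq h3)).mono (by omega)

end specs

section specs
variable {M : ℕ} {v : Vars} {D : Shape}

theorem Vars.work_boundedBy {out off w U lc op pb sz : ℕ}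
    (hv : (v.work D 0 0 0 0 0 0 0 0).BoundedBy M) (h1 : out ≤ M) (h2 : off ≤ M) (h3 : w ≤ M)
    (h4 : U ≤ M) (h5 : lc ≤ M) (h6 : op ≤ M) (h7 : pb ≤ M) (h8 : sz ≤ M) :
    (v.work D out off w U lc op pb sz).BoundedBy M :=
  {hv with out := h1, off := h2, w := h3, U := h4, lc := h5, op := h6, pb := h7, sz := h8}

/-- The memory after the parents of the first `n` vertices have been written. -/
def treeMem (D : Shape) (pre : List ℕ) (n : ℕ) : List ℕ :=
  pre ++ (List.range n).map D.parentNumber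

theorem length_treeMem (pre : List ℕ) (n : ℕ) : (treeMem D pre n).length = pre.length + n := by
  simp [treeMem]

theorem treeMem_append {pre : List ℕ} {t : ℕ} {g : ℕ → ℕ}
    (hg : ∀ y < D.width t, g y = D.parentNumber (D.off t + y)) :
    treeMem D pre (D.off t) ++ (List.range (D.width t)).map g = treeMem D pre (D.off (t + 1)) := by
  unfold treeMem
  rw [Shape.off, Shape.off, offset_succ, List.range_add, List.map_append, List.append_assoc,
    List.map_map]
  congr 2
  refine List.map_congr_left fun y hy => hg y (List.mem_range.1 hy)

/-- The assumptions on the bound `M` under which the tree `D` can be written behind `pre`. -/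
structure TreeBounds (M : ℕ) (v : Vars) (D : Shape) (pre : List ℕ) : Prop where
  valid : D.Valid
  four_le : 4 ≤ M
  regs : (v.work D 0 0 0 0 0 0 0 0).BoundedBy M
  pre_le : ∀ x ∈ pre, x ≤ M
  cap : pre.length + D.numVertices ≤ M

variable {pre : List ℕ}

theorem Shape.off_le_numVertices {t : ℕ} (ht : t ≤ D.top + 1 + (D.κ + 1)) :
    D.off t ≤ D.numVertices := offset_mono ht

theorem Shape.width_le_numVertices {t : ℕ} (ht : t < D.top + 1 + (D.κ + 1)) :
    D.width t ≤ D.numVertices := by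
  have := Shape.off_le_numVertices (D := D) (Nat.succ_le_of_lt ht)
  rw [Nat.succ_eq_add_one, Shape.off, offset_succ] at this
  omega

theorem Shape.index_le_numVertices (hD : D.Valid) {t : ℕ} (ht : t ≤ D.top + 1 + (D.κ + 1)) :
    t ≤ D.numVertices := (le_offset (Shape.width_pos hD) t).trans (off_le_numVertices ht)

theorem Shape.parentNumber_le (hD : D.Valid) {v : ℕ} (hv : v < D.numVertices) :
    D.parentNumber v ≤ D.numVertices := by
  rcases Nat.eq_zero_or_pos v with rfl | h
  · rw [parentNumber_zero hD]; exact Nat.zero_le _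
  · exact ((parentNumber_lt hD hv h).trans hv).le

theorem TreeBounds.treeMem_le (hB : TreeBounds M v D pre) {n : ℕ} (hn : n ≤ D.numVertices) :
    ∀ x ∈ treeMem D pre n, x ≤ M := by
  refine forall_mem_append_map hB.pre_le fun j hj => ?_
  have hcap := hB.cap
  have := Shape.parentNumber_le hB.valid (hj.trans_le hn)
  omega

theorem steps_nextLevel (hB : TreeBounds M v D pre) {t lc op pb sz : ℕ} (ht : t < D.top)
    (hlc : lc ≤ M) (hop : op ≤ M) (hpb : pb ≤ M) (hsz : sz ≤ M) :
    Steps M levelProg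
      (conf (v.work D (pre.length + D.off (t + 1)) (D.off t) (D.width t) (D.stem t) lc op pb sz)
        (treeMem D pre (D.off (t + 1))))
      (conf (v.work D (pre.length + D.off (t + 1 + 1)) (D.off (t + 1)) (D.width (t + 1)) (D.stem t)
        (lc - 1) op pb sz) (treeMem D pre (D.off (t + 1 + 1))))
      (2 * D.numVertices + 3) := by
  have hcap := hB.cap
  have h1 := Shape.off_le_numVertices (D := D) (t := t) (by omega)
  have h2 := Shape.off_le_numVertices (D := D) (t := t + 1) (by omega)
  have h3 := Shape.off_le_numVertices (D := D) (t := t + 1 + 1) (by omega)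
  have h4 := Shape.width_le_numVertices (D := D) (t := t) (by omega)
  have h5 := Shape.stem_le_width hB.valid t
  have h6 : D.off (t + 1 + 1) = D.off (t + 1) + D.width (t + 1) := offset_succ _
  have h7 := steps_level (v := v) (l := treeMem D pre (D.off (t + 1))) (t := t) (lc := lc)
    (op := op) (pb := pb) (sz := sz) hB.valid hB.four_le (hB.treeMem_le h2)
    (Vars.work_boundedBy hB.regs (by rw [length_treeMem]; omega) (by omega) (by omega) (by omega)
      hlc hop hpb hsz) (by rw [length_treeMem]; omega) (by omega)
  rw [treeMem_append (fun y hy => (Shape.parentNumber_level hB.valid ht hy).symm), length_treeMem,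
    Nat.add_assoc, ← h6] at h7
  exact h7.mono (by omega)

/-- A sequence of levels with the same stem. -/
theorem steps_levels (hB : TreeBounds M v D pre) {t n U op pb sz : ℕ} (ht : t + n ≤ D.top)
    (hU : ∀ s, t ≤ s → s < t + n → D.stem s = U)
    (hop : op ≤ M) (hpb : pb ≤ M) (hsz : sz ≤ M) :
    Steps M (.loop Reg.lc levelProg)
      (conf (v.work D (pre.length + D.off (t + 1)) (D.off t) (D.width t) U n op pb sz)
        (treeMem D pre (D.off (t + 1))))
      (conf (v.work D (pre.length + D.off (t + n + 1)) (D.off (t + n)) (D.width (t + n)) U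
        0 op pb sz) (treeMem D pre (D.off (t + n + 1))))
      (n * (2 * D.numVertices + 4) + 1) := by
  have hcap := hB.cap
  have hn := Shape.index_le_numVertices hB.valid (t := n) (by omega)
  have h := Steps.loop (M := M) (p := levelProg) (i := Reg.lc) (n := n)
    (k := 2 * D.numVertices + 3) (by have := hB.four_le; omega)
    (fun j => conf (v.work D (pre.length + D.off (t + j + 1)) (D.off (t + j)) (D.width (t + j)) U
      (n - j) op pb sz) (treeMem D pre (D.off (t + j + 1))))
    (fun j hj => ⟨show n - j ≠ 0 by omega, show n - j ≤ M by omega, ?_⟩) (show n - n = 0 by omega)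
  · simpa using h
  · have := steps_nextLevel hB (t := t + j) (lc := n - j) (op := op) (pb := pb) (sz := sz)
      (by omega) (by omega) hop hpb hsz
    rwa [hU (t + j) (by omega) (by omega), Nat.sub_sub] at this

theorem Shape.off_arm_add {u b : ℕ} (hb : b ≤ 1) :
    D.off (D.arm + u + b) = D.off (D.arm + u) + b * D.width D.arm := by
  rcases Nat.le_one_iff_eq_zero_or_eq_one.1 hb with rfl | rfl
  · simp
  · rw [Shape.off, Shape.off, offset_succ, Shape.width_of_arm_le (by omega), Nat.one_mul]

theorem steps_labelLeaf {l : List ℕ} (hM : 4 ≤ M) (hv : v.BoundedBy M) (hl : ∀ x ∈ l, x ≤ M)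
    (hout : v.out = l.length) :
    Steps M (block labelLeafCode) (conf v l)
      (conf {v with out := v.out + 1, y := v.y + 1, rem := v.rem - 1, t1 := 0, t2 := 0, t3 := 0}
        (l ++ [v.op + v.y % v.E / v.pb % 2 * v.w + v.y])) 1 := by
  refine Steps.block hM hv hl (by decide) ?_ ?_
  · simp only [runVars, labelLeafCode, Instr.applyVars, List.foldl_cons, List.foldl_nil,
      Vars.get_eqs, Vars.set_eqs]
  · simp only [runVars, labelLeafCode, Instr.applyVars, List.foldl_cons, List.foldl_nil,
      Vars.get_eqs, Vars.set_eqs]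
    rw [hout, update_listMem_length, ← Nat.mod_eq_sub_div_mul, ← Nat.mod_eq_sub_div_mul]

theorem steps_label (hB : TreeBounds M v D pre) {b lc off U sz : ℕ} (hb : b < D.κ)
    (hlc : lc ≤ M) (hoff : off ≤ M) (hU : U ≤ M) (hsz : sz ≤ M) :
    Steps M labelProg
      (conf (v.work D (pre.length + D.off (D.top + 1 + b)) off (D.width D.arm) U lc
        (D.off (D.arm + 2 * b)) (2 ^ b) sz) (treeMem D pre (D.off (D.top + 1 + b))))
      (conf (v.work D (pre.length + D.off (D.top + 1 + (b + 1))) off (D.width D.arm) U (lc - 1)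
        (D.off (D.arm + 2 * (b + 1))) (2 ^ (b + 1)) sz)
        (treeMem D pre (D.off (D.top + 1 + (b + 1)))))
      (2 * D.numVertices + 3) := by
  have hcap := hB.cap
  have hM := hB.four_le
  have hD := hB.valid
  have htop : D.top = D.arm + (2 * D.κ + 1 + D.h) := rfl
  have h1 := Shape.off_le_numVertices (D := D) (t := D.top + 1 + b) (by omega)
  have h2 := Shape.off_le_numVertices (D := D) (t := D.top + 1 + b + 1) (by omega)
  have h3 := Shape.off_le_numVertices (D := D) (t := D.arm + 2 * b) (by omega)
  have h4 := Shape.width_le_numVertices (D := D) (t := D.arm) (by omega)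
  have hw : D.width (D.top + 1 + b) = D.width D.arm := Shape.width_of_arm_le (by omega)
  have h6 : D.off (D.top + 1 + b + 1) = D.off (D.top + 1 + b) + D.width D.arm := by
    rw [Shape.off, offset_succ, hw]
  have hpb : 2 ^ b ≤ M := (Nat.pow_le_pow_right (by omega) hb.le).trans hB.regs.Q
  set l := treeMem D pre (D.off (D.top + 1 + b)) with hl
  have hlen : l.length = pre.length + D.off (D.top + 1 + b) := length_treeMem ..
  set vv := v.work D (pre.length + D.off (D.top + 1 + b)) off (D.width D.arm) U lc
        (D.off (D.arm + 2 * b)) (2 ^ b) sz with hvv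
  have hvvB : vv.BoundedBy M := Vars.work_boundedBy hB.regs (by omega) hoff (by omega) hU hlc
    (by omega) hpb hsz
  set g : ℕ → ℕ := fun y => D.off (D.arm + 2 * b) + y % D.slots / 2 ^ b % 2 * D.width D.arm + y
    with hg
  have hgF : ∀ y < D.width D.arm, g y = D.parentNumber (D.off (D.top + 1 + b) + y) := by
    intro y hy
    have hbit : D.bit b y = y % D.slots / 2 ^ b % 2 := if_pos hb
    rw [Shape.parentNumber_leaf hD hy, hbit, Shape.off_arm_add (by omega)]
  have happ : ∀ n ≤ D.width D.arm, ∀ x ∈ l ++ (List.range n).map g, x ≤ M := by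
    intro n hn
    refine forall_mem_append_map (hB.treeMem_le h1) fun j hj => ?_
    rw [hgF j (by omega)]
    have hv := offset_add_lt (w := D.width) (T := D.top + 1 + (D.κ + 1)) (t := D.top + 1 + b)
      (y := j) (by omega) (by omega)
    exact (Shape.parentNumber_le hD hv).trans (by omega)
  have s1 : Steps M (block labelStartCode) (conf vv l)
      (conf {vv with out := l.length, y := 0, rem := D.width D.arm} l) 1 := by
    refine Steps.block hM hvvB (hB.treeMem_le h1) (by decide) ?_ ?_
    · simp only [runVars, labelStartCode, Instr.applyVars, List.foldl_cons, List.foldl_nil,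
        Vars.get_eqs, Vars.set_eqs, hvv, hlen, Nat.add_zero]
    · simp only [runVars, labelStartCode, Instr.applyVars, List.foldl_cons, List.foldl_nil,
        Vars.get_eqs, Vars.set_eqs]
  have s2 := Steps.writeLoop (M := M) (p := block labelLeafCode) (v := vv) (l := l)
    (n := D.width D.arm) (k := 1) g (by omega) (by omega)
    (fun j hj => steps_labelLeaf
      (v := {vv with out := l.length + j, y := j, rem := D.width D.arm - j})
      (l := l ++ (List.range j).map g) hM
      {hvvB with out := by simp only; omega, y := by simp only; omega, rem := by simp only; omega}
      (happ j hj.le) (by simp))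
  have s3 : Steps M (block labelEndCode)
      (conf {vv with out := l.length + D.width D.arm, y := D.width D.arm, rem := 0}
        (l ++ (List.range (D.width D.arm)).map g))
      (conf (v.work D (pre.length + D.off (D.top + 1 + (b + 1))) off (D.width D.arm) U (lc - 1)
        (D.off (D.arm + 2 * (b + 1))) (2 ^ (b + 1)) sz)
        (treeMem D pre (D.off (D.top + 1 + (b + 1))))) 1 := by
    have e1 : D.off (D.arm + 2 * (b + 1)) =
        D.off (D.arm + 2 * b) + D.width D.arm + D.width D.arm := by
      have a1 := Shape.off_arm_add (D := D) (u := 2 * b) (b := 1) le_rfl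
      have a2 := Shape.off_arm_add (D := D) (u := 2 * b + 1) (b := 1) le_rfl
      rw [show D.arm + 2 * (b + 1) = D.arm + (2 * b + 1) + 1 by omega, a2, ← Nat.add_assoc, a1]
      omega
    refine Steps.block hM {hvvB with
      out := by simp only; omega, y := by simp only; omega, rem := by simp only; omega}
      (happ _ le_rfl) (by decide) ?_ ?_
    · simp only [runVars, labelEndCode, Instr.applyVars, List.foldl_cons, List.foldl_nil,
        Vars.get_eqs, Vars.set_eqs, hvv, hlen]
      simp only [← Nat.add_assoc, h6, e1, pow_succ, Nat.mul_two]
    · simp only [runVars, labelEndCode, Instr.applyVars, List.foldl_cons, List.foldl_nil,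
        Vars.get_eqs, Vars.set_eqs]
      rw [← hw, hl, treeMem_append (by rw [hw]; exact hgF), Nat.add_assoc (D.top + 1)]
  exact (s1.seq (s2.seq s3)).mono (by omega)

end specs

/-- The number of literals, given by their codes, that are true under the partial assignment `i` to
the variables of parity `h`: bit `j` of `i` is the value of the variable `2 * j + h`. -/
def trueCount (h i : ℕ) (codes : List ℕ) : ℕ :=
  codes.countP fun z => z % 4 = 2 * h + i / 2 ^ (z / 4) % 2

/-- The truth value of a clause under a partial assignment. -/
def clauseValue (h i : ℕ) (codes : List ℕ) : ℕ := 1 - (1 - trueCount h i codes)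

/-- The bit recorded on column `y` of a tree. In the first tree (`h = 0`) it is the truth value of
the clause of the column under the partial assignment of the column. In the second tree (`h = 1`) it
is the negation, except for the first columns, where it is `0`. -/
def columnValue (D : Shape) (m : ℕ) (cs : ℕ → List ℕ) (y : ℕ) : ℕ :=
  (clauseValue D.h (y / D.slots - (D.d ^ D.L - D.h) * D.h)
      (cs (y % D.slots % 2 ^ D.κ % m)) - D.h +
    (D.h - clauseValue D.h (y / D.slots - (D.d ^ D.L - D.h) * D.h)
      (cs (y % D.slots % 2 ^ D.κ % m)))) - ((D.d ^ D.L - D.h) * D.h - y / D.slots)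

/-- The list `base` has a table of `m` pointers to clauses at `tbl`, and the powers of two that the
literals of these clauses refer to at `len`. -/
structure ClauseTable (base : List ℕ) (len tbl m : ℕ) (cs : ℕ → List ℕ) : Prop where
  clause : ∀ c < m, ∃ p, base[tbl + c]? = some p ∧ base[p]? = some (cs c).length ∧
    ∀ j (hj : j < (cs c).length), base[p + 1 + j]? = some (cs c)[j] ∧
      base[len + (cs c)[j] / 4]? = some (2 ^ ((cs c)[j] / 4))

theorem listMem_of_prefix {base l : List ℕ} (h : base <+: l) {a x : ℕ} (hx : base[a]? = some x) :
    listMem l a = x := by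
  obtain ⟨r, rfl⟩ := h
  have ha : a < base.length := (List.getElem?_eq_some_iff.1 hx).1
  rw [listMem, List.getD_eq_getElem?_getD, List.getElem?_append_left ha, hx, Option.getD_some]

theorem trueCount_take_succ {h i : ℕ} {codes : List ℕ} {j : ℕ} (hj : j < codes.length) :
    trueCount h i (codes.take (j + 1)) = trueCount h i (codes.take j) +
      if codes[j] % 4 = 2 * h + i / 2 ^ (codes[j] / 4) % 2 then 1 else 0 := by
  rw [trueCount, trueCount, List.take_succ_eq_append_getElem hj, List.countP_append,
    List.countP_singleton]
  simp

theorem trueCount_le (h i : ℕ) (codes : List ℕ) : trueCount h i codes ≤ codes.length :=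
  List.countP_le_length

section specs
variable {M : ℕ} {v : Vars} {D : Shape}

theorem steps_literal {l : List ℕ} {z p : ℕ} (hM : 4 ≤ M) (hv : v.BoundedBy M)
    (hl : ∀ x ∈ l, x ≤ M) (hz : listMem l (v.ptr + 1) = z) (hp : listMem l (v.len + z / 4) = p) :
    Steps M (block literalCode) (conf v l)
      (conf {v with
        ptr := v.ptr + 1, cnt := v.cnt - 1,
        sat := v.sat + if z % 4 = 2 * v.h + v.i / p % 2 then 1 else 0,
        t1 := 0, t2 := 0, t3 := 0, t4 := 0, t5 := 0} l) 1 := by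
  refine Steps.block hM hv hl (by decide) ?_ ?_
  · simp only [runVars, literalCode, Instr.applyVars, List.foldl_cons, List.foldl_nil,
      Vars.get_eqs, Vars.set_eqs, hz, hp, ← Nat.mod_eq_sub_div_mul, Vars.mk.injEq, and_true,
      true_and]
    split_ifs <;> omega
  · simp only [runVars, literalCode, Instr.applyVars, List.foldl_cons, List.foldl_nil,
      Vars.get_eqs, Vars.set_eqs]

theorem steps_truthStart {l : List ℕ} {p k : ℕ} (hM : 4 ≤ M) (hv : v.BoundedBy M)
    (hl : ∀ x ∈ l, x ≤ M) (hp : listMem l (v.tbl + v.y % v.E % v.Q % v.m) = p)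
    (hk : listMem l p = k) :
    Steps M (block truthStartCode) (conf v l)
      (conf {v with
        ptr := p, cnt := k, sat := 0, i := v.y / v.E - (v.N - v.h) * v.h,
        t1 := 0, t2 := 0, t3 := 0, t4 := 0, t5 := 0} l) 1 := by
  refine Steps.block hM hv hl (by decide) ?_ ?_
  · simp only [runVars, truthStartCode, Instr.applyVars, List.foldl_cons, List.foldl_nil,
      Vars.get_eqs, Vars.set_eqs, ← Nat.mod_eq_sub_div_mul, hp, hk]
  · simp only [runVars, truthStartCode, Instr.applyVars, List.foldl_cons, List.foldl_nil,
      Vars.get_eqs, Vars.set_eqs]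

theorem steps_truthEnd {l : List ℕ} (hM : 4 ≤ M) (hv : v.BoundedBy M)
    (hl : ∀ x ∈ l, x ≤ M) (hout : v.out = l.length) :
    Steps M (block truthEndCode) (conf v l)
      (conf {v with
        out := v.out + 1, y := v.y + 1, rem := v.rem - 1, ptr := 0, sat := 0, i := 0,
        t1 := 0, t2 := 0, t3 := 0, t4 := 0}
        (l ++ [v.op + ((1 - (1 - v.sat)) - v.h + (v.h - (1 - (1 - v.sat))) -
          ((v.N - v.h) * v.h - v.y / v.E)) * v.w + v.y])) 1 := by
  refine Steps.block hM hv hl (by decide) ?_ ?_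
  · simp only [runVars, truthEndCode, Instr.applyVars, List.foldl_cons, List.foldl_nil,
      Vars.get_eqs, Vars.set_eqs]
  · simp only [runVars, truthEndCode, Instr.applyVars, List.foldl_cons, List.foldl_nil,
      Vars.get_eqs, Vars.set_eqs]
    rw [hout, update_listMem_length]

theorem steps_clause {l codes : List ℕ} {p K : ℕ} (hM : 4 ≤ M) (hK : codes.length ≤ K)
    (hv : v.BoundedBy M) (hl : ∀ x ∈ l, x ≤ M) (hcodes : codes.length ≤ M)
    (hpM : p + codes.length ≤ M)
    (hmem : ∀ j (hj : j < codes.length), listMem l (p + 1 + j) = codes[j] ∧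
      listMem l (v.len + codes[j] / 4) = 2 ^ (codes[j] / 4)) :
    Steps M (.loop Reg.cnt (block literalCode))
      (conf {v with ptr := p, cnt := codes.length, sat := 0,
                    t1 := 0, t2 := 0, t3 := 0, t4 := 0, t5 := 0} l)
      (conf {v with ptr := p + codes.length, cnt := 0, sat := trueCount v.h v.i codes,
                    t1 := 0, t2 := 0, t3 := 0, t4 := 0, t5 := 0} l) (2 * K + 1) := by
  have h := Steps.loop (M := M) (p := block literalCode) (i := Reg.cnt) (n := codes.length)
    (k := 1) (by omega)
    (fun j => conf {v with
      ptr := p + j, cnt := codes.length - j, sat := trueCount v.h v.i (codes.take j),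
      t1 := 0, t2 := 0, t3 := 0, t4 := 0, t5 := 0} l)
    (fun j hj => ⟨show codes.length - j ≠ 0 by omega, show codes.length - j ≤ M by omega, ?_⟩)
    (show codes.length - codes.length = 0 by omega)
  · have h' := h.mono (k' := 2 * K + 1) (by omega)
    simpa [trueCount] using h'
  · have h1 := trueCount_le v.h v.i (codes.take j)
    rw [List.length_take] at h1
    have := steps_literal (v := {v with
      ptr := p + j, cnt := codes.length - j, sat := trueCount v.h v.i (codes.take j),
      t1 := 0, t2 := 0, t3 := 0, t4 := 0, t5 := 0}) (l := l) (z := codes[j])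
      (p := 2 ^ (codes[j] / 4)) hM
      {hv with ptr := by simp only; omega, cnt := by simp only; omega, sat := by simp only; omega,
               t1 := Nat.zero_le _, t2 := Nat.zero_le _, t3 := Nat.zero_le _, t4 := Nat.zero_le _,
               t5 := Nat.zero_le _} hl
      (by rw [← (hmem j hj).1]; congr 1; simp only; omega) (hmem j hj).2
    simp only [← trueCount_take_succ hj, Nat.sub_sub] at this
    exact this

variable {pre : List ℕ}

theorem steps_truth {base : List ℕ} {cs : ℕ → List ℕ} {K U sz : ℕ} (hB : TreeBounds M v D pre)
    (hβ : ∀ y, D.β y = columnValue D v.m cs y) (hbase : base <+: pre)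
    (htable : ClauseTable base v.len v.tbl v.m cs) (hm : 0 < v.m)
    (hK : ∀ c < v.m, (cs c).length ≤ K)
    {off pb : ℕ} (hoff : off ≤ M) (hpb : pb ≤ M) (hU : U ≤ M) (hsz : sz ≤ M) :
    Steps M (.loop Reg.rem truthProg)
      (conf {v.work D (pre.length + D.off (D.top + 1 + D.κ)) off (D.width D.arm) U 0
        (D.off (D.arm + 2 * D.κ)) pb sz with rem := D.width D.arm}
        (treeMem D pre (D.off (D.top + 1 + D.κ))))
      (conf {v.work D (pre.length + D.numVertices) off (D.width D.arm) U 0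
        (D.off (D.arm + 2 * D.κ)) pb sz with y := D.width D.arm}
        (treeMem D pre D.numVertices))
      (D.width D.arm * (2 * K + 4) + 1) := by
  have hcap := hB.cap
  have hM := hB.four_le
  have hD := hB.valid
  have htop : D.top = D.arm + (2 * D.κ + 1 + D.h) := rfl
  have h1 := Shape.off_le_numVertices (D := D) (t := D.top + 1 + D.κ) (by omega)
  have h3 := Shape.off_le_numVertices (D := D) (t := D.arm + 2 * D.κ) (by omega)
  have h4 := Shape.width_le_numVertices (D := D) (t := D.arm) (by omega)
  have hw : D.width (D.top + 1 + D.κ) = D.width D.arm := Shape.width_of_arm_le (by omega)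
  have h6 : D.numVertices = D.off (D.top + 1 + D.κ) + D.width D.arm := by
    rw [Shape.numVertices, ← Nat.add_assoc, Shape.off, offset_succ, hw]
  set l := treeMem D pre (D.off (D.top + 1 + D.κ)) with hl
  have hlen : l.length = pre.length + D.off (D.top + 1 + D.κ) := length_treeMem ..
  set vv := v.work D (pre.length + D.off (D.top + 1 + D.κ)) off (D.width D.arm) U 0
        (D.off (D.arm + 2 * D.κ)) pb sz with hvv
  have hvvB : vv.BoundedBy M := Vars.work_boundedBy hB.regs (by omega) hoff (by omega) hU
    (Nat.zero_le _) (by omega) hpb hsz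
  set g : ℕ → ℕ := fun y =>
    D.off (D.arm + 2 * D.κ) + columnValue D v.m cs y * D.width D.arm + y with hg
  have hgF : ∀ y < D.width D.arm, g y = D.parentNumber (D.off (D.top + 1 + D.κ) + y) := by
    intro y hy
    have hbit : D.bit D.κ y = columnValue D v.m cs y := by
      rw [Shape.bit, if_neg (lt_irrefl _), hβ]
    have hle := Shape.bit_le hD D.κ y
    rw [Shape.parentNumber_leaf hD hy, Shape.off_arm_add hle, hbit]
  have happ : ∀ n ≤ D.width D.arm, ∀ x ∈ l ++ (List.range n).map g, x ≤ M := by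
    intro n hn
    refine forall_mem_append_map (hB.treeMem_le h1) fun j hj => ?_
    rw [hgF j (by omega)]
    have hv := offset_add_lt (w := D.width) (T := D.top + 1 + (D.κ + 1)) (t := D.top + 1 + D.κ)
      (y := j) (by omega) (by omega)
    exact (Shape.parentNumber_le hD hv).trans (by omega)
  have hpre : ∀ n, base <+: l ++ (List.range n).map g := fun n =>
    hbase.trans ((List.prefix_append _ _).trans (List.prefix_append _ _))
  have hbody : ∀ j < D.width D.arm, Steps M truthProg
      (conf {vv with out := l.length + j, y := j, rem := D.width D.arm - j}
        (l ++ (List.range j).map g))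
      (conf {vv with out := l.length + j + 1, y := j + 1, rem := D.width D.arm - j - 1}
        (l ++ (List.range j).map g ++ [g j])) (2 * K + 3) := by
    intro j hj
    have hc : j % D.slots % 2 ^ D.κ % v.m < v.m := Nat.mod_lt _ hm
    obtain ⟨p, hp1, hp2, hp3⟩ := htable.clause _ hc
    have hmem : ∀ {a x}, base[a]? = some x → listMem (l ++ (List.range j).map g) a = x :=
      fun hx => listMem_of_prefix (hpre j) hx
    have hbM : ∀ {a x : ℕ}, base[a]? = some x → a + 1 ≤ M ∧ x ≤ M := by
      intro a x hx
      have ha := (List.getElem?_eq_some_iff.1 hx).1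
      have := hbase.length_le
      exact ⟨by omega, hB.pre_le _ (hbase.subset (List.mem_of_getElem? hx))⟩
    have hcl := (hbM hp2).2
    have hpcl : p + (cs (j % D.slots % 2 ^ D.κ % v.m)).length ≤ M := by
      rcases Nat.eq_zero_or_pos (cs (j % D.slots % 2 ^ D.κ % v.m)).length with h | h
      · have := (hbM hp2).1; omega
      · have := (hbM (hp3 _ (Nat.sub_lt h Nat.one_pos)).1).1; omega
    have hbnd : ({vv with out := l.length + j, y := j, rem := D.width D.arm - j} :
        Vars).BoundedBy M :=
      {hvvB with
        out := by simp only; omega, y := by simp only; omega, rem := by simp only; omega}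
    have hi : j / D.slots - (D.d ^ D.L - D.h) * D.h ≤ M :=
      (Nat.sub_le _ _).trans ((Nat.div_le_self _ _).trans (by omega))
    have s1 := steps_truthStart
      (v := {vv with out := l.length + j, y := j, rem := D.width D.arm - j})
      (p := p) (k := (cs (j % D.slots % 2 ^ D.κ % v.m)).length) hM hbnd (happ j hj.le)
      (hmem hp1) (hmem hp2)
    have s2 := steps_clause (v := {vv with
        out := l.length + j, y := j, rem := D.width D.arm - j,
        i := j / D.slots - (D.d ^ D.L - D.h) * D.h})
      (l := l ++ (List.range j).map g) (codes := cs (j % D.slots % 2 ^ D.κ % v.m))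
      (p := p) hM (hK _ hc) {hbnd with i := hi} (happ j hj.le) hcl hpcl
      (fun a ha => ⟨hmem (hp3 a ha).1, hmem (hp3 a ha).2⟩)
    have hsat := trueCount_le D.h (j / D.slots - (D.d ^ D.L - D.h) * D.h)
      (cs (j % D.slots % 2 ^ D.κ % v.m))
    have s3 := steps_truthEnd (v := {vv with
        out := l.length + j, y := j, rem := D.width D.arm - j,
        i := j / D.slots - (D.d ^ D.L - D.h) * D.h,
        ptr := p + (cs (j % D.slots % 2 ^ D.κ % v.m)).length, cnt := 0,
        sat := trueCount D.h (j / D.slots - (D.d ^ D.L - D.h) * D.h)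
          (cs (j % D.slots % 2 ^ D.κ % v.m))})
      (l := l ++ (List.range j).map g) hM
      {hbnd with i := hi, ptr := hpcl, cnt := Nat.zero_le _, sat := hsat.trans hcl}
      (happ j hj.le) (by simp)
    exact (s1.seq (s2.seq s3)).mono (by omega)
  have s := Steps.writeLoop (M := M) (p := truthProg) (v := vv) (l := l) (n := D.width D.arm)
    (k := 2 * K + 3) g (by omega) (by omega) hbody
  rw [hlen, hl, ← hw, treeMem_append (by rw [hw]; exact hgF), hw, Nat.add_assoc pre.length,
    ← h6] at s
  exact s

end specs

section specs
variable {M : ℕ} {v : Vars} {D : Shape} {pre : List ℕ}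

theorem steps_labels (hB : TreeBounds M v D pre) {off U sz : ℕ}
    (hoff : off ≤ M) (hU : U ≤ M) (hsz : sz ≤ M) :
    Steps M (.loop Reg.lc labelProg)
      (conf (v.work D (pre.length + D.off (D.top + 1)) off (D.width D.arm) U D.κ
        (D.off D.arm) 1 sz) (treeMem D pre (D.off (D.top + 1))))
      (conf (v.work D (pre.length + D.off (D.top + 1 + D.κ)) off (D.width D.arm) U 0
        (D.off (D.arm + 2 * D.κ)) (2 ^ D.κ) sz) (treeMem D pre (D.off (D.top + 1 + D.κ))))
      (D.κ * (2 * D.numVertices + 4) + 1) := by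
  have hκ := hB.regs.κ
  simp only at hκ
  have h := Steps.loop (M := M) (p := labelProg) (i := Reg.lc) (n := D.κ)
    (k := 2 * D.numVertices + 3) (by have := hB.four_le; omega)
    (fun b => conf (v.work D (pre.length + D.off (D.top + 1 + b)) off (D.width D.arm) U (D.κ - b)
        (D.off (D.arm + 2 * b)) (2 ^ b) sz) (treeMem D pre (D.off (D.top + 1 + b))))
    (fun b hb => ⟨show D.κ - b ≠ 0 by omega, show D.κ - b ≤ M by omega, ?_⟩)
    (show D.κ - D.κ = 0 by omega)
  · simpa using h
  · have := steps_label hB hb (lc := D.κ - b) (by omega) hoff hU hsz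
    rwa [Nat.sub_sub] at this

theorem treeMem_one (hD : D.Valid) : treeMem D pre (D.off (0 + 1)) = pre ++ [0] := by
  have : D.off (0 + 1) = 1 := by
    rw [Shape.off, offset_succ, offset_zero]; rfl
  rw [this, treeMem]
  simp [Shape.parentNumber_zero hD]

/-- The program writes the encoding of the tree of shape `D` behind the list `pre`. -/
theorem steps_tree {base : List ℕ} {cs : ℕ → List ℕ} {K : ℕ}
    (hB : TreeBounds M v D (pre ++ [0])) (hβ : ∀ y, D.β y = columnValue D v.m cs y)
    (hbase : base <+: pre) (htable : ClauseTable base v.len v.tbl v.m cs) (hm : 0 < v.m)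
    (hK : ∀ c < v.m, (cs c).length ≤ K) :
    Steps M treeProg (conf (v.work D pre.length 0 0 0 0 0 0 0) pre)
      (conf (v.work D (pre ++ (D.tree hB.valid).encode).length 0 0 0 0 0 0 0)
        (pre ++ (D.tree hB.valid).encode))
      ((D.top + D.κ) * (2 * D.numVertices + 4) + D.numVertices * (2 * K + 4) + 13) := by
  have hcap := hB.cap
  have hM := hB.four_le
  have hD := hB.valid
  rw [List.length_append, List.length_singleton] at hcap
  have harm : D.arm = 2 * D.L + 2 * (D.κ + 1) := rfl
  have htop : D.top = D.arm + (2 * D.κ + 1 + D.h) := rfl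
  have hw : ∀ t, D.arm ≤ t → D.width t = D.width D.arm := fun t => Shape.width_of_arm_le
  have hidx : ∀ t, t ≤ D.top + 1 + (D.κ + 1) → t ≤ D.numVertices ∧ D.off t ≤ D.numVertices :=
    fun t ht => ⟨Shape.index_le_numVertices hD ht, Shape.off_le_numVertices ht⟩
  have hwid : ∀ t, t < D.top + 1 + (D.κ + 1) → D.width t ≤ D.numVertices :=
    fun t ht => Shape.width_le_numVertices ht
  have hpre : ∀ x ∈ pre, x ≤ M := fun x hx => hB.pre_le x (by simp [hx])
  have hlenpre : (pre ++ [0]).length = pre.length + 1 := by simp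
  have hmem : ∀ n ≤ D.numVertices, ∀ x ∈ treeMem D (pre ++ [0]) n, x ≤ M :=
    fun n hn => hB.treeMem_le hn
  have hN : D.d ^ D.L ≤ M := hB.regs.N
  have hQ : 2 ^ D.κ ≤ M := hB.regs.Q
  have hκ : D.κ ≤ M := hB.regs.κ
  have a1 := hidx (0 + 1) (by omega)
  have a2 := hidx (D.L + 1) (by omega)
  have a3 := hidx (D.L + D.L + 1) (by omega)
  have a4 := hidx (D.arm + 1) (by omega)
  have a5 := hidx (D.top + 1) (by omega)
  have a6 := hidx (D.top + 1 + D.κ) (by omega)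
  have b2 := hidx D.L (by omega)
  have b3 := hidx (D.L + D.L) (by omega)
  have b4 := hidx D.arm (by omega)
  have b5 := hidx D.top (by omega)
  have b6 := hidx (D.arm + 2 * D.κ) (by omega)
  have w2 := hwid D.L (by omega)
  have w3 := hwid (D.L + D.L) (by omega)
  have w4 := hwid D.arm (by omega)
  have s1 : Steps M (block treeStartCode) (conf (v.work D pre.length 0 0 0 0 0 0 0) pre)
      (conf (v.work D ((pre ++ [0]).length + D.off (0 + 1)) (D.off 0) (D.width 0) 0 D.L 0 0
        pre.length) (treeMem D (pre ++ [0]) (D.off (0 + 1)))) 1 := by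
    refine Steps.block hM (Vars.work_boundedBy hB.regs (by omega) (Nat.zero_le _) (Nat.zero_le _)
      (Nat.zero_le _) (Nat.zero_le _) (Nat.zero_le _) (Nat.zero_le _) (Nat.zero_le _)) hpre
      (by decide) ?_ ?_
    · simp only [runVars, treeStartCode, Instr.applyVars, List.foldl_cons, List.foldl_nil,
        Vars.get_eqs, Vars.set_eqs, hlenpre, Nat.add_zero]
      rfl
    · simp only [runVars, treeStartCode, Instr.applyVars, List.foldl_cons, List.foldl_nil,
        Vars.get_eqs, Vars.set_eqs]
      rw [update_listMem_length, ← hlenpre, update_listMem_length, treeMem_one hD]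
  have s2 := steps_levels hB (t := 0) (n := D.L) (U := 0) (op := 0) (pb := 0) (sz := pre.length)
    (by omega) (fun s _ hs => Shape.stem_of_lt (by omega)) (Nat.zero_le _) (Nat.zero_le _)
    (by omega)
  simp only [Nat.zero_add D.L] at s2
  have s3 : Steps M (block treeMidCode)
      (conf (v.work D ((pre ++ [0]).length + D.off (D.L + 1)) (D.off D.L) (D.width D.L) 0 0 0 0
        pre.length) (treeMem D (pre ++ [0]) (D.off (D.L + 1))))
      (conf (v.work D ((pre ++ [0]).length + D.off (D.L + 1)) (D.off D.L) (D.width D.L)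
        (D.d ^ D.L - D.h) D.L 0 0 pre.length) (treeMem D (pre ++ [0]) (D.off (D.L + 1)))) 1 := by
    refine Steps.block hM (Vars.work_boundedBy hB.regs (by omega) (by omega) (by omega)
      (Nat.zero_le _) (Nat.zero_le _) (Nat.zero_le _) (Nat.zero_le _) (by omega)) (hmem _ a2.2)
      (by decide) ?_ ?_
    · simp only [runVars, treeMidCode, Instr.applyVars, List.foldl_cons, List.foldl_nil,
        Vars.get_eqs, Vars.set_eqs, Nat.add_zero]
    · simp only [runVars, treeMidCode, Instr.applyVars, List.foldl_cons, List.foldl_nil,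
        Vars.get_eqs, Vars.set_eqs]
  have s4 := steps_levels hB (t := D.L) (n := D.L) (U := D.d ^ D.L - D.h) (op := 0) (pb := 0)
    (sz := pre.length) (by omega) (fun s hs hs' => Shape.stem_mid hs (by omega))
    (Nat.zero_le _) (Nat.zero_le _) (by omega)
  have s5 : Steps M (block treeSlotsCode)
      (conf (v.work D ((pre ++ [0]).length + D.off (D.L + D.L + 1)) (D.off (D.L + D.L))
        (D.width (D.L + D.L)) (D.d ^ D.L - D.h) 0 0 0
        pre.length) (treeMem D (pre ++ [0]) (D.off (D.L + D.L + 1))))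
      (conf (v.work D ((pre ++ [0]).length + D.off (D.L + D.L + 1)) (D.off (D.L + D.L))
        (D.width (D.L + D.L)) 0 (2 * (D.κ + 1)) 0 0
        pre.length) (treeMem D (pre ++ [0]) (D.off (D.L + D.L + 1)))) 1 := by
    refine Steps.block hM (Vars.work_boundedBy hB.regs (by omega) (by omega) (by omega)
      (by omega) (Nat.zero_le _) (Nat.zero_le _) (Nat.zero_le _) (by omega)) (hmem _ a3.2)
      (by decide) ?_ ?_
    · simp only [runVars, treeSlotsCode, Instr.applyVars, List.foldl_cons, List.foldl_nil,
        Vars.get_eqs, Vars.set_eqs, Nat.two_mul]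
    · simp only [runVars, treeSlotsCode, Instr.applyVars, List.foldl_cons, List.foldl_nil,
        Vars.get_eqs, Vars.set_eqs]
  have s6 := steps_levels hB (t := D.L + D.L) (n := 2 * (D.κ + 1)) (U := 0) (op := 0) (pb := 0)
    (sz := pre.length) (by omega) (fun s hs hs' => Shape.stem_slots (by omega) (by omega))
    (Nat.zero_le _) (Nat.zero_le _) (by omega)
  rw [show D.L + D.L + 2 * (D.κ + 1) = D.arm by omega] at s6
  have s7 : Steps M (block treeArmCode)
      (conf (v.work D ((pre ++ [0]).length + D.off (D.arm + 1)) (D.off D.arm) (D.width D.arm) 0 0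
        0 0 pre.length) (treeMem D (pre ++ [0]) (D.off (D.arm + 1))))
      (conf (v.work D ((pre ++ [0]).length + D.off (D.arm + 1)) (D.off D.arm) (D.width D.arm)
        (D.width D.arm) (2 * D.κ + 1 + D.h) (D.off D.arm) 0
        pre.length) (treeMem D (pre ++ [0]) (D.off (D.arm + 1)))) 1 := by
    refine Steps.block hM (Vars.work_boundedBy hB.regs (by omega) (by omega) (by omega)
      (by omega) (Nat.zero_le _) (Nat.zero_le _) (Nat.zero_le _) (by omega)) (hmem _ a4.2)
      (by decide) ?_ ?_
    · simp only [runVars, treeArmCode, Instr.applyVars, List.foldl_cons, List.foldl_nil,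
        Vars.get_eqs, Vars.set_eqs, Nat.two_mul, Nat.add_zero]
    · simp only [runVars, treeArmCode, Instr.applyVars, List.foldl_cons, List.foldl_nil,
        Vars.get_eqs, Vars.set_eqs]
  have s8 := steps_levels hB (t := D.arm) (n := 2 * D.κ + 1 + D.h) (U := D.width D.arm)
    (op := D.off D.arm) (pb := 0) (sz := pre.length) (by omega)
    (fun s hs hs' => (Shape.stem_arm hs).trans (hw s hs)) (by omega) (Nat.zero_le _) (by omega)
  rw [← htop, hw D.top (by omega)] at s8
  have s9 : Steps M (block treeLabelCode)
      (conf (v.work D ((pre ++ [0]).length + D.off (D.top + 1)) (D.off D.top) (D.width D.arm)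
        (D.width D.arm) 0 (D.off D.arm) 0
        pre.length) (treeMem D (pre ++ [0]) (D.off (D.top + 1))))
      (conf (v.work D ((pre ++ [0]).length + D.off (D.top + 1)) (D.off D.top) (D.width D.arm)
        (D.width D.arm) D.κ (D.off D.arm) 1
        pre.length) (treeMem D (pre ++ [0]) (D.off (D.top + 1)))) 1 := by
    refine Steps.block hM (Vars.work_boundedBy hB.regs (by omega) (by omega) (by omega)
      (by omega) (Nat.zero_le _) (by omega) (Nat.zero_le _) (by omega)) (hmem _ a5.2)
      (by decide) ?_ ?_
    · simp only [runVars, treeLabelCode, Instr.applyVars, List.foldl_cons, List.foldl_nil,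
        Vars.get_eqs, Vars.set_eqs, Nat.add_zero]
    · simp only [runVars, treeLabelCode, Instr.applyVars, List.foldl_cons, List.foldl_nil,
        Vars.get_eqs, Vars.set_eqs]
  have s10 := steps_labels hB (off := D.off D.top) (U := D.width D.arm) (sz := pre.length)
    (by omega) (by omega) (by omega)
  have s11 : Steps M (block treeTruthCode)
      (conf (v.work D ((pre ++ [0]).length + D.off (D.top + 1 + D.κ)) (D.off D.top) (D.width D.arm)
        (D.width D.arm) 0 (D.off (D.arm + 2 * D.κ)) (2 ^ D.κ)
        pre.length) (treeMem D (pre ++ [0]) (D.off (D.top + 1 + D.κ))))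
      (conf {v.work D ((pre ++ [0]).length + D.off (D.top + 1 + D.κ)) (D.off D.top) (D.width D.arm)
        (D.width D.arm) 0 (D.off (D.arm + 2 * D.κ)) (2 ^ D.κ)
        pre.length with rem := D.width D.arm}
        (treeMem D (pre ++ [0]) (D.off (D.top + 1 + D.κ)))) 1 := by
    refine Steps.block hM (Vars.work_boundedBy hB.regs (by omega) (by omega) (by omega)
      (by omega) (Nat.zero_le _) (by omega) hQ (by omega)) (hmem _ a6.2) (by decide) ?_ ?_
    · simp only [runVars, treeTruthCode, Instr.applyVars, List.foldl_cons, List.foldl_nil,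
        Vars.get_eqs, Vars.set_eqs, Nat.add_zero]
    · simp only [runVars, treeTruthCode, Instr.applyVars, List.foldl_cons, List.foldl_nil,
        Vars.get_eqs, Vars.set_eqs]
  have s12 := steps_truth (K := K) (U := D.width D.arm) (sz := pre.length) (off := D.off D.top)
    (pb := 2 ^ D.κ) hB hβ (hbase.trans (List.prefix_append _ _)) htable hm hK (by omega) hQ
    (by omega) (by omega)
  have hlen : (pre ++ (D.tree hD).encode).length = pre.length + 1 + D.numVertices := by
    rw [Shape.encode_tree hD]; simp; omega
  have s13 : Steps M (block treeEndCode)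
      (conf {v.work D ((pre ++ [0]).length + D.numVertices) (D.off D.top) (D.width D.arm)
        (D.width D.arm) 0 (D.off (D.arm + 2 * D.κ)) (2 ^ D.κ)
        pre.length with y := D.width D.arm} (treeMem D (pre ++ [0]) D.numVertices))
      (conf (v.work D (pre ++ (D.tree hD).encode).length 0 0 0 0 0 0 0)
        (pre ++ (D.tree hD).encode)) 1 := by
    refine Steps.block hM {Vars.work_boundedBy (out := (pre ++ [0]).length + D.numVertices)
      (off := D.off D.top) (w := D.width D.arm) (U := D.width D.arm) (lc := 0)
      (op := D.off (D.arm + 2 * D.κ)) (pb := 2 ^ D.κ) (sz := pre.length) hB.regs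
      (by omega) (by omega) (by omega) (by omega) (Nat.zero_le _) (by omega) hQ (by omega) with
      y := by simp only; omega} (hmem _ le_rfl) (by decide) ?_ ?_
    · simp only [runVars, treeEndCode, Instr.applyVars, List.foldl_cons, List.foldl_nil,
        Vars.get_eqs, Vars.set_eqs, hlen, hlenpre]
    · simp only [runVars, treeEndCode, Instr.applyVars, List.foldl_cons, List.foldl_nil,
        Vars.get_eqs, Vars.set_eqs]
      rw [update_listMem_of_lt (by rw [length_treeMem, hlenpre]; omega), hlenpre,
        show pre.length + 1 + D.numVertices - pre.length - 1 = D.numVertices by omega,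
        Shape.encode_tree hD, treeMem, List.append_assoc, List.set_append_right _ _ le_rfl,
        Nat.sub_self]
      rfl
  refine (s1.seq (s2.seq (s3.seq (s4.seq (s5.seq (s6.seq (s7.seq (s8.seq (s9.seq (s10.seq
    (s11.seq (s12.seq s13)))))))))))).mono ?_
  have hW : D.width D.arm * (2 * K + 4) ≤ D.numVertices * (2 * K + 4) := Nat.mul_le_mul_right _ w4
  have htot : (D.top + D.κ) * (2 * D.numVertices + 4) =
      D.L * (2 * D.numVertices + 4) + D.L * (2 * D.numVertices + 4) +
      2 * (D.κ + 1) * (2 * D.numVertices + 4) +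
      (2 * D.κ + 1 + D.h) * (2 * D.numVertices + 4) + D.κ * (2 * D.numVertices + 4) := by
    rw [htop, harm]; ring
  omega

end specs

/-! ### The whole reduction -/

section programs
open Reg Instr

/-- Reads the number of clauses. -/
def clauseNumberCode : List Instr := [.const t1 1, .load m t1, .const t1 0]

/-- Computes the number `(n + 1) / 2` of powers of two that are needed. -/
def powersStartCode : List Instr :=
  [.add len out t1, .load t2 t1, .const t1 1, .add t2 t2 t1, .const t3 2, .div rem t2 t3,
    .const pb 1, .const t1 0, .const t2 0, .const t3 0]

/-- Writes the next power of two. -/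
def powersCode : List Instr :=
  [.store out pb, .const t1 1, .add out out t1, .add pb pb pb, .sub rem rem t1, .const t1 0]

/-- Prepares the table of clauses; the first clause is in place `2`. -/
def pointersStartCode : List Instr := [.add tbl out t1, .const ptr 2, .add rem m t1]

/-- Writes the place of the next clause. -/
def pointersCode : List Instr :=
  [.store out ptr, .load t1 ptr, .const t2 1, .add out out t2, .sub rem rem t2, .add ptr ptr t1,
    .add ptr ptr t2, .const t1 0, .const t2 0]

/-- Prepares the computation of `L` and `N`. -/
def sizeStartCode : List Instr := [.add bas out t1, .const N 1, .sub rem pb N]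

/-- Multiplies `N` by `d`. -/
def sizeCode : List Instr :=
  [.mul N N d, .const t1 1, .add L L t1, .sub rem pb N, .const t1 0]

/-- Prepares the computation of `κ`, `Q` and `E`. -/
def slotsStartCode : List Instr := [.const Q 1, .mul E d d, .sub rem m Q]

/-- Multiplies `Q` by two and `E` by `d ^ 2`. -/
def slotsCode : List Instr :=
  [.const t1 2, .mul Q Q t1, .const t1 1, .add κ κ t1, .mul E E d, .mul E E d, .sub rem m Q,
    .const t1 0]

/-- Prepares the move of the output to the start of the memory. -/
def moveStartCode : List Instr := [.add rem out t1]

/-- Moves a number to its final place. -/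
def moveCode : List Instr :=
  [.add t1 y bas, .load t2 t1, .store y t2, .const t1 1, .add y y t1, .sub rem rem t1,
    .const t1 0, .const t2 0]

/-- Clears the registers, except for the length of the output. -/
def moveEndCode : List Instr :=
  [.sub out out bas, .const len 0, .const tbl 0, .const bas 0, .const m 0, .const Q 0, .const E 0,
    .const κ 0, .const L 0, .const N 0, .const h 0, .const y 0, .const d 0]

/-- Replaces a formula by the encodings of two trees of degree `d`. -/
def reductionProg (deg : ℕ) : Prog :=
  .seq (.seq (block powersStartCode) (.loop rem (block powersCode))) <|
  .seq (.seq (block pointersStartCode) (.loop rem (block pointersCode))) <|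
  .seq (block [.const d deg]) <|
  .seq (.seq (block sizeStartCode) (.loop rem (block sizeCode))) <|
  .seq (.seq (block slotsStartCode) (.loop rem (block slotsCode))) <|
  .seq (block [.const pb 0, .const ptr 0]) <| .seq treeProg <| .seq (block [.const h 1]) <|
  .seq treeProg <| .seq (.seq (block moveStartCode) (.loop rem (block moveCode)))
    (block moveEndCode)

end programs

/-- All registers are zero, except that `out` holds the number of used memory cells. -/
abbrev Vars.init (out : ℕ) : Vars :=
  ⟨out, 0, 0, 0, 0, 0, 0, 0, 0, 0, 0, 0, 0, 0, 0, 0, 0, 0, 0, 0, 0, 0, 0, 0, 0, 0, 0, 0, 0, 0⟩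

theorem Vars.init_boundedBy {M o : ℕ} (h : o ≤ M) : (Vars.init o).BoundedBy M := by
  constructor <;> first | exact h | exact Nat.zero_le _

theorem startState_eq_conf (w : List ℕ) : startState w = conf (Vars.init w.length) w := by
  unfold startState conf
  congr 1
  funext i
  rcases Nat.lt_or_ge i 30 with h | h
  · interval_cases i <;> rfl
  · rw [if_neg (by omega), Vars.get, List.getD_eq_default]
    exact h

/-- The place of clause `c` in the encoding of a formula with the clauses `cs`. -/
def clausePtr (cs : ℕ → List ℕ) (c : ℕ) : ℕ := 2 + offset (fun c => (cs c).length + 1) c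

/-- The list `inp` encodes a formula with `m` clauses `cs` on `n` variables, which is given by the
codes of its literals. -/
structure EncodesFormula (inp : List ℕ) (n m : ℕ) (cs : ℕ → List ℕ) : Prop where
  vars : inp[0]? = some n
  clauses : inp[1]? = some m
  length : ∀ c < m, inp[clausePtr cs c]? = some (cs c).length
  literal : ∀ c < m, ∀ j (hj : j < (cs c).length), inp[clausePtr cs c + 1 + j]? = some (cs c)[j]
  code_lt : ∀ c < m, ∀ z ∈ cs c, z / 4 < (n + 1) / 2

/-- The encoding of a formula, followed by the powers of two and the table of clauses. -/
def tableMem (inp : List ℕ) (n m : ℕ) (cs : ℕ → List ℕ) : List ℕ :=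
  inp ++ (List.range ((n + 1) / 2)).map (2 ^ ·) ++ (List.range m).map (clausePtr cs)

section
variable {inp : List ℕ} {n m : ℕ} {cs : ℕ → List ℕ}

theorem length_tableMem : (tableMem inp n m cs).length = inp.length + (n + 1) / 2 + m := by
  simp [tableMem, Nat.add_assoc]

theorem EncodesFormula.clausePtr_lt (h : EncodesFormula inp n m cs) {c : ℕ} (hc : c < m) :
    clausePtr cs c < inp.length := (List.getElem?_eq_some_iff.1 (h.length c hc)).1

theorem EncodesFormula.clausePtr_le (h : EncodesFormula inp n m cs) {c : ℕ} (hc : c ≤ m) :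
    clausePtr cs c ≤ inp.length := by
  rcases c with _ | c
  · have := (List.getElem?_eq_some_iff.1 h.clauses).1
    rw [clausePtr, offset_zero]; omega
  · rw [clausePtr, offset_succ]
    have h1 := h.clausePtr_lt hc
    rw [clausePtr] at h1
    rcases Nat.eq_zero_or_pos (cs c).length with h0 | h0
    · omega
    · have := (List.getElem?_eq_some_iff.1 (h.literal c hc _ (Nat.sub_lt h0 Nat.one_pos))).1
      rw [clausePtr] at this
      omega

theorem EncodesFormula.clauseTable (h : EncodesFormula inp n m cs) :
    ClauseTable (tableMem inp n m cs) inp.length (inp.length + (n + 1) / 2) m cs := by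
  have hinp : ∀ {a x : ℕ}, inp[a]? = some x → (tableMem inp n m cs)[a]? = some x := by
    intro a x hx
    have := (List.getElem?_eq_some_iff.1 hx).1
    rw [tableMem, List.append_assoc, List.getElem?_append_left this, hx]
  refine ⟨fun c hc => ⟨clausePtr cs c, ?_, hinp (h.length c hc), fun j hj =>
    ⟨hinp (h.literal c hc j hj), ?_⟩⟩⟩
  · rw [tableMem, List.getElem?_append_right (by simp)]
    simp [hc]
  · have hz := h.code_lt c hc _ (List.getElem_mem hj)
    rw [tableMem, List.append_assoc, List.getElem?_append_right (by simp),
      List.getElem?_append_left (by simp [hz])]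
    simp [hz]

end

/-- The trees of the reduction: `h = 0` for the first tree and `h = 1` for the second one. The
columns stand for the assignments to the `(n + 1) / 2` variables of parity `h`, and the labels,
modulo `m`, for the clauses. -/
def reductionShape (d n m : ℕ) (cs : ℕ → List ℕ) (h : ℕ) : Shape where
  d := d
  L := Nat.clog d (2 ^ ((n + 1) / 2))
  κ := Nat.clog 2 m
  h := h
  β := columnValue ⟨d, Nat.clog d (2 ^ ((n + 1) / 2)), Nat.clog 2 m, h, fun _ => 0⟩ m cs

theorem reductionShape_valid {d n m : ℕ} {cs : ℕ → List ℕ} {h : ℕ} (hd : 2 ≤ d) (hh : h ≤ 1) :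
    (reductionShape d n m cs h).Valid := by
  refine ⟨hd, hh, fun x => ?_⟩
  simp only [reductionShape, columnValue, clauseValue]
  omega

/-- The bound `M` on all numbers that occur in the reduction. -/
structure ReductionBounds (M d : ℕ) (inp : List ℕ) (n m : ℕ) (cs : ℕ → List ℕ) : Prop where
  four_le : 4 ≤ M
  two_le_d : 2 ≤ d
  d_le : d ≤ M
  m_pos : 0 < m
  encodes : EncodesFormula inp n m cs
  inp_le : ∀ x ∈ inp, x + 1 ≤ M
  N_le : d ^ (reductionShape d n m cs 0).L ≤ M
  Q_le : 2 ^ (reductionShape d n m cs 0).κ ≤ M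
  E_le : (reductionShape d n m cs 0).slots ≤ M
  cap : inp.length + (n + 1) / 2 + m + (1 + (reductionShape d n m cs 0).numVertices) +
    (1 + (reductionShape d n m cs 1).numVertices) ≤ M

section specs
variable {M d n m : ℕ} {inp : List ℕ} {cs : ℕ → List ℕ}

theorem ReductionBounds.pow_le (hB : ReductionBounds M d inp n m cs) {j : ℕ}
    (hj : j ≤ (n + 1) / 2) : 2 ^ j ≤ M :=
  (Nat.pow_le_pow_right (by omega) hj).trans
    ((Nat.le_pow_clog (by have := hB.two_le_d; omega) _).trans hB.N_le)

theorem ReductionBounds.powers_le (hB : ReductionBounds M d inp n m cs) {j : ℕ}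
    (hj : j ≤ (n + 1) / 2) : ∀ x ∈ inp ++ (List.range j).map (2 ^ ·), x ≤ M :=
  forall_mem_append_map (fun x hx => (Nat.le_succ x).trans (hB.inp_le x hx))
    fun i hi => hB.pow_le (by omega)

theorem ReductionBounds.pointers_le (hB : ReductionBounds M d inp n m cs) {j : ℕ} (hj : j ≤ m) :
    ∀ x ∈ inp ++ (List.range ((n + 1) / 2)).map (2 ^ ·) ++ (List.range j).map (clausePtr cs),
      x ≤ M := by
  refine forall_mem_append_map (hB.powers_le le_rfl) fun i hi => ?_
  have := hB.encodes.clausePtr_le (c := i) (by omega)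
  have := hB.cap
  omega

theorem steps_clauseNumber (hM : 4 ≤ M) (hlen : inp.length ≤ M) (hinp : ∀ x ∈ inp, x ≤ M)
    (hm : inp[1]? = some m) :
    Steps M (block clauseNumberCode) (startState inp)
      (conf {Vars.init inp.length with m := m} inp) 1 := by
  rw [startState_eq_conf]
  have hm' : listMem inp 1 = m := listMem_of_prefix List.prefix_rfl hm
  refine Steps.block hM (Vars.init_boundedBy hlen) hinp (by decide) ?_ ?_
  · simp only [runVars, clauseNumberCode, Instr.applyVars, List.foldl_cons, List.foldl_nil,
      Vars.get_eqs, Vars.set_eqs, hm']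
  · simp only [runVars, clauseNumberCode, Instr.applyVars, List.foldl_cons, List.foldl_nil,
      Vars.get_eqs, Vars.set_eqs]

theorem steps_powers (hB : ReductionBounds M d inp n m cs) :
    Steps M (.seq (block powersStartCode) (.loop Reg.rem (block powersCode)))
      (conf {Vars.init inp.length with m := m} inp)
      (conf {Vars.init (inp.length + (n + 1) / 2) with
        m := m, len := inp.length, pb := 2 ^ ((n + 1) / 2)}
        (inp ++ (List.range ((n + 1) / 2)).map (2 ^ ·)))
      (1 + ((n + 1) / 2 * (1 + 1) + 1)) := by
  have hM := hB.four_le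
  have hcap := hB.cap
  have hn : listMem inp 0 = n := listMem_of_prefix List.prefix_rfl hB.encodes.vars
  refine Steps.seq (s' := conf {Vars.init inp.length with
    m := m, len := inp.length, pb := 1, rem := (n + 1) / 2} inp) ?_ ?_
  · refine Steps.block hM {Vars.init_boundedBy (o := inp.length) (by omega) with
      m := by simp only; omega} (fun x hx => (Nat.le_succ x).trans (hB.inp_le x hx))
      (by decide) ?_ ?_
    · simp only [runVars, powersStartCode, Instr.applyVars, List.foldl_cons, List.foldl_nil,
        Vars.get_eqs, Vars.set_eqs, Nat.add_zero, hn]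
    · simp only [runVars, powersStartCode, Instr.applyVars, List.foldl_cons, List.foldl_nil,
        Vars.get_eqs, Vars.set_eqs]
  · have h := Steps.loop (M := M) (p := block powersCode) (i := Reg.rem) (n := (n + 1) / 2)
      (k := 1) (by omega)
      (fun j => conf {Vars.init (inp.length + j) with
        m := m, len := inp.length, pb := 2 ^ j, rem := (n + 1) / 2 - j}
        (inp ++ (List.range j).map (2 ^ ·)))
      (fun j hj => ⟨show (n + 1) / 2 - j ≠ 0 by omega, show (n + 1) / 2 - j ≤ M by omega, ?_⟩)
      (show (n + 1) / 2 - (n + 1) / 2 = 0 by omega)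
    · simpa using h
    · refine Steps.block hM {Vars.init_boundedBy (o := inp.length + j) (by omega) with
        m := by simp only; omega, len := by simp only; omega, pb := hB.pow_le hj.le,
        rem := by simp only; omega} (hB.powers_le hj.le) (by decide) ?_ ?_
      · simp only [runVars, powersCode, Instr.applyVars, List.foldl_cons, List.foldl_nil,
          Vars.get_eqs, Vars.set_eqs, pow_succ, Nat.mul_two, Nat.sub_sub, Nat.add_assoc]
      · simp only [runVars, powersCode, Instr.applyVars, List.foldl_cons, List.foldl_nil,
          Vars.get_eqs, Vars.set_eqs]
        rw [show inp.length + j = (inp ++ (List.range j).map (2 ^ ·)).length by simp,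
          update_listMem_length, List.range_succ, List.map_append, ← List.append_assoc]
        rfl

theorem steps_pointers (hB : ReductionBounds M d inp n m cs) :
    Steps M (.seq (block pointersStartCode) (.loop Reg.rem (block pointersCode)))
      (conf {Vars.init (inp.length + (n + 1) / 2) with
        m := m, len := inp.length, pb := 2 ^ ((n + 1) / 2)}
        (inp ++ (List.range ((n + 1) / 2)).map (2 ^ ·)))
      (conf {Vars.init (tableMem inp n m cs).length with
        m := m, len := inp.length, tbl := inp.length + (n + 1) / 2, ptr := clausePtr cs m,
        pb := 2 ^ ((n + 1) / 2)} (tableMem inp n m cs))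
      (1 + (m * (1 + 1) + 1)) := by
  have hM := hB.four_le
  have hcap := hB.cap
  have hpb := hB.pow_le le_rfl
  refine Steps.seq (s' := conf {Vars.init (inp.length + (n + 1) / 2) with
    m := m, len := inp.length, tbl := inp.length + (n + 1) / 2, ptr := 2, rem := m,
    pb := 2 ^ ((n + 1) / 2)} (inp ++ (List.range ((n + 1) / 2)).map (2 ^ ·))) ?_ ?_
  · refine Steps.block hM {Vars.init_boundedBy (o := inp.length + (n + 1) / 2) (by omega) with
      m := by simp only; omega, len := by simp only; omega, pb := hpb}
      (hB.powers_le le_rfl) (by decide) ?_ ?_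
    · simp only [runVars, pointersStartCode, Instr.applyVars, List.foldl_cons, List.foldl_nil,
        Vars.get_eqs, Vars.set_eqs, Nat.add_zero]
    · simp only [runVars, pointersStartCode, Instr.applyVars, List.foldl_cons, List.foldl_nil,
        Vars.get_eqs, Vars.set_eqs]
  · have h := Steps.loop (M := M) (p := block pointersCode) (i := Reg.rem) (n := m)
      (k := 1) (by omega)
      (fun j => conf {Vars.init (inp.length + (n + 1) / 2 + j) with
        m := m, len := inp.length, tbl := inp.length + (n + 1) / 2, ptr := clausePtr cs j,
        rem := m - j, pb := 2 ^ ((n + 1) / 2)}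
        (inp ++ (List.range ((n + 1) / 2)).map (2 ^ ·) ++ (List.range j).map (clausePtr cs)))
      (fun j hj => ⟨show m - j ≠ 0 by omega, show m - j ≤ M by omega, ?_⟩)
      (show m - m = 0 by omega)
    · rw [length_tableMem]
      simpa [clausePtr, tableMem, offset_zero] using h
    · have hptr := hB.encodes.clausePtr_lt hj
      have hread : listMem (inp ++ (List.range ((n + 1) / 2)).map (2 ^ ·) ++
          (List.range j).map (clausePtr cs)) (clausePtr cs j) = (cs j).length :=
        listMem_of_prefix ((List.prefix_append _ _).trans (List.prefix_append _ _))
          (hB.encodes.length j hj)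
      have hread' : Function.update (listMem (inp ++ (List.range ((n + 1) / 2)).map (2 ^ ·) ++
          (List.range j).map (clausePtr cs))) (inp.length + (n + 1) / 2 + j) (clausePtr cs j)
          (clausePtr cs j) = (cs j).length := by
        rw [Function.update_of_ne (by omega), hread]
      refine Steps.block hM {Vars.init_boundedBy (o := inp.length + (n + 1) / 2 + j) (by omega) with
        m := by simp only; omega, len := by simp only; omega, tbl := by simp only; omega,
        ptr := by simp only; omega, pb := hpb,
        rem := by simp only; omega} (hB.pointers_le hj.le) (by decide) ?_ ?_
      · simp only [runVars, pointersCode, Instr.applyVars, List.foldl_cons, List.foldl_nil,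
          Vars.get_eqs, Vars.set_eqs, hread', Nat.sub_sub]
        simp only [clausePtr, offset_succ, Nat.add_assoc]
      · simp only [runVars, pointersCode, Instr.applyVars, List.foldl_cons, List.foldl_nil,
          Vars.get_eqs, Vars.set_eqs]
        rw [show inp.length + (n + 1) / 2 + j = (inp ++ (List.range ((n + 1) / 2)).map (2 ^ ·) ++
          (List.range j).map (clausePtr cs)).length by simp [Nat.add_assoc],
          update_listMem_length, List.range_succ, List.map_append, ← List.append_assoc]
        rfl

theorem steps_setDegree {v : Vars} {l : List ℕ} (hM : 2 ≤ M) (hv : v.BoundedBy M)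
    (hl : ∀ x ∈ l, x ≤ M) (hd : d ≤ M) :
    Steps M (block [.const Reg.d d]) (conf v l) (conf {v with d := d} l) 1 := by
  have h := steps_block (M := M) [.const Reg.d d] (by simp) hM (conf_boundedBy hv hl)
    (by simpa [Instr.constant] using hd)
  have he : [Instr.const Reg.d d].foldl (fun s a => a.apply s) (conf v l) =
      conf {v with d := d} l := by
    simp only [List.foldl_cons, List.foldl_nil, Instr.apply, State.setReg, conf]
    rw [← Vars.get_set v (by decide)]
    rfl
  rwa [he] at h

theorem steps_size (hB : ReductionBounds M d inp n m cs) :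
    Steps M (.seq (block sizeStartCode) (.loop Reg.rem (block sizeCode)))
      (conf {Vars.init (tableMem inp n m cs).length with
        m := m, len := inp.length, tbl := inp.length + (n + 1) / 2, ptr := clausePtr cs m,
        pb := 2 ^ ((n + 1) / 2), d := d} (tableMem inp n m cs))
      (conf {Vars.init (tableMem inp n m cs).length with
        m := m, len := inp.length, tbl := inp.length + (n + 1) / 2, ptr := clausePtr cs m,
        pb := 2 ^ ((n + 1) / 2), d := d, bas := (tableMem inp n m cs).length,
        N := d ^ (reductionShape d n m cs 0).L, L := (reductionShape d n m cs 0).L}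
        (tableMem inp n m cs))
      (1 + ((reductionShape d n m cs 0).L * (1 + 1) + 1)) := by
  have hM := hB.four_le
  have hcap := hB.cap
  have hpb := hB.pow_le le_rfl
  have hd := hB.two_le_d
  have hlen := length_tableMem (inp := inp) (n := n) (m := m) (cs := cs)
  have hptr := hB.encodes.clausePtr_le le_rfl
  have hNM := hB.N_le
  set L := (reductionShape d n m cs 0).L with hL
  have hN : ∀ j ≤ L, d ^ j ≤ M := fun j hj => (Nat.pow_le_pow_right (by omega) hj).trans hNM
  have hLM : L ≤ M := (Nat.lt_pow_self hd).le.trans hNM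
  have hv : ({Vars.init (tableMem inp n m cs).length with
      m := m, len := inp.length, tbl := inp.length + (n + 1) / 2, ptr := clausePtr cs m,
      pb := 2 ^ ((n + 1) / 2), d := d} : Vars).BoundedBy M :=
    {Vars.init_boundedBy (o := (tableMem inp n m cs).length) (by omega) with
      m := by simp only; omega, len := by simp only; omega, tbl := by simp only; omega,
      ptr := by simp only; omega, pb := hpb, d := hB.d_le}
  refine Steps.seq (s' := conf {Vars.init (tableMem inp n m cs).length with
    m := m, len := inp.length, tbl := inp.length + (n + 1) / 2, ptr := clausePtr cs m,
    pb := 2 ^ ((n + 1) / 2), d := d, bas := (tableMem inp n m cs).length, N := 1,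
    rem := 2 ^ ((n + 1) / 2) - 1} (tableMem inp n m cs)) ?_ ?_
  · refine Steps.block hM hv (hB.pointers_le le_rfl) (by decide) ?_ ?_
    · simp only [runVars, sizeStartCode, Instr.applyVars, List.foldl_cons, List.foldl_nil,
        Vars.get_eqs, Vars.set_eqs, Nat.add_zero]
    · simp only [runVars, sizeStartCode, Instr.applyVars, List.foldl_cons, List.foldl_nil,
        Vars.get_eqs, Vars.set_eqs]
  · have h := Steps.loop (M := M) (p := block sizeCode) (i := Reg.rem) (n := L)
      (k := 1) (by omega)
      (fun j => conf {Vars.init (tableMem inp n m cs).length with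
        m := m, len := inp.length, tbl := inp.length + (n + 1) / 2, ptr := clausePtr cs m,
        pb := 2 ^ ((n + 1) / 2), d := d, bas := (tableMem inp n m cs).length, N := d ^ j, L := j,
        rem := 2 ^ ((n + 1) / 2) - d ^ j} (tableMem inp n m cs))
      (fun j hj => ⟨?_, show 2 ^ ((n + 1) / 2) - d ^ j ≤ M by omega, ?_⟩)
      (Nat.sub_eq_zero_of_le (Nat.le_pow_clog (by omega) _))
    · simpa [Nat.sub_eq_zero_of_le (show 2 ^ ((n + 1) / 2) ≤ d ^ L from
        Nat.le_pow_clog (by omega) _)] using h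
    · exact Nat.sub_ne_zero_of_lt (Nat.pow_lt_of_lt_clog hj)
    · refine Steps.block hM {hv with
        bas := by simp only; omega, N := hN j hj.le, L := by simp only; omega,
        rem := by simp only; omega} (hB.pointers_le le_rfl) (by decide) ?_ ?_
      · simp only [runVars, sizeCode, Instr.applyVars, List.foldl_cons, List.foldl_nil,
          Vars.get_eqs, Vars.set_eqs, pow_succ]
      · simp only [runVars, sizeCode, Instr.applyVars, List.foldl_cons, List.foldl_nil,
          Vars.get_eqs, Vars.set_eqs]

theorem steps_slots (hB : ReductionBounds M d inp n m cs) {v : Vars} {l : List ℕ}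
    (hv : v.BoundedBy M) (hl : ∀ x ∈ l, x ≤ M) (hm : v.m = m) (hd : v.d = d) (hκ : v.κ = 0)
    (h1 : v.t1 = 0) (h2 : v.rem = 0) :
    Steps M (.seq (block slotsStartCode) (.loop Reg.rem (block slotsCode))) (conf v l)
      (conf {v with
        Q := 2 ^ (reductionShape d n m cs 0).κ, κ := (reductionShape d n m cs 0).κ,
        E := (reductionShape d n m cs 0).slots} l)
      (1 + ((reductionShape d n m cs 0).κ * (1 + 1) + 1)) := by
  have hM := hB.four_le
  have hd2 := hB.two_le_d
  have hcap := hB.cap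
  have hQM := hB.Q_le
  have hEM := hB.E_le
  have hE : (reductionShape d n m cs 0).slots = d ^ (2 * ((reductionShape d n m cs 0).κ + 1)) := rfl
  rw [hE] at hEM ⊢
  have hκm : m ≤ 2 ^ (reductionShape d n m cs 0).κ := Nat.le_pow_clog (by omega) _
  have hκlt : ∀ j < (reductionShape d n m cs 0).κ, 2 ^ j < m := fun j hj => Nat.pow_lt_of_lt_clog hj
  generalize (reductionShape d n m cs 0).κ = κ at *
  have hQ : ∀ j ≤ κ, 2 ^ j ≤ M := fun j hj => (Nat.pow_le_pow_right (by omega) hj).trans hQM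
  have hE' : ∀ j ≤ κ, d ^ (2 * (j + 1)) ≤ M := fun j hj =>
    (Nat.pow_le_pow_right (by omega) (by omega)).trans hEM
  have hκM : κ ≤ M := (Nat.lt_pow_self (by omega)).le.trans hQM
  refine Steps.seq (s' := conf {v with Q := 1, E := d ^ 2, rem := m - 1} l) ?_ ?_
  · refine Steps.block hM hv hl (by decide) ?_ ?_
    · simp only [runVars, slotsStartCode, Instr.applyVars, List.foldl_cons, List.foldl_nil,
        Vars.get_eqs, Vars.set_eqs, hm, hd, pow_two]
    · simp only [runVars, slotsStartCode, Instr.applyVars, List.foldl_cons, List.foldl_nil,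
        Vars.get_eqs, Vars.set_eqs]
  · have h := Steps.loop (M := M) (p := block slotsCode) (i := Reg.rem) (n := κ)
      (k := 1) (by omega)
      (fun j => conf {v with Q := 2 ^ j, κ := j, E := d ^ (2 * (j + 1)), rem := m - 2 ^ j} l)
      (fun j hj => ⟨?_, (Nat.sub_le m (2 ^ j)).trans (by omega), ?_⟩)
      (Nat.sub_eq_zero_of_le hκm)
    · simp only [Nat.sub_eq_zero_of_le hκm] at h
      cases v
      simp only at hκ h2
      subst hκ h2
      simpa using h
    · exact Nat.sub_ne_zero_of_lt (hκlt j hj)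
    · refine Steps.block hM {hv with
        Q := hQ j hj.le, κ := by simp only; omega, E := hE' j hj.le,
        rem := (Nat.sub_le _ _).trans (by omega)} hl (by decide) ?_ ?_
      · simp only [runVars, slotsCode, Instr.applyVars, List.foldl_cons, List.foldl_nil,
          Vars.get_eqs, Vars.set_eqs, pow_succ, hm, hd, h1, Nat.mul_add]
      · simp only [runVars, slotsCode, Instr.applyVars, List.foldl_cons, List.foldl_nil,
          Vars.get_eqs, Vars.set_eqs]

/-- Moving the part of a list behind place `bas` to the start of the memory. As many cells are
overwritten as the list has entries, so that nothing but zeros remains behind the moved part. -/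
theorem steps_move {v : Vars} {l : List ℕ} (hM : 4 ≤ M)
    (hv : v.BoundedBy M) (hl : ∀ x ∈ l, x ≤ M) (hout : v.out = l.length) (hlen : l.length ≤ M)
    (hy : v.y = 0) (h1 : v.t1 = 0) (h2 : v.t2 = 0) (hrem : v.rem = 0) :
    Steps M (.seq (block moveStartCode) (.loop Reg.rem (block moveCode))) (conf v l)
      (conf {v with y := l.length}
        ((List.range l.length).map fun a => listMem l (a + v.bas)))
      (1 + (l.length * (1 + 1) + 1)) := by
  have hmem : ∀ a, listMem l a ≤ M := (conf_boundedBy hv hl).2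
  refine Steps.seq (s' := conf {v with rem := l.length} l) ?_ ?_
  · refine Steps.block hM hv hl (by decide) ?_ ?_
    · simp only [runVars, moveStartCode, Instr.applyVars, List.foldl_cons, List.foldl_nil,
        Vars.get_eqs, Vars.set_eqs, h1, hout, Nat.add_zero]
    · simp only [runVars, moveStartCode, Instr.applyVars, List.foldl_cons, List.foldl_nil,
        Vars.get_eqs, Vars.set_eqs]
  · have h := Steps.loop (M := M) (p := block moveCode) (i := Reg.rem) (n := l.length)
      (k := 1) (by omega)
      (fun j => conf {v with y := j, rem := l.length - j}
        ((List.range j).map (fun a => listMem l (a + v.bas)) ++ l.drop j))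
      (fun j hj => ⟨show l.length - j ≠ 0 by omega, show l.length - j ≤ M by omega, ?_⟩)
      (show l.length - l.length = 0 by omega)
    · cases v
      simp only at hy hrem
      subst hy hrem
      simpa using h
    · have hread : listMem ((List.range j).map (fun a => listMem l (a + v.bas)) ++ l.drop j)
          (j + v.bas) = listMem l (j + v.bas) := by
        rw [listMem, List.getD_eq_getElem?_getD, List.getElem?_append_right (by simp),
          List.getElem?_drop, listMem, List.getD_eq_getElem?_getD]
        simp
      refine Steps.block hM {hv with y := by simp only; omega, rem := by simp only; omega} ?_
        (by decide) ?_ ?_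
      · intro x hx
        rcases List.mem_append.1 hx with hx | hx
        · obtain ⟨a, -, rfl⟩ := List.mem_map.1 hx
          exact hmem _
        · exact hl x (List.mem_of_mem_drop hx)
      · simp only [runVars, moveCode, Instr.applyVars, List.foldl_cons, List.foldl_nil,
          Vars.get_eqs, Vars.set_eqs, h1, h2, Nat.sub_sub]
      · simp only [runVars, moveCode, Instr.applyVars, List.foldl_cons, List.foldl_nil,
          Vars.get_eqs, Vars.set_eqs, hread]
        rw [update_listMem_of_lt (by simp; omega), List.set_append_right _ _ (by simp),
          List.drop_eq_getElem_cons hj, List.range_succ, List.map_append, List.append_assoc]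
        simp only [List.length_map, List.length_range, Nat.sub_self, List.set_cons_zero,
          List.map_cons, List.map_nil, List.singleton_append]

theorem listMem_map_shift (l : List ℕ) (b : ℕ) :
    listMem ((List.range l.length).map fun a => listMem l (a + b)) = listMem (l.drop b) := by
  funext a
  simp only [listMem, List.getD_eq_getElem?_getD, List.getElem?_map, List.getElem?_drop]
  rcases Nat.lt_or_ge a l.length with h | h
  · simp [h, Nat.add_comm]
  · rw [List.getElem?_eq_none (by simpa using h), List.getElem?_eq_none (by omega)]
    rfl

/-- The encodings of the two trees of the reduction. -/
def reductionOutput (d n m : ℕ) (cs : ℕ → List ℕ) (hd : 2 ≤ d) : List ℕ :=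
  ((reductionShape d n m cs 0).tree (reductionShape_valid hd (Nat.zero_le 1))).encode ++
    ((reductionShape d n m cs 1).tree (reductionShape_valid hd le_rfl)).encode

/-- The registers while the trees are written. -/
abbrev treeVars (inp : List ℕ) (n m : ℕ) (cs : ℕ → List ℕ) : Vars :=
  {Vars.init 0 with
    m := m, len := inp.length, tbl := inp.length + (n + 1) / 2, bas := (tableMem inp n m cs).length}

/-- A bound on the number of steps of the reduction. -/
def reductionTime (d n m K : ℕ) (cs : ℕ → List ℕ) (len : ℕ) : ℕ :=
  (2 * ((n + 1) / 2) + 2) + (2 * m + 2) + (2 * (reductionShape d n m cs 0).L + 2) +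
  (2 * (reductionShape d n m cs 0).κ + 2) +
  (((reductionShape d n m cs 0).top + (reductionShape d n m cs 0).κ) *
    (2 * (reductionShape d n m cs 0).numVertices + 4) +
    (reductionShape d n m cs 0).numVertices * (2 * K + 4) + 13) +
  (((reductionShape d n m cs 1).top + (reductionShape d n m cs 1).κ) *
    (2 * (reductionShape d n m cs 1).numVertices + 4) +
    (reductionShape d n m cs 1).numVertices * (2 * K + 4) + 13) +
  (2 * (len + (n + 1) / 2 + m + (1 + (reductionShape d n m cs 0).numVertices) +
    (1 + (reductionShape d n m cs 1).numVertices)) + 2) + 4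

theorem encode_length {D : Shape} (hD : D.Valid) :
    (D.tree hD).encode.length = 1 + D.numVertices := by
  rw [Shape.encode_tree hD]
  simp [Nat.add_comm]

/-- The reduction leaves the machine as it would start on the instance of Subtree Isomorphism. -/
theorem steps_reduction (hB : ReductionBounds M d inp n m cs) {K : ℕ}
    (hK : ∀ c < m, (cs c).length ≤ K) :
    Steps M (reductionProg d) (conf {Vars.init inp.length with m := m} inp)
      (startState (reductionOutput d n m cs hB.two_le_d))
      (reductionTime d n m K cs inp.length) := by
  have hM := hB.four_le
  have hcap := hB.cap
  have hpb := hB.pow_le le_rfl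
  have hlen := length_tableMem (inp := inp) (n := n) (m := m) (cs := cs)
  have hptr := hB.encodes.clausePtr_le le_rfl
  have hD0 := reductionShape_valid (n := n) (m := m) (cs := cs) hB.two_le_d (Nat.zero_le 1)
  have hD1 := reductionShape_valid (n := n) (m := m) (cs := cs) hB.two_le_d (le_refl 1)
  set D0 := reductionShape d n m cs 0 with hD0'
  set D1 := reductionShape d n m cs 1 with hD1'
  have hl0 := encode_length hD0
  have hl1 := encode_length hD1
  set base := tableMem inp n m cs with hbase
  have hbaseM : ∀ x ∈ base, x ≤ M := hB.pointers_le le_rfl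
  have hLM : D0.L ≤ M := (Nat.lt_pow_self hB.two_le_d).le.trans hB.N_le
  have hκM : D0.κ ≤ M := (Nat.lt_pow_self (by omega)).le.trans hB.Q_le
  have hregs : ∀ h ≤ 1, ((treeVars inp n m cs).work (reductionShape d n m cs h)
      0 0 0 0 0 0 0 0).BoundedBy M := fun h hh =>
    {Vars.init_boundedBy (o := 0) (Nat.zero_le M) with
      m := by simp only; omega, len := by simp only; omega, tbl := by simp only; omega,
      bas := show base.length ≤ M by omega, Q := hB.Q_le, E := hB.E_le, κ := hκM, L := hLM,
      N := hB.N_le, h := hh.trans (by omega), d := hB.d_le}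
  have henc : ∀ {D : Shape} (hD : D.Valid), D.numVertices ≤ M →
      ∀ x ∈ (D.tree hD).encode, x ≤ M := by
    intro D hD hM x hx
    rw [Shape.encode_tree hD, List.mem_cons] at hx
    rcases hx with rfl | hx
    · exact hM
    · obtain ⟨j, hj, rfl⟩ := List.mem_map.1 hx
      exact (Shape.parentNumber_le hD (List.mem_range.1 hj)).trans hM
  have happ : ∀ {l l' : List ℕ}, (∀ x ∈ l, x ≤ M) → (∀ x ∈ l', x ≤ M) → ∀ x ∈ l ++ l', x ≤ M :=
    fun h h' x hx => (List.mem_append.1 hx).elim (h x) (h' x)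
  have hzero : ∀ x ∈ [0], x ≤ M := by simp
  have hE0 := henc hD0 (by omega)
  have hE1 := henc hD1 (by omega)
  have s1 := steps_powers hB
  have s2 := steps_pointers hB
  have hv2 : ({Vars.init base.length with
      m := m, len := inp.length, tbl := inp.length + (n + 1) / 2, ptr := clausePtr cs m,
      pb := 2 ^ ((n + 1) / 2)} : Vars).BoundedBy M :=
    {Vars.init_boundedBy (o := base.length) (by omega) with
      m := by simp only; omega, len := by simp only; omega, tbl := by simp only; omega,
      ptr := by simp only; omega, pb := hpb}
  have s3 := steps_setDegree (by omega) hv2 hbaseM hB.d_le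
  have s4 := steps_size hB
  have hv4 : ({Vars.init base.length with
      m := m, len := inp.length, tbl := inp.length + (n + 1) / 2, ptr := clausePtr cs m,
      pb := 2 ^ ((n + 1) / 2), d := d, bas := base.length, N := d ^ D0.L, L := D0.L} :
      Vars).BoundedBy M :=
    {hv2 with d := hB.d_le, bas := by simp only; omega, N := hB.N_le, L := hLM}
  have s5 := steps_slots hB hv4 hbaseM rfl rfl rfl rfl rfl
  have s6 : Steps M (block [.const Reg.pb 0, .const Reg.ptr 0])
      (conf {Vars.init base.length with
        m := m, len := inp.length, tbl := inp.length + (n + 1) / 2, ptr := clausePtr cs m,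
        pb := 2 ^ ((n + 1) / 2), d := d, bas := base.length, N := d ^ D0.L, L := D0.L,
        Q := 2 ^ D0.κ, κ := D0.κ, E := D0.slots} base)
      (conf ((treeVars inp n m cs).work D0 base.length 0 0 0 0 0 0 0) base) 1 := by
    refine Steps.block hM {hv4 with Q := hB.Q_le, κ := hκM, E := hB.E_le} hbaseM (by decide) ?_ ?_
    · simp only [runVars, Instr.applyVars, List.foldl_cons, List.foldl_nil, Vars.set_eqs]
      rfl
    · simp only [runVars, Instr.applyVars, List.foldl_cons, List.foldl_nil]
  have s7 := steps_tree (M := M) (v := treeVars inp n m cs) (D := D0) (pre := base) (base := base)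
    (cs := cs) (K := K)
    ⟨hD0, hM, hregs 0 (Nat.zero_le _), happ hbaseM hzero, by simp; omega⟩ (fun _ => rfl)
    List.prefix_rfl hB.encodes.clauseTable hB.m_pos hK
  set mem1 := base ++ (D0.tree hD0).encode with hmem1
  have hmem1M : ∀ x ∈ mem1, x ≤ M := happ hbaseM hE0
  have hlen1 : mem1.length = base.length + (1 + D0.numVertices) := by
    rw [hmem1, List.length_append, hl0]
  have s8 : Steps M (block [.const Reg.h 1])
      (conf ((treeVars inp n m cs).work D0 mem1.length 0 0 0 0 0 0 0) mem1)
      (conf ((treeVars inp n m cs).work D1 mem1.length 0 0 0 0 0 0 0) mem1) 1 := by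
    refine Steps.block hM (Vars.work_boundedBy (hregs 0 (Nat.zero_le _)) (by omega)
      (Nat.zero_le _) (Nat.zero_le _) (Nat.zero_le _) (Nat.zero_le _) (Nat.zero_le _)
      (Nat.zero_le _) (Nat.zero_le _)) hmem1M (by decide) ?_ ?_
    · simp only [runVars, Instr.applyVars, List.foldl_cons, List.foldl_nil, Vars.set_eqs]
      rfl
    · simp only [runVars, Instr.applyVars, List.foldl_cons, List.foldl_nil]
  have s9 := steps_tree (M := M) (v := treeVars inp n m cs) (D := D1) (pre := mem1) (base := base)
    (cs := cs) (K := K)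
    ⟨hD1, hM, hregs 1 le_rfl, happ hmem1M hzero, by
      rw [List.length_append, List.length_singleton]; omega⟩ (fun _ => rfl)
    (List.prefix_append _ _) hB.encodes.clauseTable hB.m_pos hK
  set mem2 := mem1 ++ (D1.tree hD1).encode with hmem2
  have hmem2M : ∀ x ∈ mem2, x ≤ M := happ hmem1M hE1
  have hlen2 : mem2.length = base.length + (1 + D0.numVertices) + (1 + D1.numVertices) := by
    rw [hmem2, List.length_append, hl1, hlen1]
  have hv9 : ((treeVars inp n m cs).work D1 mem2.length 0 0 0 0 0 0 0).BoundedBy M :=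
    Vars.work_boundedBy (hregs 1 le_rfl) (by omega)
      (Nat.zero_le _) (Nat.zero_le _) (Nat.zero_le _) (Nat.zero_le _) (Nat.zero_le _)
      (Nat.zero_le _) (Nat.zero_le _)
  have s10 := steps_move hM hv9 hmem2M rfl (by omega) rfl rfl rfl rfl
  have hout : mem2.drop base.length = reductionOutput d n m cs hB.two_le_d := by
    rw [hmem2, hmem1, List.append_assoc, List.drop_left]
    rfl
  have s11 : Steps M (block moveEndCode)
      (conf {(treeVars inp n m cs).work D1 mem2.length 0 0 0 0 0 0 0 with y := mem2.length}
        ((List.range mem2.length).map fun a => listMem mem2 (a + base.length)))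
      (startState (reductionOutput d n m cs hB.two_le_d)) 1 := by
    rw [startState_eq_conf]
    refine Steps.block hM {hv9 with y := by simp only; omega} ?_ (by decide) ?_ ?_
    · intro x hx
      obtain ⟨a, -, rfl⟩ := List.mem_map.1 hx
      exact (conf_boundedBy hv9 hmem2M).2 _
    · simp only [runVars, moveEndCode, Instr.applyVars, List.foldl_cons, List.foldl_nil,
        Vars.get_eqs, Vars.set_eqs, ← hout, List.length_drop]
      rfl
    · simp only [runVars, moveEndCode, Instr.applyVars, List.foldl_cons, List.foldl_nil]
      rw [listMem_map_shift, hout]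
  refine (s1.seq (s2.seq (s3.seq (s4.seq (s5.seq (s6.seq (s7.seq (s8.seq (s9.seq
    (s10.seq s11)))))))))).mono ?_
  rw [hlen2, hlen, reductionTime]
  simp only [← hD0', ← hD1']
  omega

end specs

/-! ### Correctness of the reduction -/

theorem clauseValue_le (h i : ℕ) (codes : List ℕ) : clauseValue h i codes ≤ 1 := by
  rw [clauseValue]; omega

theorem clauseValue_eq_zero_iff {h i : ℕ} {codes : List ℕ} :
    clauseValue h i codes = 0 ↔ ∀ z ∈ codes, ¬ z % 4 = 2 * h + i / 2 ^ (z / 4) % 2 := by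
  have : clauseValue h i codes = 0 ↔ trueCount h i codes = 0 := by rw [clauseValue]; omega
  rw [this, trueCount, List.countP_eq_zero]
  simp

theorem Literal.code_mod_four {n : ℕ} (l : Literal n) :
    l.code % 4 = 2 * ((l.1 : ℕ) % 2) + l.2.toNat := by
  have := Bool.toNat_le l.2
  rw [Literal.code]; omega

theorem Literal.code_div_four {n : ℕ} (l : Literal n) : l.code / 4 = (l.1 : ℕ) / 2 := by
  have := Bool.toNat_le l.2
  rw [Literal.code]; omega

/-- A partial assignment makes a literal true if the variable has the right parity and the right
value. -/
theorem Literal.code_true_iff {n : ℕ} (l : Literal n) {h i : ℕ} :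
    l.code % 4 = 2 * h + i / 2 ^ (l.code / 4) % 2 ↔
      (l.1 : ℕ) % 2 = h ∧ i.testBit ((l.1 : ℕ) / 2) = l.2 := by
  rw [l.code_mod_four, l.code_div_four, Nat.testBit_eq_decide_div_mod_eq]
  have := Nat.mod_lt (i / 2 ^ ((l.1 : ℕ) / 2)) Nat.two_pos
  rcases l.2 with _ | _ <;> simp <;> omega

section
variable {d n m : ℕ} {cs : ℕ → List ℕ}

theorem reductionShape_zero_β (y : ℕ) :
    (reductionShape d n m cs 0).β y = clauseValue 0 (y / (reductionShape d n m cs 0).slots)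
      (cs (y % (reductionShape d n m cs 0).slots % 2 ^ Nat.clog 2 m % m)) := by
  simp only [reductionShape, columnValue, Nat.mul_zero, Nat.sub_zero, Nat.zero_sub, Nat.add_zero]
  rfl

theorem reductionShape_one_β (y : ℕ) :
    (reductionShape d n m cs 1).β y =
      if y / (reductionShape d n m cs 1).slots < d ^ Nat.clog d (2 ^ ((n + 1) / 2)) - 1 then 0
      else 1 - clauseValue 1 (y / (reductionShape d n m cs 1).slots -
          (d ^ Nat.clog d (2 ^ ((n + 1) / 2)) - 1))
        (cs (y % (reductionShape d n m cs 1).slots % 2 ^ Nat.clog 2 m % m)) := by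
  have hs : (reductionShape d n m cs 1).slots = Shape.slots
    ⟨d, Nat.clog d (2 ^ ((n + 1) / 2)), Nat.clog 2 m, 1, fun _ => 0⟩ := rfl
  rw [hs]
  simp only [reductionShape, columnValue, Nat.mul_one]
  generalize Shape.slots _ = E
  generalize d ^ Nat.clog d (2 ^ ((n + 1) / 2)) - 1 = P
  have h1 := clauseValue_le 1 (y / E - P) (cs (y % E % 2 ^ Nat.clog 2 m % m))
  generalize clauseValue 1 _ _ = x at h1 ⊢
  generalize y / E = q
  clear hs
  split_ifs with h
  · omega
  · omega

/-- The trees embed if and only if some pair of partial assignments makes every clause true. -/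
theorem reduction_isoToSubtree_iff (hd : 2 ≤ d) :
    ((reductionShape d n m cs 0).tree (reductionShape_valid hd (Nat.zero_le 1))).IsoToSubtree
      ((reductionShape d n m cs 1).tree (reductionShape_valid hd le_rfl)) ↔
    ∃ i < d ^ Nat.clog d (2 ^ ((n + 1) / 2)), ∃ i' < d ^ Nat.clog d (2 ^ ((n + 1) / 2)),
      ∀ c < 2 ^ Nat.clog 2 m, clauseValue 0 i (cs (c % m)) = 0 →
        1 - clauseValue 1 i' (cs (c % m)) = 0 :=
  Shape.isoToSubtree_iff (reductionShape_valid hd (Nat.zero_le 1)) (reductionShape_valid hd le_rfl)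
    (a := fun i c => clauseValue 0 i (cs (c % m)))
    (b := fun i c => 1 - clauseValue 1 i (cs (c % m)))
    reductionShape_zero_β reductionShape_one_β

end

/-- The codes of the literals of the clauses of a formula. -/
def KCNF.codes {k n : ℕ} (φ : KCNF k n) (c : ℕ) : List ℕ := (φ.clauses.getD c []).map Literal.code

section
variable {k n : ℕ} (φ : KCNF k n)

theorem KCNF.codes_length_le (c : ℕ) : (φ.codes c).length ≤ k := by
  rw [KCNF.codes, List.length_map, List.getD_eq_getElem?_getD]
  rcases h : φ.clauses[c]? with _ | l
  · exact Nat.zero_le _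
  · exact φ.width_le l (List.mem_of_getElem? h)

/-- Correctness of the reduction. -/
theorem KCNF.satisfiable_iff {d : ℕ} (hd : 2 ≤ d) (hm : 0 < φ.clauses.length) :
    ((reductionShape d n φ.clauses.length φ.codes 0).tree
      (reductionShape_valid hd (Nat.zero_le 1))).IsoToSubtree
      ((reductionShape d n φ.clauses.length φ.codes 1).tree (reductionShape_valid hd le_rfl)) ↔
    φ.Satisfiable := by
  rw [reduction_isoToSubtree_iff hd]
  have hcode : ∀ {c : ℕ} (hc : c < φ.clauses.length), φ.codes c = φ.clauses[c].map Literal.code :=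
    fun hc => by rw [KCNF.codes, List.getD_eq_getElem _ _ hc]
  have hN : 2 ^ ((n + 1) / 2) ≤ d ^ Nat.clog d (2 ^ ((n + 1) / 2)) := Nat.le_pow_clog (by omega) _
  constructor
  · rintro ⟨i, -, i', -, h⟩
    refine ⟨fun x => if (x : ℕ) % 2 = 0 then i.testBit ((x : ℕ) / 2) else i'.testBit ((x : ℕ) / 2),
      fun cl hcl => ?_⟩
    obtain ⟨c, hc, rfl⟩ := List.getElem_of_mem hcl
    have h := h c (hc.trans_le (Nat.le_pow_clog (by omega) _))
    rw [Nat.mod_eq_of_lt hc, hcode hc] at h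
    by_cases h0 : clauseValue 0 i (φ.clauses[c].map Literal.code) = 0
    · have h1 : clauseValue 1 i' (φ.clauses[c].map Literal.code) ≠ 0 := by have := h h0; omega
      rw [Ne, clauseValue_eq_zero_iff] at h1
      push Not at h1
      obtain ⟨z, hz, hz'⟩ := h1
      obtain ⟨l, hl, rfl⟩ := List.mem_map.1 hz
      obtain ⟨h2, h3⟩ := l.code_true_iff.1 hz'
      exact ⟨l, hl, (if_neg (by omega)).trans h3⟩
    · rw [clauseValue_eq_zero_iff] at h0
      push Not at h0
      obtain ⟨z, hz, hz'⟩ := h0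
      obtain ⟨l, hl, rfl⟩ := List.mem_map.1 hz
      obtain ⟨h2, h3⟩ := l.code_true_iff.1 hz'
      exact ⟨l, hl, (if_pos h2).trans h3⟩
  · rintro ⟨a, ha⟩
    -- bit `j` of the partial assignment of parity `h` is the value of the variable `2 * j + h`
    have key : ∀ h ≤ 1, ∃ i < 2 ^ ((n + 1) / 2), ∀ x : Fin n, (x : ℕ) % 2 = h →
        i.testBit ((x : ℕ) / 2) = a x := by
      intro h hh
      refine ⟨Nat.ofBits (n := (n + 1) / 2) fun j =>
        if hj : 2 * (j : ℕ) + h < n then a ⟨2 * j + h, hj⟩ else false, Nat.ofBits_lt_two_pow _,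
        fun x hx => ?_⟩
      have := x.2
      rw [Nat.testBit_ofBits_lt _ _ (by omega), dif_pos (by simp only; omega)]
      congr 1
      ext
      simp only
      omega
    obtain ⟨i, hi, hi'⟩ := key 0 (Nat.zero_le 1)
    obtain ⟨j, hj, hj'⟩ := key 1 le_rfl
    refine ⟨i, hi.trans_le hN, j, hj.trans_le hN, fun c _ h0 => ?_⟩
    have hc : c % φ.clauses.length < φ.clauses.length := Nat.mod_lt _ hm
    rw [hcode hc] at h0 ⊢
    obtain ⟨l, hl, hal⟩ := ha _ (List.getElem_mem hc)
    have hmem : l.code ∈ φ.clauses[c % φ.clauses.length].map Literal.code :=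
      List.mem_map_of_mem hl
    have h1 : clauseValue 1 j (φ.clauses[c % φ.clauses.length].map Literal.code) ≠ 0 := by
      intro h1
      rcases Nat.mod_two_eq_zero_or_one l.1 with hx | hx
      · exact clauseValue_eq_zero_iff.1 h0 _ hmem
          (l.code_true_iff.2 ⟨hx, by rw [hi' _ hx, hal]⟩)
      · exact clauseValue_eq_zero_iff.1 h1 _ hmem
          (l.code_true_iff.2 ⟨hx, by rw [hj' _ hx, hal]⟩)
    omega

/-- The entries of a concatenation of lists. -/
theorem getElem?_flatMap_offset {α : Type*} (f : α → List ℕ) (l : List α) (w : ℕ → ℕ)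
    (hw : ∀ c (hc : c < l.length), w c = (f l[c]).length) {c : ℕ} (hc : c < l.length) {j : ℕ}
    (hj : j < (f l[c]).length) : (l.flatMap f)[offset w c + j]? = some (f l[c])[j] := by
  induction l generalizing w c with
  | nil => simp at hc
  | cons a l ih =>
    rw [List.flatMap_cons]
    rcases c with _ | c
    · rw [offset_zero, Nat.zero_add]
      simp only [List.getElem_cons_zero] at hj ⊢
      rw [List.getElem?_append_left hj, List.getElem?_eq_getElem hj]
    · have h0 : w 0 = (f a).length := hw 0 (by simp)
      have hs : offset w (c + 1) = (f a).length + offset (fun c => w (c + 1)) c := by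
        rw [offset, Finset.sum_range_succ', h0, Nat.add_comm]; rfl
      simp only [List.getElem_cons_succ] at hj ⊢
      rw [hs, Nat.add_assoc, List.getElem?_append_right (Nat.le_add_right _ _),
        Nat.add_sub_cancel_left]
      exact ih (fun c => w (c + 1)) (fun c hc => hw (c + 1) (by simpa using hc))
        (by simpa using hc) hj

theorem KCNF.encodesFormula : EncodesFormula φ.encode n φ.clauses.length φ.codes := by
  have hcode : ∀ {c : ℕ} (hc : c < φ.clauses.length), φ.codes c = φ.clauses[c].map Literal.code :=
    fun hc => by rw [KCNF.codes, List.getD_eq_getElem _ _ hc]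
  have key := fun {c : ℕ} (hc : c < φ.clauses.length) {j : ℕ} => getElem?_flatMap_offset
    (fun c : List (Literal n) => c.length :: c.map Literal.code) φ.clauses
    (fun c => (φ.codes c).length + 1) (fun c hc => by rw [hcode hc]; simp) hc (j := j)
  have hget : ∀ j, φ.encode[2 + j]? =
      (φ.clauses.flatMap fun c => c.length :: c.map Literal.code)[j]? := by
    intro j
    rw [KCNF.encode, Nat.add_comm]
    rfl
  refine ⟨rfl, rfl, fun c hc => ?_, fun c hc j hj => ?_, fun c hc z hz => ?_⟩
  · rw [clausePtr, hget]
    refine (key hc (j := 0) (by simp)).trans ?_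
    rw [hcode hc]
    simp
  · rw [clausePtr, Nat.add_assoc, Nat.add_assoc, hget]
    have h1 : 1 + j < (φ.clauses[c].length :: φ.clauses[c].map Literal.code).length := by
      rw [hcode hc, List.length_map] at hj
      simp; omega
    refine (key hc h1).trans ?_
    simp only [Nat.add_comm 1 j, List.getElem_cons_succ, hcode hc]
  · rw [hcode hc] at hz
    obtain ⟨l, -, rfl⟩ := List.mem_map.1 hz
    have := l.1.2
    rw [l.code_div_four]
    omega

/-- A formula has polynomially many clauses. -/
theorem KCNF.length_clauses_le : φ.clauses.length ≤ (2 * n + 1) ^ k := by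
  classical
  rw [← List.toFinset_card_of_nodup φ.nodup]
  have h := Finset.card_le_card_of_injOn (s := φ.clauses.toFinset)
    (t := (Finset.univ : Finset (Fin k → Option (Literal n)))) (fun c i => getElem? c (i : ℕ))
    (fun _ _ => Finset.mem_univ _) (by
      intro c hc c' hc' h
      refine List.ext_getElem? fun i => ?_
      rcases Nat.lt_or_ge i k with hi | hi
      · exact congrFun h ⟨i, hi⟩
      · have h1 := φ.width_le c (by simpa using hc)
        have h2 := φ.width_le c' (by simpa using hc')
        rw [List.getElem?_eq_none (by omega), List.getElem?_eq_none (by omega)])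
  simpa [Nat.mul_comm] using h

theorem KCNF.length_encode_le : φ.encode.length ≤ 2 + φ.clauses.length * (k + 1) := by
  have h : (φ.clauses.flatMap fun c => c.length :: c.map Literal.code).length ≤
      φ.clauses.length * (k + 1) := by
    rw [List.length_flatMap]
    refine (List.sum_le_card_nsmul _ (k + 1) ?_).trans (by simp)
    intro x hx
    obtain ⟨c, hc, rfl⟩ := List.mem_map.1 hx
    simpa using φ.width_le c hc
  simp only [KCNF.encode, List.length_cons]
  omega

theorem KCNF.encode_le {x : ℕ} (hx : x ∈ φ.encode) : x ≤ 2 * n + φ.clauses.length + k := by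
  simp only [KCNF.encode, List.mem_cons, List.mem_flatMap, List.mem_map] at hx
  rcases hx with rfl | rfl | ⟨c, hc, rfl | ⟨l, -, rfl⟩⟩
  · omega
  · omega
  · have := φ.width_le c hc; omega
  · have := l.1.2
    have := Bool.toNat_le l.2
    rw [Literal.code]; omega

end

/-! ### Size and running time -/

theorem pow_clog_le_mul {b x : ℕ} (hb : 1 < b) (hx : 0 < x) : b ^ Nat.clog b x ≤ b * x := by
  rcases Nat.eq_zero_or_pos (Nat.clog b x) with h | h
  · rw [h, pow_zero]; exact Nat.mul_pos (by omega) hx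
  · obtain ⟨e, he⟩ : ∃ e, Nat.clog b x = e + 1 := ⟨_, (Nat.succ_pred_eq_of_pos h).symm⟩
    rw [he, pow_succ, Nat.mul_comm]
    exact Nat.mul_le_mul_left _ (Nat.pow_lt_of_lt_clog (by omega)).le

namespace Shape
variable {D : Shape}

theorem width_mono (hD : D.Valid) : Monotone D.width := by
  refine monotone_nat_of_le_succ fun t => ?_
  have h1 := stem_le_width hD t
  have h2 := Nat.le_mul_of_pos_right (D.width t - D.stem t) (show 0 < D.d by
    have := hD.two_le_d; omega)
  rw [width_succ]
  omega

theorem width_le (hD : D.Valid) (t : ℕ) : D.width t ≤ 2 * D.d ^ D.L * D.slots := by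
  have h1 : D.width t ≤ D.width D.arm := (width_mono hD (Nat.le_add_right t D.arm)).trans
    (width_of_arm_le (Nat.le_add_left D.arm t)).le
  refine h1.trans ?_
  rw [width_arm_eq, width_two_mul hD]
  refine Nat.mul_le_mul_right _ ?_
  have := Nat.mul_le_mul_right (D.d ^ D.L) hD.h_le
  omega

theorem numVertices_le (hD : D.Valid) :
    D.numVertices ≤ (2 * D.L + 5 * D.κ + 6) * (2 * D.d ^ D.L * D.slots) := by
  have h1 : D.numVertices ≤ (D.top + 1 + (D.κ + 1)) * (2 * D.d ^ D.L * D.slots) := by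
    rw [numVertices, off, offset]
    refine (Finset.sum_le_card_nsmul _ _ _ fun t _ => width_le hD t).trans ?_
    rw [Finset.card_range, smul_eq_mul]
  refine h1.trans (Nat.mul_le_mul_right _ ?_)
  have := hD.h_le
  unfold top arm
  omega

end Shape

/-- The instance of Subtree Isomorphism that the reduction makes. As the trees have at least
`d ^ (L + 2 * (κ + 1))` vertices, twice the logarithm of their number exceeds the height
`2 * L + 4 * (κ + 1)`, and the term `log (log n)` is only needed to be nonnegative. -/
def reductionInstance (d n m : ℕ) (cs : ℕ → List ℕ) (hd : 2 ≤ d) : BoundedInstance d 1 :=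
  have key : ∀ h (hh : h ≤ 1), (((reductionShape d n m cs h).tree
      (reductionShape_valid hd hh)).height : ℝ) ≤
      2 * Real.logb d (((reductionShape d n m cs 0).numVertices +
        (reductionShape d n m cs 1).numVertices : ℕ) : ℝ) +
      1 * Real.log (Real.log (((reductionShape d n m cs 0).numVertices +
        (reductionShape d n m cs 1).numVertices : ℕ) : ℝ)) := by
    intro h hh
    have h1 := Shape.tree_height_le (reductionShape_valid (n := n) (m := m) (cs := cs) hd hh)
    have h2 := Shape.pow_le_numVertices
      (reductionShape_valid (n := n) (m := m) (cs := cs) hd (Nat.zero_le 1))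
    set S := (reductionShape d n m cs 0).numVertices + (reductionShape d n m cs 1).numVertices
    set e := (reductionShape d n m cs 0).L + 2 * ((reductionShape d n m cs 0).κ + 1) with he
    have h1' : ((reductionShape d n m cs h).tree (reductionShape_valid hd hh)).height ≤ 2 * e := by
      refine h1.trans ?_
      change 2 * (reductionShape d n m cs 0).L + 4 * ((reductionShape d n m cs 0).κ + 1) ≤ _
      omega
    have h3 : d ^ e ≤ S := h2.trans (Nat.le_add_right _ _)
    have h4 : 4 ≤ S := by
      have h5 : 2 ^ 2 ≤ d ^ e :=
        (Nat.pow_le_pow_left hd 2).trans (Nat.pow_le_pow_right (by omega) (by omega))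
      omega
    have h5 : (e : ℝ) ≤ Real.logb d (S : ℝ) := by
      rw [Real.le_logb_iff_rpow_le (by exact_mod_cast hd) (by positivity), Real.rpow_natCast]
      exact_mod_cast h3
    have h6 : 0 ≤ Real.log (Real.log (S : ℝ)) := by
      refine Real.log_nonneg ?_
      rw [Real.le_log_iff_exp_le (by positivity)]
      have h7 : (4 : ℝ) ≤ S := by exact_mod_cast h4
      have := Real.exp_one_lt_d9
      linarith
    have h8 : (((reductionShape d n m cs h).tree
      (reductionShape_valid hd hh)).height : ℝ) ≤ 2 * e := by exact_mod_cast h1'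
    linarith
  { H := (reductionShape d n m cs 0).tree (reductionShape_valid hd (Nat.zero_le 1))
    G := (reductionShape d n m cs 1).tree (reductionShape_valid hd le_rfl)
    degree_H := Shape.tree_degreeLE _
    degree_G := Shape.tree_degreeLE _
    height_H := key 0 (Nat.zero_le 1)
    height_G := key 1 le_rfl }

/-! The following bounds are defined over all commutative semirings, so that they can be read both
as numbers and as polynomials in the number `x` of variables. -/

section bounds
variable {R : Type*} [CommSemiring R] (d k : ℕ) (x : R)

/-- A bound on the number of clauses. -/
def clauseBound : R := (2 * x + 1) ^ k

/-- A bound on the number of slots. -/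
def slotBound : R := (4 * clauseBound k x) ^ (2 * d)

/-- A bound on the number of levels of the trees. -/
def levelBound : R := 2 * (x + 1) + 5 * clauseBound k x + 6

/-- A bound on the number of vertices of a tree, divided by the number of partial assignments. -/
def vertexBound : R := levelBound k x * (2 * d * slotBound d k x)

/-- A bound on the number of memory cells that do not hold the trees. -/
def lengthBound : R := 2 + clauseBound k x * (k + 1) + (x + 1) + clauseBound k x + 2

/-- A bound on the numbers that occur, divided by the number of partial assignments. -/
def numberBound : R :=
  4 + d + (2 * x + clauseBound k x + k + 1) + d + 2 * clauseBound k x + slotBound d k x +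
    (lengthBound k x + 2 * vertexBound d k x)

/-- A bound on the number of steps of the reduction, divided by the number of partial
assignments. -/
def stepBound : R :=
  (4 * (x + 1) + 4 * clauseBound k x + 8 + 2 * (4 * levelBound k x + 13) +
    2 * lengthBound k x + 6) +
    (4 * levelBound k x + 2 * (2 * k + 4) + 4) * vertexBound d k x

end bounds

section
variable {k n : ℕ} (φ : KCNF k n) {d : ℕ}

theorem clauseBound_pos : 0 < clauseBound k n := Nat.pow_pos (by omega)

/-- The sizes of the trees and of their parts. -/
theorem KCNF.shape_bounds (hd : 2 ≤ d) (hm : 0 < φ.clauses.length) {h : ℕ} (hh : h ≤ 1) :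
    (reductionShape d n φ.clauses.length φ.codes h).slots ≤ slotBound d k n ∧
    d ^ (reductionShape d n φ.clauses.length φ.codes h).L ≤ d * 2 ^ ((n + 1) / 2) ∧
    2 ^ (reductionShape d n φ.clauses.length φ.codes h).κ ≤ 2 * clauseBound k n ∧
    (reductionShape d n φ.clauses.length φ.codes h).L ≤ (n + 1) / 2 ∧
    (reductionShape d n φ.clauses.length φ.codes h).κ ≤ φ.clauses.length ∧
    (reductionShape d n φ.clauses.length φ.codes h).numVertices ≤
      vertexBound d k n * 2 ^ ((n + 1) / 2) := by
  have hmB : φ.clauses.length ≤ clauseBound k n := φ.length_clauses_le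
  have hN : d ^ (reductionShape d n φ.clauses.length φ.codes h).L ≤ d * 2 ^ ((n + 1) / 2) :=
    pow_clog_le_mul (by omega) (by positivity)
  have hQ : 2 ^ (reductionShape d n φ.clauses.length φ.codes h).κ ≤ 2 * clauseBound k n :=
    (pow_clog_le_mul (by omega) hm).trans (Nat.mul_le_mul_left 2 hmB)
  have hL : (reductionShape d n φ.clauses.length φ.codes h).L ≤ (n + 1) / 2 :=
    Nat.clog_le_of_le_pow (Nat.pow_le_pow_left hd _)
  have hκ : (reductionShape d n φ.clauses.length φ.codes h).κ ≤ φ.clauses.length :=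
    Nat.clog_le_of_le_pow (Nat.lt_pow_self (by omega)).le
  have hE : (reductionShape d n φ.clauses.length φ.codes h).slots ≤ slotBound d k n := by
    calc (reductionShape d n φ.clauses.length φ.codes h).slots
        ≤ (2 ^ d) ^ (2 * ((reductionShape d n φ.clauses.length φ.codes h).κ + 1)) :=
          Nat.pow_le_pow_left (Nat.lt_pow_self (by omega)).le _
      _ = (2 * 2 ^ (reductionShape d n φ.clauses.length φ.codes h).κ) ^ (2 * d) := by
          rw [← pow_succ', ← pow_mul, ← pow_mul]; congr 1; ring
      _ ≤ slotBound d k n := Nat.pow_le_pow_left (by omega) _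
  refine ⟨hE, hN, hQ, hL, hκ, ?_⟩
  refine (Shape.numVertices_le (reductionShape_valid hd hh)).trans ?_
  calc _ ≤ levelBound k n * (2 * (d * 2 ^ ((n + 1) / 2)) * slotBound d k n) := by
        refine Nat.mul_le_mul ?_ (Nat.mul_le_mul (Nat.mul_le_mul_left 2 hN) hE)
        have : levelBound k n = 2 * (n + 1) + 5 * clauseBound k n + 6 := rfl
        omega
    _ = vertexBound d k n * 2 ^ ((n + 1) / 2) := by
        simp only [vertexBound, Nat.cast_id]; ring

theorem le_numberBound_mul {a : ℕ} (h : a ≤ numberBound d k n) :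
    a ≤ numberBound d k n * 2 ^ ((n + 1) / 2) :=
  h.trans (Nat.le_mul_of_pos_right _ (by positivity))

theorem KCNF.encode_lt_numberBound : ∀ x ∈ φ.encode, x + 1 ≤ numberBound d k n := by
  intro x hx
  have h1 := φ.encode_le hx
  have hmB : φ.clauses.length ≤ clauseBound k n := φ.length_clauses_le
  simp only [numberBound, Nat.cast_id]
  omega

theorem KCNF.length_encode_add_le :
    φ.encode.length + (n + 1) / 2 + φ.clauses.length + 2 ≤ lengthBound k n := by
  have h1 := φ.length_encode_le
  have hmB : φ.clauses.length ≤ clauseBound k n := φ.length_clauses_le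
  have h2 := Nat.mul_le_mul_right (k + 1) hmB
  simp only [lengthBound, Nat.cast_id]
  omega

theorem lengthBound_le : lengthBound k n ≤ numberBound d k n := by
  simp only [numberBound]; omega

theorem KCNF.reductionBounds (hd : 2 ≤ d) (hm : 0 < φ.clauses.length) :
    ReductionBounds (numberBound d k n * 2 ^ ((n + 1) / 2)) d φ.encode n φ.clauses.length
      φ.codes := by
  obtain ⟨hE, hN, hQ, hL, hκ, hV⟩ := φ.shape_bounds hd hm (Nat.zero_le 1)
  obtain ⟨-, -, -, -, -, hV'⟩ := φ.shape_bounds hd hm le_rfl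
  have hlen := φ.length_encode_add_le
  refine ⟨le_numberBound_mul ?_, hd, le_numberBound_mul ?_, hm, φ.encodesFormula,
    fun x hx => le_numberBound_mul (φ.encode_lt_numberBound x hx), hN.trans ?_,
    le_numberBound_mul (hQ.trans ?_), le_numberBound_mul (hE.trans ?_), ?_⟩
  · simp only [numberBound]; omega
  · simp only [numberBound, Nat.cast_id]; omega
  · refine Nat.mul_le_mul_right _ ?_
    simp only [numberBound, Nat.cast_id]; omega
  · simp only [numberBound]; omega
  · simp only [numberBound]; omega
  · calc _ ≤ lengthBound k n + 2 * (vertexBound d k n * 2 ^ ((n + 1) / 2)) := by omega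
      _ ≤ lengthBound k n * 2 ^ ((n + 1) / 2) +
          2 * (vertexBound d k n * 2 ^ ((n + 1) / 2)) :=
        Nat.add_le_add_right (Nat.le_mul_of_pos_right _ (by positivity)) _
      _ = (lengthBound k n + 2 * vertexBound d k n) * 2 ^ ((n + 1) / 2) := by ring
      _ ≤ _ := by
        refine Nat.mul_le_mul_right _ ?_
        simp only [numberBound]; omega

theorem KCNF.reductionTime_le (hd : 2 ≤ d) (hm : 0 < φ.clauses.length) :
    reductionTime d n φ.clauses.length k φ.codes φ.encode.length ≤
      stepBound d k n * 2 ^ ((n + 1) / 2) := by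
  have hlen := φ.length_encode_add_le
  have hmB : φ.clauses.length ≤ clauseBound k n := φ.length_clauses_le
  have hT : 0 < 2 ^ ((n + 1) / 2) := by positivity
  have hlev : levelBound k n = 2 * (n + 1) + 5 * clauseBound k n + 6 := rfl
  set T := 2 ^ ((n + 1) / 2) with hT'
  have key : ∀ h ≤ 1,
      ((reductionShape d n φ.clauses.length φ.codes h).top +
        (reductionShape d n φ.clauses.length φ.codes h).κ) *
        (2 * (reductionShape d n φ.clauses.length φ.codes h).numVertices + 4) +
      (reductionShape d n φ.clauses.length φ.codes h).numVertices * (2 * k + 4) + 13 ≤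
      levelBound k n * (2 * (vertexBound d k n * T) + 4) +
        vertexBound d k n * T * (2 * k + 4) + 13 := by
    intro h hh
    obtain ⟨hE, hN, hQ, hL, hκ, hV⟩ := φ.shape_bounds hd hm hh
    have h1 : (reductionShape d n φ.clauses.length φ.codes h).top +
        (reductionShape d n φ.clauses.length φ.codes h).κ ≤ levelBound k n := by
      have : (reductionShape d n φ.clauses.length φ.codes h).h = h := rfl
      unfold Shape.top Shape.arm
      omega
    gcongr
  obtain ⟨hE, hN, hQ, hL, hκ, hV⟩ := φ.shape_bounds hd hm (Nat.zero_le 1)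
  obtain ⟨-, -, -, -, -, hV'⟩ := φ.shape_bounds hd hm le_rfl
  rw [← hT'] at hV hV'
  have k0 := key 0 (Nat.zero_le 1)
  have k1 := key 1 le_rfl
  have hA := Nat.le_mul_of_pos_right (4 * (n + 1) + 4 * clauseBound k n + 8 +
    2 * (4 * levelBound k n + 13) + 2 * lengthBound k n + 6) hT
  calc reductionTime d n φ.clauses.length k φ.codes φ.encode.length
      ≤ (4 * (n + 1) + 4 * clauseBound k n + 8) +
        2 * (levelBound k n * (2 * (vertexBound d k n * T) + 4) +
        vertexBound d k n * T * (2 * k + 4) + 13) +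
        (2 * (lengthBound k n + 2 * (vertexBound d k n * T)) + 6) := by
          unfold reductionTime; omega
    _ = (4 * (n + 1) + 4 * clauseBound k n + 8 +
        2 * (4 * levelBound k n + 13) + 2 * lengthBound k n + 6) +
        (4 * levelBound k n + 2 * (2 * k + 4) + 4) * vertexBound d k n * T := by ring
    _ ≤ _ := Nat.add_le_add_right hA _
    _ = _ := by simp only [stepBound, Nat.cast_id]; ring

theorem unitCost_le : unitCost (numberBound d k n * 2 ^ ((n + 1) / 2)) ≤
    2 ^ 64 * (numberBound d k n + n + 1) := by
  refine Nat.mul_le_mul_left _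
    ((Nat.size_le.2 ?_).trans (show numberBound d k n + (n + 1) / 2 ≤ _ by omega))
  rw [pow_add]
  exact Nat.mul_lt_mul_of_pos_right (Nat.lt_pow_self (by omega)) (by positivity)

end

/-! ### The algorithm for satisfiability -/

open Polynomial in
/-- The bounds are polynomials in the number of variables. -/
theorem exists_polynomial_bound (d k c : ℕ) : ∃ q : ℕ[X], ∀ n : ℕ, q.eval n =
    (stepBound d k n + 2) * (2 ^ 64 * (numberBound d k n + n + 1)) * 2 +
      c * (4 * vertexBound d k n) ^ 2 := by
  refine ⟨(stepBound d k X + 2) * (2 ^ 64 * (numberBound d k X + X + 1)) * 2 +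
    (c : ℕ[X]) * (4 * vertexBound d k X) ^ 2, fun n => ?_⟩
  simp [stepBound, numberBound, vertexBound, lengthBound, levelBound, slotBound, clauseBound]

theorem two_pow_half_le (n : ℕ) :
    (2 : ℝ) ^ ((n + 1) / 2) ≤ 2 * (2 : ℝ) ^ ((n : ℝ) / 2) := by
  rw [← Real.rpow_natCast, ← Real.rpow_one_add' (by norm_num) (by positivity)]
  refine Real.rpow_le_rpow_of_exponent_le (by norm_num) ?_
  have : (((n + 1) / 2 : ℕ) : ℝ) ≤ ((n + 1 : ℕ) : ℝ) / 2 := Nat.cast_div_le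
  push_cast at this
  linarith

/-- A subquadratic time bound for trees with about `2 ^ (n / 2)` vertices. -/
theorem subquadratic_le {c ε W S y : ℝ} (hε : 0 < ε) (hS : 1 ≤ S) (hW : 1 ≤ W)
    (hSW : S ≤ W * (2 : ℝ) ^ (y / 2)) :
    c * S ^ (2 - ε) ≤ |c| * W ^ 2 * (2 : ℝ) ^ ((1 - min ε 1 / 2) * y) := by
  have h1 : 0 < min ε 1 := lt_min hε one_pos
  have h2 : min ε 1 ≤ 1 := min_le_right _ _
  calc c * S ^ (2 - ε) ≤ |c| * S ^ (2 - min ε 1) := by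
        refine mul_le_mul (le_abs_self c) ?_ (by positivity) (abs_nonneg c)
        exact Real.rpow_le_rpow_of_exponent_le hS (by linarith [min_le_left ε 1])
    _ ≤ |c| * (W * (2 : ℝ) ^ (y / 2)) ^ (2 - min ε 1) := by
        refine mul_le_mul_of_nonneg_left ?_ (abs_nonneg c)
        exact Real.rpow_le_rpow (by linarith) hSW (by linarith)
    _ = |c| * W ^ (2 - min ε 1) * (2 : ℝ) ^ ((1 - min ε 1 / 2) * y) := by
        rw [Real.mul_rpow (by linarith) (by positivity), ← Real.rpow_mul (by norm_num), mul_assoc]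
        congr 3
        ring
    _ ≤ _ := by
        refine mul_le_mul_of_nonneg_right ?_ (by positivity)
        refine mul_le_mul_of_nonneg_left ?_ (abs_nonneg c)
        rw [← Real.rpow_two]
        exact Real.rpow_le_rpow_of_exponent_le hW (by linarith)

/-- The algorithm for `k`-SAT: it answers yes if there are no clauses, and otherwise it runs the
reduction and the algorithm `p` for Subtree Isomorphism. -/
def satProg (d : ℕ) (p : Prog) : Prog :=
  .seq (block clauseNumberCode)
    (.ite Reg.m (.seq (reductionProg d) p) (block [.const Reg.out 1]))

section
variable {k n : ℕ} (φ : KCNF k n) {d : ℕ}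

theorem vertexBound_pos (hd : 2 ≤ d) : 0 < vertexBound d k n := by
  have := clauseBound_pos (k := k) (n := n)
  simp only [vertexBound, slotBound, levelBound, Nat.cast_id]
  positivity

theorem KCNF.satisfiable_of_clauses_eq_nil (h : φ.clauses.length = 0) : φ.Satisfiable :=
  ⟨fun _ => false, by simp [List.length_eq_zero_iff.1 h]⟩

/-- The running time of the algorithm for `k`-SAT, apart from the time of the algorithm for
Subtree Isomorphism. -/
def satTime (d k n : ℕ) : ℕ :=
  (stepBound d k n + 2) * (2 ^ 64 * (numberBound d k n + n + 1)) * 2 ^ ((n + 1) / 2)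

theorem four_le_numberBound : 4 ≤ numberBound d k n * 2 ^ ((n + 1) / 2) :=
  le_numberBound_mul (by simp only [numberBound]; omega)

theorem KCNF.length_clauses_le_numberBound :
    φ.clauses.length ≤ numberBound d k n * 2 ^ ((n + 1) / 2) := by
  have hlen := φ.length_encode_add_le
  have hlen' := lengthBound_le (d := d) (k := k) (n := n)
  exact le_numberBound_mul (by omega)

theorem KCNF.encode_le_numberBound :
    ∀ x ∈ φ.encode, x ≤ numberBound d k n * 2 ^ ((n + 1) / 2) :=
  fun x hx => le_numberBound_mul ((Nat.le_succ x).trans (φ.encode_lt_numberBound x hx))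

theorem KCNF.steps_start :
    Steps (numberBound d k n * 2 ^ ((n + 1) / 2)) (block clauseNumberCode) (startState φ.encode)
      (conf {Vars.init φ.encode.length with m := φ.clauses.length} φ.encode) 1 := by
  have hlen := φ.length_encode_add_le
  have hlen' := lengthBound_le (d := d) (k := k) (n := n)
  exact steps_clauseNumber four_le_numberBound (le_numberBound_mul (by omega))
    φ.encode_le_numberBound rfl

theorem le_satTime {t j : ℕ}
    (h : t ≤ (j + 2) * unitCost (numberBound d k n * 2 ^ ((n + 1) / 2)))
    (hj : j ≤ stepBound d k n * 2 ^ ((n + 1) / 2)) : t ≤ satTime d k n := by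
  have hT : 0 < 2 ^ ((n + 1) / 2) := by positivity
  have h2 : j + 2 ≤ (stepBound d k n + 2) * 2 ^ ((n + 1) / 2) := by
    rw [Nat.add_mul]; omega
  refine h.trans ((Nat.mul_le_mul h2 unitCost_le).trans ?_)
  rw [satTime, Nat.mul_right_comm]

theorem KCNF.exec_satProg_nil (p : Prog) (hm : φ.clauses.length = 0) :
    ∃ s t, Exec (satProg d p) (startState φ.encode) s t ∧ t ≤ satTime d k n ∧ s.reg 0 ≠ 0 := by
  obtain ⟨t₁, ht₁, e₁⟩ := φ.steps_start (d := d)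
  have hM := four_le_numberBound (d := d) (k := k) (n := n)
  have hlen := φ.length_encode_add_le
  have hlen' := lengthBound_le (d := d) (k := k) (n := n)
  obtain ⟨t₂, ht₂, e₂⟩ := Steps.block (M := numberBound d k n * 2 ^ ((n + 1) / 2))
    (is := [.const Reg.out 1]) (v := {Vars.init φ.encode.length with m := φ.clauses.length})
    (l := φ.encode) (v' := {Vars.init 1 with m := φ.clauses.length}) (l' := φ.encode) hM
    {Vars.init_boundedBy (o := φ.encode.length) (le_numberBound_mul (by omega)) with
      m := φ.length_clauses_le_numberBound} φ.encode_le_numberBound (by decide) rfl rfl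
  refine ⟨_, _, .seq e₁ (.ite_false (i := Reg.m) hm e₂), ?_, Nat.one_ne_zero⟩
  have h1 := size_le_unitCost (by omega) (Nat.zero_le (numberBound d k n * 2 ^ ((n + 1) / 2)))
  refine le_satTime (j := 1) (by omega) ?_
  exact Nat.mul_pos (by simp only [stepBound]; omega) (by positivity)

theorem KCNF.exec_satProg (p : Prog) (hd : 2 ≤ d) (hm : 0 < φ.clauses.length) {s : State} {u : ℕ}
    (hp : Exec p (startState (reductionOutput d n φ.clauses.length φ.codes hd)) s u) :
    ∃ t, Exec (satProg d p) (startState φ.encode) s (t + u) ∧ t ≤ satTime d k n := by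
  obtain ⟨t₁, ht₁, e₁⟩ := φ.steps_start (d := d)
  obtain ⟨t₂, ht₂, e₂⟩ := steps_reduction (φ.reductionBounds hd hm) (K := k)
    fun c _ => φ.codes_length_le c
  have hM := four_le_numberBound (d := d) (k := k) (n := n)
  have hsize := size_le_unitCost (by omega) (φ.length_clauses_le_numberBound (d := d))
  have e := Exec.seq e₁ (.ite_true (i := Reg.m) (q := block [.const Reg.out 1]) hm.ne'
    (.seq e₂ hp))
  change Exec (satProg d p) _ _ (t₁ + (1 + φ.clauses.length.size + (t₂ + u))) at e
  refine ⟨t₁ + (1 + φ.clauses.length.size + t₂), ?_,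
    le_satTime (j := reductionTime d n φ.clauses.length k φ.codes φ.encode.length) ?_
      (φ.reductionTime_le hd hm)⟩
  · rwa [show t₁ + (1 + φ.clauses.length.size + t₂) + u =
      t₁ + (1 + φ.clauses.length.size + (t₂ + u)) by omega]
  · rw [Nat.add_mul]; omega

end

/-- An algorithm for Subtree Isomorphism in time `O(n ^ (2 - ε))` yields algorithms for `k`-SAT, for
all `k`, in time `2 ^ ((1 - min ε 1 / 2) * n)`, up to a polynomial factor. -/
theorem solvesInTime_satProg {d : ℕ} (hd : 2 ≤ d) {ε : ℝ} (hε : 0 < ε) {p : Prog} {c : ℝ}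
    (hp : SolvesInTime (ι := BoundedInstance d 1) p (fun x => x.H.encode ++ x.G.encode)
      (fun x => x.H.IsoToSubtree x.G) (fun x => c * (x.numVerts : ℝ) ^ (2 - ε))) (k : ℕ) :
    ∃ q : Polynomial ℕ, SolvesInTime (ι := Σ n : ℕ, KCNF k n) (satProg d p) (fun x => x.2.encode)
      (fun x => x.2.Satisfiable)
      (fun x => (2 : ℝ) ^ ((1 - min ε 1 / 2) * (x.1 : ℝ)) * ((q.eval x.1 : ℕ) : ℝ)) := by
  obtain ⟨q, hq⟩ := exists_polynomial_bound d k ⌈|c|⌉₊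
  refine ⟨q, ?_⟩
  rintro ⟨n, φ⟩
  dsimp only
  rw [hq]
  set P : ℝ := (2 : ℝ) ^ ((1 - min ε 1 / 2) * (n : ℝ)) with hP
  have hP0 : 0 < P := by positivity
  have hhalf : (2 : ℝ) ^ ((n : ℝ) / 2) ≤ P := by
    refine Real.rpow_le_rpow_of_exponent_le (by norm_num) ?_
    have h1 : 1 / 2 ≤ 1 - min ε 1 / 2 := by linarith [min_le_right ε 1]
    have := mul_le_mul_of_nonneg_right h1 (Nat.cast_nonneg (α := ℝ) n)
    linarith
  have hW := vertexBound_pos (k := k) (n := n) hd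
  -- the time of the reduction
  have hred : ((satTime d k n : ℕ) : ℝ) ≤ P *
      (((stepBound d k n + 2) * (2 ^ 64 * (numberBound d k n + n + 1)) * 2 : ℕ) : ℝ) := by
    have h1 := (two_pow_half_le n).trans (mul_le_mul_of_nonneg_left hhalf zero_le_two)
    have h2 := mul_le_mul_of_nonneg_left h1 (Nat.cast_nonneg (α := ℝ)
      ((stepBound d k n + 2) * (2 ^ 64 * (numberBound d k n + n + 1))))
    rw [satTime]
    push_cast at h2 ⊢
    linarith
  rcases Nat.eq_zero_or_pos φ.clauses.length with hm | hm
  · obtain ⟨s, t, he, ht, hs⟩ := φ.exec_satProg_nil (d := d) p hm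
    refine ⟨s, t, he, ?_, fun _ => φ.satisfiable_of_clauses_eq_nil hm, fun _ => hs⟩
    refine ((Nat.cast_le.2 ht).trans hred).trans (mul_le_mul_of_nonneg_left ?_ hP0.le)
    exact Nat.cast_le.2 (Nat.le_add_right _ _)
  · obtain ⟨s, u, he, hu, hs⟩ := hp (reductionInstance d n φ.clauses.length φ.codes hd)
    obtain ⟨t, het, ht⟩ := φ.exec_satProg p hd hm he
    refine ⟨s, t + u, het, ?_, hs.trans (φ.satisfiable_iff hd hm)⟩
    set S := (reductionInstance d n φ.clauses.length φ.codes hd).numVerts with hS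
    have hS' : S = (reductionShape d n φ.clauses.length φ.codes 0).numVertices +
      (reductionShape d n φ.clauses.length φ.codes 1).numVertices := rfl
    obtain ⟨-, -, -, -, -, hV⟩ := φ.shape_bounds hd hm (Nat.zero_le 1)
    obtain ⟨-, -, -, -, -, hV'⟩ := φ.shape_bounds hd hm le_rfl
    have hSpos : 0 < S := by
      have := Shape.numVertices_pos (reductionShape_valid (n := n) (m := φ.clauses.length)
        (cs := φ.codes) hd (Nat.zero_le 1))
      omega
    have hSle : (S : ℝ) ≤ ((4 * vertexBound d k n : ℕ) : ℝ) * (2 : ℝ) ^ ((n : ℝ) / 2) := by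
      have h1 : S ≤ 2 * vertexBound d k n * 2 ^ ((n + 1) / 2) := by
        rw [hS', Nat.mul_assoc]; omega
      have h2 : (S : ℝ) ≤ 2 * (vertexBound d k n : ℕ) * (2 : ℝ) ^ ((n + 1) / 2) := by
        exact_mod_cast h1
      have h3 := mul_le_mul_of_nonneg_left (two_pow_half_le n)
        (Nat.cast_nonneg (α := ℝ) (2 * vertexBound d k n))
      push_cast at h3 ⊢
      linarith
    have h1 := subquadratic_le (c := c) hε (by exact_mod_cast hSpos)
      (show (1 : ℝ) ≤ ((4 * vertexBound d k n : ℕ) : ℝ) by exact_mod_cast (by omega)) hSle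
    have h2 : |c| * ((4 * vertexBound d k n : ℕ) : ℝ) ^ 2 * P ≤
        (⌈|c|⌉₊ : ℝ) * ((4 * vertexBound d k n : ℕ) : ℝ) ^ 2 * P := by
      gcongr
      exact Nat.le_ceil _
    have h3 : (t : ℝ) ≤ (satTime d k n : ℕ) := Nat.cast_le.2 ht
    rw [Nat.cast_add, Nat.cast_add, mul_add]
    have h4 : ((⌈|c|⌉₊ * (4 * vertexBound d k n) ^ 2 : ℕ) : ℝ) =
        (⌈|c|⌉₊ : ℝ) * ((4 * vertexBound d k n : ℕ) : ℝ) ^ 2 := by push_cast; ring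
    rw [h4]
    linarith

end SubtreeLB

open SubtreeLB
/-- Under SETH, Subtree Isomorphism has no truly subquadratic algorithm, even on trees of degree at
most `d` and height at most `2 * log_d n + C * log (log n)`. -/
theorem theorem1 (hSETH : SETH) (d : ℕ) (hd : 2 ≤ d) :
    ∃ C : ℝ, 0 < C ∧ ∀ ε : ℝ, 0 < ε →
      ¬ ∃ (p : Prog) (c : ℝ),
        SolvesInTime (ι := BoundedInstance d C) p
          (fun x => x.H.encode ++ x.G.encode)
          (fun x => x.H.IsoToSubtree x.G)
          (fun x => c * (x.numVerts : ℝ) ^ (2 - ε)) := by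
  refine ⟨1, one_pos, fun ε hε => ?_⟩
  rintro ⟨p, c, hp⟩
  obtain ⟨k, hk⟩ := hSETH (min ε 1 / 2) (half_pos (lt_min hε one_pos))
  obtain ⟨q, hq⟩ := solvesInTime_satProg hd hε hp k
  exact hk ⟨satProg d p, q, hq⟩
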